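/- **Setting.** Let $\alpha\in(0,1]$, $\tau\ge 0$, let $\mu$ be the normalized surface measure on the unit sphere $\mathbb S^2\subset\mathbb R^3$, and let $(\Omega,\mathcal F,\mathbb P)$ be a probability space. Let $\{Y_{\ell,m}:\ell\ge 0,\,-\ell\le m\le\ell\}$ be the complex spherical harmonics, orthonormal in $L_2(\mathbb S^2,\mu)$: in spherical coordinates $$Y_{\ell,m}=\sqrt{\tfrac{(2\ell+1)(\ell-m)!}{(\ell+m)!}}\;P_{\ell,m}(\cos\theta)\,e^{\mathrm i m\varphi}\quad(m\ge0),\qquad Y_{\ell,m}=(-1)^m\overline{Y_{\ell,-m}}\quad(m<0),$$ where $P_{\ell,m}(s)=(-1)^m(1-s^2)^{m/2}P_\ell^{(m)}(s)$ and $P_\ell$ is the Legendre polynomial. Put $\lambda_\ell=\ell(\ell+1)$ and $\widehat f_{\ell,m}=\int f\,\overline{Y_{\ell,m}}\,d\mu$, and let $E_\alpha(z)=\sum_{k\ge0}z^k/\Gamma(\alpha k+1)$ be the Mittag-Leffler function. Let $\xi\in L_2(\Omega\times\mathbb S^2)$ be a centered, strongly isotropic Gaussian random field (jointly measurable, real-valued)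 with angular power spectrum $\mathcal C_\ell=\mathbb E|\widehat\xi_{\ell,m}|^2$. Let $W_\tau(t)$, $t\ge\tau$, be a real $L_2(\mathbb S^2)$-valued $Q$-Wiener process started at time $\tau$: $W_\tau(\tau)=0$, continuous trajectories, independent increments, $W_\tau(t)-W_\tau(s)\sim\mathcal N(0,(t-s)Q)$, where $QY_{\ell,m}=\mathcal A_\ell Y_{\ell,m}$ with $\mathcal A_\ell\ge0$. Let $\xi$ and $W_\tau$ be independent. Assume that there are $\kappa_1,\kappa_2>2$ and $\widetilde D,\widetilde C,\widetilde K,\widetilde A>0$ with $$\mathcal C_0\le\widetilde D,\quad \mathcal C_\ell\le\widetilde C\ell^{-\kappa_1},\qquad \mathcal A_0\le\widetilde K,\quad \mathcal A_\ell\le\widetilde A\ell^{-\kappa_2}\qquad(\ell\ge1).$$ Let $U(t)=U^H(t)+U^I(t)$, $t>0$, be the (series) solution of the two-stage equation $dU-D_t^{1-\alpha}\Delta_{\mathbb S^2}U\,dt=\mathbf 1_{\{t\ge\tau\}}\,dW_\tau(t)$, $U(0)=\xi$; that is, $U^H(t)=\sum_{\ell\ge0}U^H_\ell(t)$ and $U^I(t)=\sum_{\ell\ge0}U^I_\ell(t)$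 in $L_2(\Omega\times\mathbb S^2)$, where $$U^H_\ell(t)=\sum_{m=-\ell}^{\ell}E_\alpha(-\lambda_\ell t^\alpha)\,\widehat\xi_{\ell,m}\,Y_{\ell,m},\qquad U^I_\ell(t)=\sum_{m=-\ell}^{\ell}\Big(\int_0^{t-\tau}E_\alpha\big(-\lambda_\ell(t-\tau-s)^\alpha\big)\,d\widehat W_{\ell,m}(\tau+s)\Big)Y_{\ell,m}\quad(t>\tau),$$ $U^I_\ell(t)=0$ for $t\le\tau$, $\widehat W_{\ell,m}$ are the Fourier coefficients of $W_\tau$, and the integrals are Wiener integrals. Let $U_L(t)=\sum_{\ell=0}^{L}(U^H_\ell(t)+U^I_\ell(t))$ and $Q_L(t)=\|U(t)-U_L(t)\|_{L_2(\Omega\times\mathbb S^2)}$. **Constants.** Let $$\widetilde C_{\kappa_1}=\Big(\widetilde C\big(\tfrac{2}{\kappa_1-2}+\tfrac1{\kappa_1-1}\big)\Big)^{1/2},\qquad \widetilde A_{\kappa_2}=\Big(\widetilde A\big(\tfrac{2}{\kappa_2-2}+\tfrac1{\kappa_2-1}\big)\Big)^{1/2},$$ $M_\alpha=\Gamma(1+\alpha)^2|2\alpha-1|^{-1}$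 for $\alpha\ne\frac12$, $M_{1/2}=\Gamma(3/2)^2$, $\psi^H_\alpha(t)=\Gamma(1+\alpha)t^{-\alpha}$, and $$\psi^I_\alpha(t)=\begin{cases}\sqrt{1+M_\alpha t^{1-2\alpha}},&\alpha<\frac12,\\ \sqrt{1+M_\alpha},&\alpha>\frac12,\\ \sqrt{1+M_{1/2}(2+\ln t)},&\alpha=\frac12,\ t>1,\\ \sqrt{1+2M_{1/2}},&\alpha=\frac12,\ t\le1,\end{cases}\qquad \gamma_\alpha(\kappa_2)=\begin{cases}\kappa_2+2,&\alpha<\frac12,\\ \kappa_2+\frac2\alpha-2,&\alpha>\frac12,\\ \kappa_2,&\alpha=\frac12,\end{cases}$$ $\widehat\kappa_\alpha=\min(\kappa_1+2,\ \kappa_2+\frac2\alpha-2)$ and $\kappa_\alpha=\min(\kappa_1+2,\ \gamma_\alpha(\kappa_2))$. **Theorem.** The series defining $U(t)$ converge in $L_2(\Omega\times\mathbb S^2)$ for every $t>0$, and for every integer $L\ge1$: 1. if $0<t\le\lambda_L^{-1/\alpha}$ and $\tau\ge\lambda_L^{-1/\alpha}$, then $Q_L(t)\le\widetilde C_{\kappa_1}L^{-(\kappa_1-2)/2}$;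 2. if $\lambda_L^{-1/\alpha}<t\le\tau+\lambda_L^{-1/\alpha}$, then $Q_L(t)\le\big((\psi^H_\alpha(t)\widetilde C_{\kappa_1})^2+\widetilde A_{\kappa_2}^2\big)^{1/2}L^{-\widehat\kappa_\alpha/2}$; 3. if $t>\tau+\lambda_L^{-1/\alpha}$, then $Q_L(t)\le\big((\psi^H_\alpha(t)\widetilde C_{\kappa_1})^2+(\psi^I_\alpha(t-\tau)\widetilde A_{\kappa_2})^2\big)^{1/2}L^{-\kappa_\alpha/2}$. -/

import Mathlib

open MeasureTheory ProbabilityTheory Filter Topology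

open scoped ENNReal NNReal ComplexConjugate RealInnerProductSpace

noncomputable section

namespace SphereSPDE

/-! ### The sphere, its normalized surface measure, spherical harmonics -/

/-- Three-dimensional Euclidean space. -/
abbrev E3 : Type := EuclideanSpace ℝ (Fin 3)

/-- The unit sphere of `ℝ³`. -/
abbrev S2 : Type := Metric.sphere (0 : E3) 1

/-- The surface measure of the sphere, normalized to total mass one. -/
def sphereMeasure : Measure S2 :=
  ((volume : Measure E3).toSphere Set.univ)⁻¹ • (volume : Measure E3).toSphere

instance : IsProbabilityMeasure sphereMeasure := by
  constructor
  rw [sphereMeasure, Measure.smul_apply, smul_eq_mul]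
  refine ENNReal.inv_mul_cancel ?_ (measure_ne_top _ _)
  rw [Ne, Measure.measure_univ_eq_zero]
  exact Measure.toSphere_ne_zero _

/-- The Legendre polynomial `P_ℓ`, by Rodrigues' formula. -/
def legendre (l : ℕ) : Polynomial ℝ :=
  Polynomial.C ((2 : ℝ) ^ l * (l.factorial : ℝ))⁻¹ *
    Polynomial.derivative^[l] ((Polynomial.X ^ 2 - 1) ^ l)

/-- The associated Legendre function `P_{ℓ,m}(t) = (-1)^m (1 - t²)^{m/2} (d/dt)^m P_ℓ(t)`. -/
def assocLegendre (l m : ℕ) (t : ℝ) : ℝ :=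
  (-1) ^ m * Real.sqrt (1 - t ^ 2) ^ m * (Polynomial.derivative^[m] (legendre l)).eval t

/-- The spherical harmonic `Y_{ℓ,m}` for `m ≥ 0`, in Cartesian coordinates: at the point with
spherical coordinates `(θ, φ)` one has `x₁ + i x₂ = sin θ e^{iφ}` and `x₃ = cos θ`; see
`harmonicNonneg_spherical` for the expression in spherical coordinates. -/
def harmonicNonneg (l m : ℕ) (x : S2) : ℂ :=
  (Real.sqrt ((2 * l + 1) * ((l - m).factorial : ℝ) / ((l + m).factorial : ℝ)) : ℂ) *
    ((-1) ^ m * (((Polynomial.derivative^[m] (legendre l)).eval (x.1 2) : ℝ) : ℂ) *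
      ((x.1 0 : ℂ) + Complex.I * (x.1 1 : ℂ)) ^ m)

/-- The complex spherical harmonics `Y_{ℓ,m}`, `-ℓ ≤ m ≤ ℓ`, orthonormal for `sphereMeasure`. -/
def sphericalHarmonic (l : ℕ) (m : ℤ) (x : S2) : ℂ :=
  if 0 ≤ m then harmonicNonneg l m.natAbs x
  else (-1) ^ m.natAbs * conj (harmonicNonneg l m.natAbs x)

/-- In spherical coordinates,
`Y_{ℓ,m} = √((2ℓ+1)(ℓ-m)!/(ℓ+m)!) P_{ℓ,m}(cos θ) e^{imφ}` for `m ≥ 0`. -/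
theorem harmonicNonneg_spherical (l m : ℕ) (x : S2) (θ φ : ℝ) (h0 : 0 ≤ θ) (hπ : θ ≤ Real.pi)
    (hx : x.1 = !₂[Real.sin θ * Real.cos φ, Real.sin θ * Real.sin φ, Real.cos θ]) :
    harmonicNonneg l m x =
      (Real.sqrt ((2 * l + 1) * ((l - m).factorial : ℝ) / ((l + m).factorial : ℝ)) : ℂ) *
        (assocLegendre l m (Real.cos θ) : ℂ) * Complex.exp (Complex.I * m * φ) := by
  have hs : Real.sqrt (1 - Real.cos θ ^ 2) = Real.sin θ := by
    rw [← Real.sin_sq, Real.sqrt_sq (Real.sin_nonneg_of_nonneg_of_le_pi h0 hπ)]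
  have he : Complex.exp (Complex.I * m * φ) = (Complex.cos φ + Complex.sin φ * Complex.I) ^ m := by
    rw [← Complex.exp_mul_I, ← Complex.exp_nat_mul]
    congr 1
    ring
  have hz : ((x.1 0 : ℂ) + Complex.I * (x.1 1 : ℂ)) =
      (Real.sin θ : ℂ) * (Complex.cos φ + Complex.sin φ * Complex.I) := by
    simp only [hx]
    simp
    ring
  have h2 : x.1 2 = Real.cos θ := by simp [hx]
  rw [harmonicNonneg, assocLegendre, hz, h2, hs, he, mul_pow]
  push_cast
  ring

theorem continuous_harmonicNonneg (l m : ℕ) : Continuous (harmonicNonneg l m) := by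
  have hc : ∀ i : Fin 3, Continuous fun x : S2 => x.1 i := fun i => by fun_prop
  have h2 : Continuous fun x : S2 => (Polynomial.derivative^[m] (legendre l)).eval (x.1 2) :=
    (Polynomial.continuous _).comp (hc 2)
  have h0 := hc 0
  have h1 := hc 1
  unfold harmonicNonneg
  fun_prop

theorem continuous_sphericalHarmonic (l : ℕ) (m : ℤ) : Continuous (sphericalHarmonic l m) := by
  have h := continuous_harmonicNonneg l m.natAbs
  by_cases hm : 0 ≤ m
  · have : sphericalHarmonic l m = harmonicNonneg l m.natAbs := by
      funext x
      simp [sphericalHarmonic, hm]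
    rw [this]
    exact h
  · have : sphericalHarmonic l m = fun x => (-1) ^ m.natAbs * conj (harmonicNonneg l m.natAbs x) := by
      funext x
      simp [sphericalHarmonic, hm]
    rw [this]
    fun_prop

/-- The eigenvalue `λ_ℓ = ℓ(ℓ+1)` of the negative Laplace-Beltrami operator. -/
def eigenvalue (l : ℕ) : ℝ := (l : ℝ) * ((l : ℝ) + 1)

/-- The Fourier-Laplace coefficient `∫ f conj(Y_{ℓ,m}) dμ` of a real-valued function. -/
def fourierCoeff (f : S2 → ℝ) (l : ℕ) (m : ℤ) : ℂ :=
  ∫ x, (f x : ℂ) * conj (sphericalHarmonic l m x) ∂sphereMeasure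

/-- Real-valued `L²` functions on the sphere, with the Borel σ-algebra. -/
abbrev SphereL2 : Type := Lp ℝ 2 sphereMeasure

instance : MeasurableSpace SphereL2 := borel _

instance : BorelSpace SphereL2 := ⟨rfl⟩

/-- The real part of `Y_{ℓ,m}` as an element of `L²`. -/
def reHarmonic (l : ℕ) (m : ℤ) : SphereL2 :=
  ContinuousMap.toLp 2 sphereMeasure ℝ
    ⟨fun x => (sphericalHarmonic l m x).re, Complex.continuous_re.comp (continuous_sphericalHarmonic l m)⟩

/-- The imaginary part of `Y_{ℓ,m}` as an element of `L²`. -/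
def imHarmonic (l : ℕ) (m : ℤ) : SphereL2 :=
  ContinuousMap.toLp 2 sphereMeasure ℝ
    ⟨fun x => (sphericalHarmonic l m x).im, Complex.continuous_im.comp (continuous_sphericalHarmonic l m)⟩

/-! ### Isotropic Gaussian random fields -/

/-- The action of a linear isometry of `ℝ³` on the sphere. -/
def rotate (R : E3 ≃ₗᵢ[ℝ] E3) (x : S2) : S2 :=
  ⟨R x.1, by
    have h := x.2
    rw [mem_sphere_zero_iff_norm] at h ⊢
    rw [R.norm_map, h]⟩

section Probability

variable {Ω : Type*} [MeasurableSpace Ω]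

/-- Strong isotropy: the finite-dimensional laws are invariant under `SO(3)`. -/
def IsStronglyIsotropic (P : Measure Ω) (ξ : Ω → S2 → ℝ) : Prop :=
  ∀ (k : ℕ) (x : Fin k → S2) (R : E3 ≃ₗᵢ[ℝ] E3),
    LinearMap.det (R.toLinearEquiv : E3 →ₗ[ℝ] E3) = 1 →
      P.map (fun ω i => ξ ω (x i)) = P.map (fun ω i => ξ ω (rotate R (x i)))

/-- A centered, strongly isotropic Gaussian random field: a jointly measurable, square integrable
map `Ω × S² → ℝ` with centered Gaussian, rotation invariant finite-dimensional laws. -/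
structure IsIsotropicGaussianField (P : Measure Ω) (ξ : Ω → S2 → ℝ) : Prop where
  measurable : Measurable (Function.uncurry ξ)
  memLp : MemLp (Function.uncurry ξ) 2 (P.prod sphereMeasure)
  centered : ∀ x, ∫ ω, ξ ω x ∂P = 0
  gaussian : IsGaussianProcess (fun (x : S2) ω => ξ ω x) P
  isotropic : IsStronglyIsotropic P ξ

/-- `C` is the angular power spectrum of `ξ`: `C_ℓ = 𝔼|ξ̂_{ℓ,m}|²` for all `-ℓ ≤ m ≤ ℓ`. -/
def IsAngularPowerSpectrum (P : Measure Ω) (ξ : Ω → S2 → ℝ) (C : ℕ → ℝ) : Prop :=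
  ∀ (l : ℕ) (m : ℤ), m ∈ Finset.Icc (-(l : ℤ)) l →
    C l = ∫ ω, ‖fourierCoeff (ξ ω) l m‖ ^ 2 ∂P

/-! ### The time-delayed `Q`-Wiener process and Wiener integrals -/

/-- An `L²(S²)`-valued `Q`-Wiener process `(W(t))_{t ≥ τ}` started at time `τ`. The law of an
increment is `N(0, (t-s)Q)`, i.e. `⟨W(t) - W(s), f⟩` is centered Gaussian with variance
`(t-s)⟨Qf, f⟩` for every `f`. -/
structure IsQWiener (P : Measure Ω) (Q : SphereL2 →L[ℝ] SphereL2) (τ : ℝ)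
    (W : ℝ → Ω → SphereL2) : Prop where
  covariance : Q.IsPositive
  measurable : ∀ t, τ ≤ t → Measurable (W t)
  start : ∀ᵐ ω ∂P, W τ ω = 0
  continuous : ∀ᵐ ω ∂P, ContinuousOn (fun t => W t ω) (Set.Ici τ)
  indep : HasIndepIncrements (fun (t : Set.Ici τ) ω => W t ω) P
  law : ∀ s t, τ ≤ s → s ≤ t → ∀ f : SphereL2,
    HasLaw (fun ω => ⟪W t ω - W s ω, f⟫) (gaussianReal 0 (Real.toNNReal ((t - s) * ⟪Q f, f⟫))) P

/-- `A` is the angular power spectrum of the noise with covariance operator `Q`: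
`A_ℓ ≥ 0` and `Q Y_{ℓ,m} = A_ℓ Y_{ℓ,m}` (for the real and the imaginary part). -/
def IsNoiseSpectrum (Q : SphereL2 →L[ℝ] SphereL2) (A : ℕ → ℝ) : Prop :=
  ∀ l : ℕ, 0 ≤ A l ∧ ∀ m : ℤ, m ∈ Finset.Icc (-(l : ℤ)) l →
    Q (reHarmonic l m) = A l • reHarmonic l m ∧ Q (imHarmonic l m) = A l • imHarmonic l m

/-- The step function `∑_{i<n} c_i 1_{(p_i, p_{i+1}]}`. -/
def stepFun (n : ℕ) (p c : ℕ → ℝ) (u : ℝ) : ℝ :=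
  ∑ i ∈ Finset.range n, (Set.Ioc (p i) (p (i + 1))).indicator (fun _ => c i) u

/-- The integral `∑_{i<n} c_i (X(p_{i+1}) - X(p_i))` of a step function against a process. -/
def stepIntegral (X : ℝ → Ω → ℂ) (n : ℕ) (p c : ℕ → ℝ) (ω : Ω) : ℂ :=
  ∑ i ∈ Finset.range n, (c i : ℂ) * (X (p (i + 1)) ω - X (p i) ω)

/-- `J` is the Wiener integral `∫_a^b g dX`: the limit in `L²(Ω)` of the integrals of step
functions which converge to `g` in `L²([a,b])`. (For a process with the increments of a multiple
of Brownian motion, the limit does not depend on the step functions, up to a null set.) -/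
def IsWienerIntegral (P : Measure Ω) (X : ℝ → Ω → ℂ) (g : ℝ → ℝ) (a b : ℝ) (J : Ω → ℂ) : Prop :=
  MemLp J 2 P ∧ ∃ (n : ℕ → ℕ) (p c : ℕ → ℕ → ℝ),
    (∀ k, Monotone (p k) ∧ ∀ i, p k i ∈ Set.Icc a b) ∧
    Tendsto (fun k => eLpNorm (fun u => stepFun (n k) (p k) (c k) u - g u) 2
      (volume.restrict (Set.Icc a b))) atTop (𝓝 0) ∧
    Tendsto (fun k => eLpNorm (fun ω => stepIntegral X (n k) (p k) (c k) ω - J ω) 2 P)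
      atTop (𝓝 0)

open Classical in
/-- The Wiener integral `∫_a^b g dX` (a version of it). -/
def wienerIntegral (P : Measure Ω) (X : ℝ → Ω → ℂ) (g : ℝ → ℝ) (a b : ℝ) : Ω → ℂ :=
  if h : ∃ J, IsWienerIntegral P X g a b J then h.choose else 0

/-! ### The solution of the two-stage equation and its truncation -/

/-- The two-parameter Mittag-Leffler function `E_{α,β}(z) = ∑ z^k / Γ(αk+β)` on the real line. -/
def mittagLeffler (α β z : ℝ) : ℝ := ∑' k : ℕ, z ^ k / Real.Gamma (α * k + β)

/-- `E_α(-λ_ℓ r^α)`. -/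
def relaxation (α : ℝ) (l : ℕ) (r : ℝ) : ℝ := mittagLeffler α 1 (-eigenvalue l * r ^ α)

/-- `U^H_ℓ(t) = ∑_m E_α(-λ_ℓ t^α) ξ̂_{ℓ,m} Y_{ℓ,m}`. -/
def layerH (α : ℝ) (ξ : Ω → S2 → ℝ) (l : ℕ) (t : ℝ) (z : Ω × S2) : ℂ :=
  ∑ m ∈ Finset.Icc (-(l : ℤ)) l,
    (relaxation α l t : ℂ) * fourierCoeff (ξ z.1) l m * sphericalHarmonic l m z.2

/-- The coefficients `∫_0^{t-τ} E_α(-λ_ℓ (t-τ-s)^α) dŴ_{ℓ,m}(τ+s)` of `U^I(t)`, `t > τ`. -/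
def coeffI (P : Measure Ω) (α τ : ℝ) (W : ℝ → Ω → SphereL2) (l : ℕ) (m : ℤ) (t : ℝ) : Ω → ℂ :=
  wienerIntegral P (fun s ω => fourierCoeff (W (τ + s) ω) l m)
    (fun s => relaxation α l (t - τ - s)) 0 (t - τ)

/-- `U^I_ℓ(t)`, which vanishes for `t ≤ τ`. -/
def layerI (P : Measure Ω) (α τ : ℝ) (W : ℝ → Ω → SphereL2) (l : ℕ) (t : ℝ) (z : Ω × S2) : ℂ :=
  if t ≤ τ then 0
  else ∑ m ∈ Finset.Icc (-(l : ℤ)) l, coeffI P α τ W l m t z.1 * sphericalHarmonic l m z.2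

/-- `F` is the sum of the series `∑_ℓ f_ℓ` in `L²(Ω × S²)`. -/
def IsL2Sum (P : Measure Ω) (f : ℕ → Ω × S2 → ℂ) (F : Ω × S2 → ℂ) : Prop :=
  (∀ l, MemLp (f l) 2 (P.prod sphereMeasure)) ∧ MemLp F 2 (P.prod sphereMeasure) ∧
    Tendsto (fun n => eLpNorm (fun z => F z - ∑ l ∈ Finset.range n, f l z) 2
      (P.prod sphereMeasure)) atTop (𝓝 0)

/-- `U = U^H + U^I` on `(0,∞)`, where
`U^H(t) = ∑_ℓ U^H_ℓ(t)` and `U^I(t) = ∑_ℓ U^I_ℓ(t)` in `L²(Ω × S²)`. -/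
def IsSolution (P : Measure Ω) (α τ : ℝ) (ξ : Ω → S2 → ℝ) (W : ℝ → Ω → SphereL2)
    (U : ℝ → Ω × S2 → ℂ) : Prop :=
  ∃ UH UI : ℝ → Ω × S2 → ℂ, ∀ t, 0 < t →
    IsL2Sum P (fun l => layerH α ξ l t) (UH t) ∧
    IsL2Sum P (fun l => layerI P α τ W l t) (UI t) ∧
    U t = UH t + UI t

/-- The truncation `U_L(t) = ∑_{ℓ ≤ L} (U^H_ℓ(t) + U^I_ℓ(t))`. -/
def truncation (P : Measure Ω) (α τ : ℝ) (ξ : Ω → S2 → ℝ) (W : ℝ → Ω → SphereL2)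
    (L : ℕ) (t : ℝ) (z : Ω × S2) : ℂ :=
  ∑ l ∈ Finset.range (L + 1), (layerH α ξ l t z + layerI P α τ W l t z)

/-- The truncation error `Q_L(t) = ‖U(t) - U_L(t)‖` in `L²(Ω × S²)`, as an extended number. -/
def truncationError (P : Measure Ω) (α τ : ℝ) (ξ : Ω → S2 → ℝ) (W : ℝ → Ω → SphereL2)
    (U : ℝ → Ω × S2 → ℂ) (L : ℕ) (t : ℝ) : ℝ≥0∞ :=
  eLpNorm (fun z => U t z - truncation P α τ ξ W L t z) 2 (P.prod sphereMeasure)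

end Probability

/-! ### Constants and exponents -/

/-- Algebraic decay: `a_0 ≤ D` and `a_ℓ ≤ c ℓ^{-κ}` for `ℓ ≥ 1`. -/
def AlgebraicDecay (a : ℕ → ℝ) (D c κ : ℝ) : Prop :=
  a 0 ≤ D ∧ ∀ l : ℕ, 1 ≤ l → a l ≤ c * (l : ℝ) ^ (-κ)

/-- `c_κ = (c (2/(κ-2) + 1/(κ-1)))^{1/2}`. -/
def decayConst (c κ : ℝ) : ℝ := Real.sqrt (c * (2 / (κ - 2) + 1 / (κ - 1)))

/-- The constant `M_α`. -/
def constM (α : ℝ) : ℝ :=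
  if α = 1 / 2 then Real.Gamma (3 / 2) ^ 2 else Real.Gamma (1 + α) ^ 2 * |2 * α - 1|⁻¹

/-- `ψ^H_α(t) = Γ(1+α) t^{-α}`. -/
def psiH (α t : ℝ) : ℝ := Real.Gamma (1 + α) * t ^ (-α)

/-- `K(t)`. -/
def constK (t : ℝ) : ℝ :=
  if 1 < t then Real.sqrt (1 + constM (1 / 2) * (2 + Real.log t))
  else Real.sqrt (1 + 2 * constM (1 / 2))

/-- `ψ^I_α(t)`. -/
def psiI (α t : ℝ) : ℝ :=
  if α < 1 / 2 then Real.sqrt (1 + constM α * t ^ (1 - 2 * α))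
  else if α = 1 / 2 then constK t
  else Real.sqrt (1 + constM α)

/-- `γ_α(κ)`. -/
def gammaExp (α κ : ℝ) : ℝ :=
  if α < 1 / 2 then κ + 2 else if α = 1 / 2 then κ else κ + 2 / α - 2

/-- `κ̂_α = min(κ₁+2, κ₂+2/α-2)`. -/
def kappaHat (α κ₁ κ₂ : ℝ) : ℝ := min (κ₁ + 2) (κ₂ + 2 / α - 2)

/-- `κ_α = min(κ₁+2, γ_α(κ₂))`. -/
def kappaFull (α κ₁ κ₂ : ℝ) : ℝ := min (κ₁ + 2) (gammaExp α κ₂)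

end SphereSPDE

end

noncomputable section

namespace SphereSPDE

/-! ### The Mittag-Leffler function on the negative half line -/

/-! By orthonormality of the harmonics, the squared norm of a block of layers is a sum of second
moments of coefficients. The coefficient of `U^H` at `(l, m)` contributes `C_l E_α(-λ_l t^α)²`. By
the Itô isometry, that of `U^I` contributes `A_l ∫_0^{t-τ} E_α(-λ_l u^α)² du`. The cross term
vanishes since `ξ` is centered and independent of `W`. Summing over the `2l+1` orders gives
`eLpNorm_sum_layers`; bounds on finite blocks beyond `L` then pass to the limit and control the
truncation error (`truncationError_le`).

What remains is deterministic. Two bounds on `E_α` suffice: `0 ≤ E_α(-r^α) ≤ 1` and `E_α(-r^α) ≤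
Γ(1+α) r^{-α}`. They come from the Volterra equation `u = 1 - I^α u`, where `I^α` is the fractional
integral: a comparison principle (`volterra_pos`) applied to `u` gives positivity, and applied to `u
- u(· + h)` gives monotonicity; monotonicity turns the equation into the decay bound. For the noise
variance the time integral is split at `λ_l^{-1/α}`, where the two bounds are of the same order.
Whether the tail `∫ u^{-2α} du` is governed by its upper end, its lower end or a logarithm decides
the cases `α < 1/2`, `α > 1/2`, `α = 1/2`. The sums over `l > L` are compared with integrals, which
yields the constants of the statement.

Two ingredients are built from scratch. Orthonormality: different orders are separated by a rotation
about the axis; for equal orders Archimedes' theorem reduces the sphere to `[-1, 1]`, where the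
Legendre equation applies. Wiener integrals: the map taking the indicator of `(0, t]` to `X t - X 0`
scales squared distances by a constant, hence so does its linear extension. -/

theorem intervalIntegrable_sub_rpow {α : ℝ} (hα : 0 < α) (t a b : ℝ) :
    IntervalIntegrable (fun s => (t - s) ^ (α - 1)) volume a b := by
  have h := (intervalIntegral.intervalIntegrable_rpow' (a := t - a) (b := t - b)
    (r := α - 1) (by linarith)).comp_sub_left t
  simpa using h

theorem integral_sub_rpow {α : ℝ} (hα : 0 < α) {a t : ℝ} :
    ∫ s in a..t, (t - s) ^ (α - 1) = (t - a) ^ α / α := by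
  have := intervalIntegral.integral_comp_sub_left (fun u : ℝ => u ^ (α - 1)) (a := a) (b := t) t
  rw [this, integral_rpow (Or.inl (by linarith))]
  simp [Real.zero_rpow hα.ne']

/-- The Beta integral on `[0, t]`. -/
theorem integral_sub_rpow_mul_rpow {a b t : ℝ} (ha : 0 < a) (hb : 0 < b) (ht : 0 < t) :
    ∫ s in (0 : ℝ)..t, (t - s) ^ (a - 1) * s ^ (b - 1) =
      t ^ (a + b - 1) * (Real.Gamma a * Real.Gamma b / Real.Gamma (a + b)) := by
  have h := Complex.betaIntegral_scaled (b : ℂ) (a : ℂ) ht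
  have hb2 := Complex.Gamma_mul_Gamma_eq_betaIntegral (s := (b : ℂ)) (t := (a : ℂ))
    (by simpa using hb) (by simpa using ha)
  have hG : (Complex.Gamma ((b : ℂ) + a)) ≠ 0 := by
    apply Complex.Gamma_ne_zero_of_re_pos
    simp; linarith
  have hbe : Complex.betaIntegral (b : ℂ) (a : ℂ) =
      ((Real.Gamma a * Real.Gamma b / Real.Gamma (a + b) : ℝ) : ℂ) := by
    rw [eq_comm]
    push_cast [← Complex.Gamma_ofReal]
    rw [mul_comm, hb2, add_comm (a : ℂ) b]
    field_simp
  apply Complex.ofReal_injective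
  rw [← intervalIntegral.integral_ofReal]
  rw [hbe] at h
  push_cast
  push_cast at h
  have e : ((t ^ (a + b - 1) : ℝ) : ℂ) = (t : ℂ) ^ ((b : ℂ) + a - 1) := by
    rw [Complex.ofReal_cpow ht.le]; push_cast; congr 1; ring
  rw [e, ← h]
  apply intervalIntegral.integral_congr
  intro s hs
  rw [Set.uIcc_of_le ht.le] at hs
  simp only
  rw [Complex.ofReal_cpow (by linarith [hs.2]), Complex.ofReal_cpow hs.1]
  push_cast
  ring

/-- Positivity of solutions of a Volterra equation with a weakly singular kernel. -/
theorem volterra_pos {α c : ℝ} (hα0 : 0 < α) (hα1 : α ≤ 1) (hc : 0 ≤ c) {v f : ℝ → ℝ}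
    (hv : ContinuousOn v (Set.Ici 0)) (h0 : 0 < v 0)
    (hvf : ∀ t, 0 < t → v t = f t - c * ∫ s in (0 : ℝ)..t, (t - s) ^ (α - 1) * v s)
    (hf : ∀ s t, 0 < s → s ≤ t → f s * s ^ (1 - α) ≤ f t * t ^ (1 - α)) :
    ∀ t, 0 ≤ t → 0 < v t := by
  by_contra! hcon
  obtain ⟨t', ht'0, ht'⟩ := hcon
  set Z : Set ℝ := Set.Ici 0 ∩ v ⁻¹' Set.Iic 0 with hZ
  have hZc : IsClosed Z := hv.preimage_isClosed_of_isClosed isClosed_Ici isClosed_Iic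
  have hZb : BddBelow Z := ⟨0, fun x hx => hx.1⟩
  have hZm : sInf Z ∈ Z := hZc.csInf_mem ⟨t', ht'0, ht'⟩ hZb
  set t₀ := sInf Z with ht₀
  have hvt₀ : v t₀ ≤ 0 := hZm.2
  have ht₀0 : 0 ≤ t₀ := hZm.1
  have ht₀p : 0 < t₀ := by
    rcases ht₀0.eq_or_lt with h | h
    · rw [← h] at hvt₀; linarith
    · exact h
  have hpos : ∀ s, 0 ≤ s → s < t₀ → 0 < v s := by
    intro s hs hst
    by_contra! h
    exact absurd (csInf_le hZb (⟨hs, h⟩ : s ∈ Z)) (not_le.2 hst)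
  -- At the first point `t₀` where `v ≤ 0`, choose a window `[t₁, t₀]` whose kernel mass is below
  -- `1/2`. The condition `t₀ / 2 < t₁` will keep the scaling factor `q` at least `1/2`.
  have hlim : Tendsto (fun t => c * ((t₀ - t) ^ α / α)) (𝓝[<] t₀) (𝓝 0) := by
    have : Continuous (fun t => c * ((t₀ - t) ^ α / α)) := by
      have := Real.continuous_rpow_const hα0.le
      fun_prop
    have h2 := this.tendsto t₀
    simp only [sub_self, Real.zero_rpow hα0.ne', zero_div, mul_zero] at h2
    exact h2.mono_left nhdsWithin_le_nhds
  obtain ⟨t₁, ht₁s, ht₁l, ht₁h⟩ : ∃ t₁, c * ((t₀ - t₁) ^ α / α) < 1 / 2 ∧ t₁ < t₀ ∧ t₀ / 2 < t₁ := by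
    have h1 := hlim.eventually (gt_mem_nhds (show (0 : ℝ) < 1 / 2 by norm_num))
    have h2 : ∀ᶠ t in 𝓝[<] t₀, t < t₀ := eventually_mem_nhdsWithin
    have h3 : ∀ᶠ t in 𝓝[<] t₀, t₀ / 2 < t :=
      nhdsWithin_le_nhds (lt_mem_nhds (by linarith))
    exact (h1.and (h2.and h3)).exists
  have ht₁p : 0 < t₁ := by linarith
  -- The equation at `t₀` is compared with the equation at the maximum point `r` of `v` on the
  -- window, where `v r` dominates the memory of `[r, t₀]`.
  obtain ⟨r, hr, hrmax⟩ := (isCompact_Icc (a := t₁) (b := t₀)).exists_isMaxOn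
    ⟨t₁, le_refl _, ht₁l.le⟩ (hv.mono fun x hx => ht₁p.le.trans hx.1)
  have hrp : 0 < r := ht₁p.trans_le hr.1
  have hvr : 0 < v r := (hpos t₁ ht₁p.le ht₁l).trans_le (hrmax ⟨le_refl _, ht₁l.le⟩)
  have hrt : r < t₀ := by
    rcases hr.2.eq_or_lt with h | h
    · rw [h] at hvr; linarith
    · exact h
  have hint : ∀ t a b, 0 ≤ a → a ≤ b →
      IntervalIntegrable (fun s => (t - s) ^ (α - 1) * v s) volume a b := by
    intro t a b ha hab
    apply (intervalIntegrable_sub_rpow hα0 t a b).mul_continuousOn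
    rw [Set.uIcc_of_le hab]
    exact hv.mono fun x hx => ha.trans hx.1
  -- Since `t₀ - s ≥ (t₀ / r) (r - s)` for `s ≥ 0`, the kernel seen from `t₀` is at most `q` times
  -- the one seen from `r`. The monotonicity of `f t * t ^ (1 - α)` says exactly that `q * f r ≤ f
  -- t₀`.
  set q : ℝ := (t₀ / r) ^ (α - 1) with hq
  have hq0 : 0 < q := Real.rpow_pos_of_pos (by positivity) _
  have hqh : 1 / 2 ≤ q := by
    have h2 : t₀ / r ≤ 2 := by
      rw [div_le_iff₀ hrp]; linarith [hr.1]
    have h3 : (2 : ℝ) ^ (α - 1) ≤ q :=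
      Real.rpow_le_rpow_of_nonpos (by positivity) h2 (by linarith)
    have h4 : (2 : ℝ) ^ (-1 : ℝ) ≤ 2 ^ (α - 1) :=
      Real.rpow_le_rpow_of_exponent_le (by norm_num) (by linarith)
    rw [Real.rpow_neg_one] at h4
    linarith
  have c1 : ∫ s in (0 : ℝ)..r, (t₀ - s) ^ (α - 1) * v s ≤
      q * ∫ s in (0 : ℝ)..r, (r - s) ^ (α - 1) * v s := by
    rw [← intervalIntegral.integral_const_mul]
    apply intervalIntegral.integral_mono_on_of_le_Ioo hrp.le (hint _ _ _ le_rfl hrp.le)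
      ((hint _ _ _ le_rfl hrp.le).const_mul q)
    intro s hs
    rw [← mul_assoc]
    apply mul_le_mul_of_nonneg_right _ (hpos s hs.1.le (hs.2.trans hrt)).le
    rw [hq, ← Real.mul_rpow (by positivity) (by linarith [hs.2])]
    apply Real.rpow_le_rpow_of_nonpos
    · have := hs.2
      have h5 : 0 < r - s := by linarith
      positivity
    · have h6 : 1 ≤ t₀ / r := by rw [le_div_iff₀ hrp]; linarith
      have h7 : t₀ / r * r = t₀ := by field_simp
      nlinarith [hs.1]
    · linarith
  have c2 : ∫ s in r..t₀, (t₀ - s) ^ (α - 1) * v s ≤ (t₀ - r) ^ α / α * v r := by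
    rw [← integral_sub_rpow hα0, ← intervalIntegral.integral_mul_const]
    apply intervalIntegral.integral_mono_on hrt.le (hint _ _ _ hrp.le hrt.le)
      ((intervalIntegrable_sub_rpow hα0 _ _ _).mul_const _)
    intro s hs
    apply mul_le_mul_of_nonneg_left (hrmax ⟨hr.1.trans hs.1, hs.2⟩)
    exact Real.rpow_nonneg (by linarith [hs.2]) _
  have hsplit := intervalIntegral.integral_add_adjacent_intervals
    (hint t₀ 0 r le_rfl hrp.le) (hint t₀ r t₀ hrp.le hrt.le)
  have e1 := hvf t₀ ht₀p
  have e2 := hvf r hrp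
  rw [← hsplit] at e1
  have hff : q * f r ≤ f t₀ := by
    have h8 := hf r t₀ hrp hrt.le
    have h9 : q * t₀ ^ (1 - α) = r ^ (1 - α) := by
      rw [hq, Real.div_rpow ht₀0 hrp.le, show α - 1 = -(1 - α) by ring, Real.rpow_neg ht₀0,
        Real.rpow_neg hrp.le]
      have := (Real.rpow_pos_of_pos ht₀p (1 - α)).ne'
      field_simp
    have h10 := Real.rpow_pos_of_pos ht₀p (1 - α)
    rw [← h9] at h8
    nlinarith
  have hm : (t₀ - r) ^ α / α ≤ (t₀ - t₁) ^ α / α := by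
    apply div_le_div_of_nonneg_right _ hα0.le
    exact Real.rpow_le_rpow (by linarith) (by linarith [hr.1]) hα0.le
  have k1 := mul_le_mul_of_nonneg_left c1 hc
  have k2 := mul_le_mul_of_nonneg_left c2 hc
  have k3 := mul_le_mul_of_nonneg_left hm hc
  -- Altogether `v t₀ ≥ q v(r) - c (t₀ - r)^α / α · v(r)`, which is positive because `q ≥ 1/2`
  -- exceeds the window mass. This contradicts `v t₀ ≤ 0`.
  have k4 : c * ((t₀ - r) ^ α / α * v r) ≤ 1 / 2 * v r - (1 / 2 - c * ((t₀ - t₁) ^ α / α)) * v r := by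
    nlinarith
  have k5 : 0 < (1 / 2 - c * ((t₀ - t₁) ^ α / α)) * v r := mul_pos (by linarith) hvr
  have k6 : 1 / 2 * v r ≤ q * v r := mul_le_mul_of_nonneg_right hqh hvr.le
  have k7 : q * v r = q * f r - c * (q * ∫ s in (0 : ℝ)..r, (r - s) ^ (α - 1) * v s) := by
    nth_rewrite 1 [e2]; ring
  rw [mul_add] at e1
  linarith

/-! ### The Mittag-Leffler series and its Volterra equation. -/

theorem Gamma_div_Gamma_add_le {α x : ℝ} (hα0 : 0 < α) (hα1 : α ≤ 1) (hx : 1 ≤ x) :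
    Real.Gamma x / Real.Gamma (x + α) ≤ 2 * x ^ (-α) := by
  have hx0 : 0 < x := by linarith
  have hG := Real.Gamma_pos_of_pos (show 0 < x + α by linarith)
  have key : x * Real.Gamma x ≤ Real.Gamma (x + α) * (x + α) ^ (1 - α) := by
    rw [← Real.Gamma_add_one hx0.ne']
    rcases hα1.eq_or_lt with rfl | h1
    · simp
    -- Log-convexity of `Γ` at `x + 1 = α (x + α) + (1 - α) (x + α + 1)`.
    have h := Real.Gamma_mul_add_mul_le_rpow_Gamma_mul_rpow_Gamma (s := x + α) (t := x + α + 1)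
      (a := α) (b := 1 - α) (by linarith) (by linarith) hα0 (by linarith) (by ring)
    have e : α * (x + α) + (1 - α) * (x + α + 1) = x + 1 := by ring
    rw [e, Real.Gamma_add_one (by linarith : x + α ≠ 0), Real.mul_rpow (by linarith) hG.le] at h
    refine h.trans (le_of_eq ?_)
    have : Real.Gamma (x + α) ^ α * Real.Gamma (x + α) ^ (1 - α) = Real.Gamma (x + α) := by
      rw [← Real.rpow_add hG]; simp
    linear_combination (x + α) ^ (1 - α) * this
  have h2 : (x + α) ^ (1 - α) ≤ 2 * x ^ (1 - α) := by
    calc (x + α) ^ (1 - α) ≤ (2 * x) ^ (1 - α) :=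
          Real.rpow_le_rpow (by linarith) (by linarith) (by linarith)
      _ = 2 ^ (1 - α) * x ^ (1 - α) := Real.mul_rpow (by norm_num) hx0.le
      _ ≤ 2 ^ (1 : ℝ) * x ^ (1 - α) := by
          apply mul_le_mul_of_nonneg_right _ (Real.rpow_nonneg hx0.le _)
          exact Real.rpow_le_rpow_of_exponent_le (by norm_num) (by linarith)
      _ = _ := by simp
  have h3 : x ^ (1 - α) = x * x ^ (-α) := by
    rw [sub_eq_add_neg, Real.rpow_add hx0, Real.rpow_one]
  rw [div_le_iff₀ hG]
  rw [h3] at h2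
  have h4 := key.trans (mul_le_mul_of_nonneg_left h2 hG.le)
  have h5 : x * Real.Gamma x ≤ x * (2 * x ^ (-α) * Real.Gamma (x + α)) := by
    linarith
  exact le_of_mul_le_mul_left h5 hx0

/-- Ratio test: consecutive terms have ratio `O(k^{-α})` by the Gamma quotient bound. -/
theorem summable_mittagLeffler {α : ℝ} (hα0 : 0 < α) (hα1 : α ≤ 1) (z : ℝ) :
    Summable fun k : ℕ => z ^ k / Real.Gamma (α * k + 1) := by
  rcases eq_or_ne z 0 with rfl | hz
  · apply summable_of_ne_finset_zero (s := {0})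
    intro k hk
    simp [show k ≠ 0 by simpa using hk]
  have hG : ∀ k : ℕ, 0 < Real.Gamma (α * k + 1) := fun k => Real.Gamma_pos_of_pos (by positivity)
  apply summable_of_ratio_test_tendsto_lt_one (l := 0) one_pos
  · filter_upwards with k
    exact div_ne_zero (pow_ne_zero _ hz) (hG k).ne'
  · have hlim : Tendsto (fun k : ℕ => |z| * (2 * (α * k + 1) ^ (-α))) atTop (𝓝 0) := by
      have h1 : Tendsto (fun k : ℕ => α * (k : ℝ) + 1) atTop atTop :=
        tendsto_atTop_add_const_right _ _ (tendsto_natCast_atTop_atTop.const_mul_atTop hα0)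
      have h2 := ((tendsto_rpow_neg_atTop hα0).comp h1).const_mul 2 |>.const_mul |z|
      simpa using h2
    refine squeeze_zero (fun k => by positivity) (fun k => ?_) hlim
    have h3 := Gamma_div_Gamma_add_le hα0 hα1 (x := α * k + 1) (by
      have : 0 ≤ α * k := by positivity
      linarith)
    have h4 : α * ((k + 1 : ℕ) : ℝ) + 1 = α * k + 1 + α := by push_cast; ring
    have e : ‖z ^ (k + 1) / Real.Gamma (α * ((k + 1 : ℕ) : ℝ) + 1)‖ / ‖z ^ k / Real.Gamma (α * k + 1)‖
        = |z| * (Real.Gamma (α * k + 1) / Real.Gamma (α * k + 1 + α)) := by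
      rw [h4]
      have h5 := hG k
      have h6 := hG (k + 1)
      rw [h4] at h6
      rw [norm_div, norm_div, norm_pow, norm_pow, Real.norm_eq_abs z, Real.norm_of_nonneg h5.le,
        Real.norm_of_nonneg h6.le]
      have : 0 < |z| := abs_pos.2 hz
      field_simp
      ring
    rw [e]
    exact mul_le_mul_of_nonneg_left h3 (abs_nonneg z)

theorem continuous_mittagLeffler {α : ℝ} (hα0 : 0 < α) (hα1 : α ≤ 1) :
    Continuous (mittagLeffler α 1) := by
  rw [continuous_iff_continuousAt]
  intro z
  have h : ContinuousOn (mittagLeffler α 1) (Set.Icc (-(|z| + 1)) (|z| + 1)) := by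
    apply continuousOn_tsum (u := fun k : ℕ => (|z| + 1) ^ k / Real.Gamma (α * k + 1))
    · intro k; fun_prop
    · exact summable_mittagLeffler hα0 hα1 _
    · intro k x hx
      have hG : 0 < Real.Gamma (α * k + 1) := Real.Gamma_pos_of_pos (by positivity)
      rw [norm_div, norm_pow, Real.norm_of_nonneg hG.le]
      gcongr
      exact abs_le.2 hx
  apply h.continuousAt
  apply Icc_mem_nhds <;> cases abs_cases z <;> linarith

/-- `E_α(-t^α)`. -/
def mlRelax (α t : ℝ) : ℝ := mittagLeffler α 1 (-t ^ α)

theorem continuous_mlRelax {α : ℝ} (hα0 : 0 < α) (hα1 : α ≤ 1) : Continuous (mlRelax α) :=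
  (continuous_mittagLeffler hα0 hα1).comp (Real.continuous_rpow_const hα0.le).neg

theorem mittagLeffler_zero {α : ℝ} : mittagLeffler α 1 0 = 1 := by
  rw [mittagLeffler, tsum_eq_single 0]
  · simp
  · intro k hk
    simp [hk]

theorem mlRelax_zero {α : ℝ} (hα0 : 0 < α) : mlRelax α 0 = 1 := by
  simp [mlRelax, Real.zero_rpow hα0.ne', mittagLeffler_zero]

/-- The Beta integral makes the kernel send the `k`-th term of the series to minus `Γ(α)` times the
next one, so integration shifts the series by one index. Sum and integral commute because the
integrals of the absolute values are the terms of the convergent series at `+t^α`. -/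
theorem mlRelax_volterra {α : ℝ} (hα0 : 0 < α) (hα1 : α ≤ 1) {t : ℝ} (ht : 0 < t) :
    mlRelax α t = 1 - (Real.Gamma α)⁻¹ * ∫ s in (0 : ℝ)..t, (t - s) ^ (α - 1) * mlRelax α s := by
  have hΓ := Real.Gamma_pos_of_pos hα0
  have hG : ∀ k : ℕ, 0 < Real.Gamma (α * k + 1) := fun k => Real.Gamma_pos_of_pos (by positivity)
  set F : ℕ → ℝ → ℝ := fun k s => (t - s) ^ (α - 1) * ((-s ^ α) ^ k / Real.Gamma (α * k + 1))
  have hpow : ∀ (k : ℕ) (s : ℝ), 0 ≤ s → (s ^ α) ^ k = s ^ (α * k + 1 - 1) := by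
    intro k s hs
    rw [← Real.rpow_natCast, ← Real.rpow_mul hs, add_sub_cancel_right]
  have hbase : ∀ k : ℕ, ∫ s in (0 : ℝ)..t, (t - s) ^ (α - 1) * ((s ^ α) ^ k / Real.Gamma (α * k + 1))
      = Real.Gamma α * ((t ^ α) ^ (k + 1) / Real.Gamma (α * ((k + 1 : ℕ) : ℝ) + 1)) := by
    intro k
    have h1 := integral_sub_rpow_mul_rpow hα0 (show 0 < α * (k : ℝ) + 1 by positivity) ht
    have h2 : ∫ s in (0 : ℝ)..t, (t - s) ^ (α - 1) * ((s ^ α) ^ k / Real.Gamma (α * k + 1)) =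
        (Real.Gamma (α * k + 1))⁻¹ * ∫ s in (0 : ℝ)..t, (t - s) ^ (α - 1) * s ^ (α * k + 1 - 1) := by
      rw [← intervalIntegral.integral_const_mul]
      apply intervalIntegral.integral_congr
      intro s hs
      rw [Set.uIcc_of_le ht.le] at hs
      simp only
      rw [hpow k s hs.1]
      ring
    rw [h2, h1, hpow (k + 1) t ht.le]
    have e1 : α + (α * (k : ℝ) + 1) = α * ((k + 1 : ℕ) : ℝ) + 1 := by push_cast; ring
    rw [e1]
    have := hG k
    have := hG (k + 1)
    field_simp
  have hFi : ∀ k, IntervalIntegrable (F k) volume 0 t := by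
    intro k
    apply (intervalIntegrable_sub_rpow hα0 t 0 t).mul_continuousOn
    have := Real.continuous_rpow_const hα0.le
    fun_prop
  have hFn : ∀ k, ∫ s in Set.Ioc 0 t, ‖F k s‖ =
      Real.Gamma α * ((t ^ α) ^ (k + 1) / Real.Gamma (α * ((k + 1 : ℕ) : ℝ) + 1)) := by
    intro k
    rw [← hbase k, intervalIntegral.integral_of_le ht.le]
    apply setIntegral_congr_fun measurableSet_Ioc
    intro s hs
    simp only [F]
    rw [norm_mul, norm_div, norm_pow, norm_neg, Real.norm_of_nonneg (hG k).le,
      Real.norm_of_nonneg (Real.rpow_nonneg hs.1.le _),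
      Real.norm_of_nonneg (Real.rpow_nonneg (by linarith [hs.2]) _)]
  have hsum := (summable_nat_add_iff 1).2 (summable_mittagLeffler hα0 hα1 (t ^ α))
  have hS := hasSum_integral_of_summable_integral_norm (μ := volume.restrict (Set.Ioc 0 t)) (F := F)
    (fun k => (intervalIntegrable_iff_integrableOn_Ioc_of_le ht.le).1 (hFi k))
    (by simp_rw [hFn]; exact hsum.mul_left _)
  have hFv : ∀ k, ∫ s in Set.Ioc 0 t, F k s =
      Real.Gamma α * -((-t ^ α) ^ (k + 1) / Real.Gamma (α * ((k + 1 : ℕ) : ℝ) + 1)) := by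
    intro k
    have e : ∀ s, F k s = (-1) ^ k * ((t - s) ^ (α - 1) * ((s ^ α) ^ k / Real.Gamma (α * k + 1))) := by
      intro s
      simp only [F]
      rw [neg_pow]; ring
    simp_rw [e]
    rw [integral_const_mul, ← intervalIntegral.integral_of_le ht.le, hbase, neg_pow (t ^ α) (k + 1),
      pow_succ (-1 : ℝ)]
    ring
  have hI : ∫ s in Set.Ioc 0 t, ∑' k, F k s = ∫ s in (0 : ℝ)..t, (t - s) ^ (α - 1) * mlRelax α s := by
    rw [intervalIntegral.integral_of_le ht.le]
    congr 1
    funext s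
    simp only [F, mlRelax, mittagLeffler]
    rw [tsum_mul_left]
  rw [hI] at hS
  simp_rw [hFv] at hS
  rw [← hS.tsum_eq, tsum_mul_left, tsum_neg, ← mul_assoc, inv_mul_cancel₀ hΓ.ne', one_mul,
    sub_neg_eq_add, mlRelax, mittagLeffler,
    (summable_mittagLeffler hα0 hα1 (-t ^ α)).tsum_eq_zero_add]
  simp

theorem mlRelax_pos {α : ℝ} (hα0 : 0 < α) (hα1 : α ≤ 1) {t : ℝ} (ht : 0 ≤ t) : 0 < mlRelax α t := by
  refine volterra_pos hα0 hα1 (inv_nonneg.2 (Real.Gamma_pos_of_pos hα0).le) (f := fun _ => 1)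
    (continuous_mlRelax hα0 hα1).continuousOn (by rw [mlRelax_zero hα0]; exact one_pos)
    (fun t ht => mlRelax_volterra hα0 hα1 ht) (fun s t hs hst => ?_) t ht
  simp only [one_mul]
  exact Real.rpow_le_rpow hs.le hst (by linarith)

theorem mlRelax_le_one {α : ℝ} (hα0 : 0 < α) (hα1 : α ≤ 1) {t : ℝ} (ht : 0 ≤ t) :
    mlRelax α t ≤ 1 := by
  rcases ht.eq_or_lt with rfl | ht
  · rw [mlRelax_zero hα0]
  rw [mlRelax_volterra hα0 hα1 ht, sub_le_self_iff]
  apply mul_nonneg (inv_nonneg.2 (Real.Gamma_pos_of_pos hα0).le)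
  apply intervalIntegral.integral_nonneg ht.le
  intro s hs
  exact mul_nonneg (Real.rpow_nonneg (by linarith [hs.2]) _) (mlRelax_pos hα0 hα1 hs.1).le

/-- The difference `v(t) = u(t) - u(t + h)` solves a Volterra equation with the same kernel; its
forcing term is the memory of `[0, h]` seen from `t + h`. After multiplication by `t^{1-α}` that
integrand becomes `(1 + (h - s)/t)^{α-1} u(s)`, which increases with `t`, so `volterra_pos` applies.
-/
theorem mlRelax_lt_of_lt {α : ℝ} (hα0 : 0 < α) (hα1 : α ≤ 1) {t h : ℝ} (ht : 0 ≤ t) (hh : 0 < h) :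
    mlRelax α (t + h) < mlRelax α t := by
  have hc := continuous_mlRelax hα0 hα1
  have hΓ := Real.Gamma_pos_of_pos hα0
  have hint : ∀ t a b, IntervalIntegrable (fun s => (t - s) ^ (α - 1) * mlRelax α s) volume a b :=
    fun t a b => (intervalIntegrable_sub_rpow hα0 t a b).mul_continuousOn hc.continuousOn
  have hpI : 0 < ∫ s in (0 : ℝ)..h, (h - s) ^ (α - 1) * mlRelax α s := by
    apply intervalIntegral.intervalIntegral_pos_of_pos_on (hint _ _ _) _ hh
    intro s hs
    exact mul_pos (Real.rpow_pos_of_pos (by linarith [hs.2]) _) (mlRelax_pos hα0 hα1 hs.1.le)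
  have hmain := volterra_pos hα0 hα1 (inv_nonneg.2 hΓ.le)
    (v := fun t => mlRelax α t - mlRelax α (t + h))
    (f := fun t => (Real.Gamma α)⁻¹ * ∫ s in (0 : ℝ)..h, (t + h - s) ^ (α - 1) * mlRelax α s)
    (by fun_prop)
    (by
      simp only [zero_add]
      rw [mlRelax_zero hα0, mlRelax_volterra hα0 hα1 hh, sub_sub_cancel]
      exact mul_pos (inv_pos.2 hΓ) hpI)
    (fun t ht => by
      have e1 := mlRelax_volterra hα0 hα1 ht
      have e2 := mlRelax_volterra hα0 hα1 (show 0 < t + h by linarith)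
      rw [← intervalIntegral.integral_add_adjacent_intervals (hint (t + h) 0 h)
        (hint (t + h) h (t + h))] at e2
      have e3 : ∫ s in h..(t + h), (t + h - s) ^ (α - 1) * mlRelax α s =
          ∫ s in (0 : ℝ)..t, (t - s) ^ (α - 1) * mlRelax α (s + h) := by
        have := intervalIntegral.integral_comp_add_right
          (fun s => (t + h - s) ^ (α - 1) * mlRelax α s) (a := 0) (b := t) h
        rw [zero_add] at this
        rw [← this]
        simp only [add_sub_add_right_eq_sub]
      have e4 : ∫ s in (0 : ℝ)..t, (t - s) ^ (α - 1) * (mlRelax α s - mlRelax α (s + h)) =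
          (∫ s in (0 : ℝ)..t, (t - s) ^ (α - 1) * mlRelax α s) -
          ∫ s in (0 : ℝ)..t, (t - s) ^ (α - 1) * mlRelax α (s + h) := by
        rw [← intervalIntegral.integral_sub (hint _ _ _)]
        · simp only [mul_sub]
        · exact (intervalIntegrable_sub_rpow hα0 t 0 t).mul_continuousOn (by fun_prop)
      rw [e4, ← e3, e1, e2]
      ring)
    (fun s t hs hst => by
      have ht := hs.trans_le hst
      rw [mul_assoc, mul_assoc]
      apply mul_le_mul_of_nonneg_left _ (inv_nonneg.2 hΓ.le)
      rw [← intervalIntegral.integral_mul_const, ← intervalIntegral.integral_mul_const]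
      apply intervalIntegral.integral_mono_on_of_le_Ioo hh.le ((hint _ _ _).mul_const _)
        ((hint _ _ _).mul_const _)
      intro u hu
      have hu2 : 0 < h - u := by linarith [hu.2]
      have key : ∀ r : ℝ, 0 < r → (r + h - u) ^ (α - 1) * r ^ (1 - α) =
          (1 + (h - u) / r) ^ (α - 1) := by
        intro r hr
        have : r ^ (1 - α) = (r⁻¹) ^ (α - 1) := by
          rw [Real.inv_rpow hr.le, ← Real.rpow_neg hr.le, neg_sub]
        rw [this, ← Real.mul_rpow (by linarith) (by positivity)]
        congr 1
        field_simp
        ring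
      have k : (s + h - u) ^ (α - 1) * s ^ (1 - α) ≤ (t + h - u) ^ (α - 1) * t ^ (1 - α) := by
        rw [key s hs, key t ht]
        apply Real.rpow_le_rpow_of_nonpos (by positivity) _ (by linarith)
        gcongr
      have := mul_le_mul_of_nonneg_right k (mlRelax_pos hα0 hα1 hu.1.le).le
      linarith) t ht
  linarith

/-- As `u` decreases, its fractional integral is at least `u(t) t^α / Γ(1+α)`; by the Volterra
equation and `u > 0` that integral is at most `1`. -/
theorem mlRelax_mul_le {α : ℝ} (hα0 : 0 < α) (hα1 : α ≤ 1) {t : ℝ} (ht : 0 < t) :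
    mlRelax α t * t ^ α ≤ Real.Gamma (1 + α) := by
  have hc := continuous_mlRelax hα0 hα1
  have hΓ := Real.Gamma_pos_of_pos hα0
  have h1 : t ^ α / α * mlRelax α t ≤ ∫ s in (0 : ℝ)..t, (t - s) ^ (α - 1) * mlRelax α s := by
    have h2 := integral_sub_rpow (a := 0) (t := t) hα0
    rw [sub_zero] at h2
    rw [← h2, ← intervalIntegral.integral_mul_const]
    apply intervalIntegral.integral_mono_on ht.le
      ((intervalIntegrable_sub_rpow hα0 t 0 t).mul_const _)
      ((intervalIntegrable_sub_rpow hα0 t 0 t).mul_continuousOn hc.continuousOn)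
    intro s hs
    apply mul_le_mul_of_nonneg_left _ (Real.rpow_nonneg (by linarith [hs.2]) _)
    rcases hs.2.eq_or_lt with rfl | h
    · exact le_rfl
    · have := mlRelax_lt_of_lt hα0 hα1 hs.1 (show 0 < t - s by linarith)
      rw [add_sub_cancel] at this
      exact this.le
  have h3 := mlRelax_volterra hα0 hα1 ht
  have h4 := mlRelax_pos hα0 hα1 ht.le
  have h5 := mul_le_mul_of_nonneg_left h1 (inv_nonneg.2 hΓ.le)
  have h6 : (Real.Gamma α)⁻¹ * (t ^ α / α * mlRelax α t) ≤ 1 := by linarith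
  have h7 : (Real.Gamma α)⁻¹ * (t ^ α / α * mlRelax α t) =
      mlRelax α t * t ^ α / (α * Real.Gamma α) := by
    field_simp
  rw [h7, div_le_one (by positivity)] at h6
  rwa [add_comm, Real.Gamma_add_one hα0.ne']

/-! ### Transfer to the relaxation functions by the time scaling `t ↦ λ_l^{1/α} t`. -/

theorem relaxation_eq {α : ℝ} (hα0 : 0 < α) (l : ℕ) {t : ℝ} (ht : 0 ≤ t) :
    relaxation α l t = mlRelax α (eigenvalue l ^ (1 / α) * t) := by
  have hl : 0 ≤ eigenvalue l := by unfold eigenvalue; positivity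
  rw [relaxation, mlRelax, Real.mul_rpow (Real.rpow_nonneg hl _) ht, ← Real.rpow_mul hl,
    one_div_mul_cancel hα0.ne', Real.rpow_one, neg_mul]

theorem eigenvalue_nonneg (l : ℕ) : 0 ≤ eigenvalue l := by unfold eigenvalue; positivity

theorem relaxation_nonneg {α : ℝ} (hα0 : 0 < α) (hα1 : α ≤ 1) (l : ℕ) {t : ℝ} (ht : 0 ≤ t) :
    0 ≤ relaxation α l t := by
  rw [relaxation_eq hα0 l ht]
  exact (mlRelax_pos hα0 hα1 (mul_nonneg (Real.rpow_nonneg (eigenvalue_nonneg l) _) ht)).le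

theorem relaxation_le_one {α : ℝ} (hα0 : 0 < α) (hα1 : α ≤ 1) (l : ℕ) {t : ℝ} (ht : 0 ≤ t) :
    relaxation α l t ≤ 1 := by
  rw [relaxation_eq hα0 l ht]
  exact mlRelax_le_one hα0 hα1 (mul_nonneg (Real.rpow_nonneg (eigenvalue_nonneg l) _) ht)

theorem relaxation_mul_le {α : ℝ} (hα0 : 0 < α) (hα1 : α ≤ 1) {l : ℕ} (hl : 1 ≤ l) {t : ℝ}
    (ht : 0 < t) : relaxation α l t * (eigenvalue l * t ^ α) ≤ Real.Gamma (1 + α) := by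
  have hl0 : 0 < eigenvalue l := by
    have : (0 : ℝ) < l := by exact_mod_cast hl
    unfold eigenvalue; positivity
  have h := mlRelax_mul_le hα0 hα1 (mul_pos (Real.rpow_pos_of_pos hl0 (1 / α)) ht)
  rwa [← relaxation_eq hα0 l ht.le, Real.mul_rpow (Real.rpow_nonneg hl0.le _) ht.le,
    ← Real.rpow_mul hl0.le, one_div_mul_cancel hα0.ne', Real.rpow_one] at h

theorem continuous_relaxation {α : ℝ} (hα0 : 0 < α) (hα1 : α ≤ 1) (l : ℕ) :
    Continuous (relaxation α l) :=
  (continuous_mittagLeffler hα0 hα1).comp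
    (continuous_const.mul (Real.continuous_rpow_const hα0.le))

/-! ### Orthogonality of the associated Legendre functions -/

section Legendre

open Polynomial

theorem sq_sub_one_mul_derivative (l : ℕ) :
    ((X : ℝ[X]) ^ 2 - 1) * derivative ((X ^ 2 - 1) ^ l) = C (2 * l : ℝ) * X * (X ^ 2 - 1) ^ l := by
  rcases l with _ | k
  · simp
  · rw [derivative_pow]
    simp only [derivative_sub, derivative_X_pow, derivative_one, Nat.add_sub_cancel, map_mul,
      map_natCast, map_ofNat]
    push_cast
    ring

/-- The differential equation satisfied by the derivatives of `(X² - 1)^l`. -/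
theorem iterate_derivative_sq_sub_one_pow (l n : ℕ) :
    ((X : ℝ[X]) ^ 2 - 1) * derivative^[n + 2] ((X ^ 2 - 1) ^ l) +
      C (2 * (n + 1 - l) : ℝ) * X * derivative^[n + 1] ((X ^ 2 - 1) ^ l) +
      C ((n + 1) * (n - 2 * l) : ℝ) * derivative^[n] ((X ^ 2 - 1) ^ l) = 0 := by
  induction n with
  | zero =>
    have h := congrArg derivative (sq_sub_one_mul_derivative l)
    simp only [derivative_mul, derivative_sub, derivative_X_pow, derivative_one, derivative_C,
      derivative_X] at h
    simp only [Function.iterate_succ_apply', Function.iterate_zero_apply]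
    simp only [map_mul, map_add, map_sub, map_natCast, map_ofNat, map_one, map_zero, Nat.cast_zero,
      Nat.cast_ofNat] at h ⊢
    linear_combination h
  | succ n ih =>
    have h := congrArg derivative ih
    simp only [derivative_mul, derivative_sub, derivative_add, derivative_X_pow, derivative_one,
      derivative_C, derivative_X, derivative_zero, ← Function.iterate_succ_apply' derivative] at h
    simp only [map_mul, map_add, map_sub, map_natCast, map_ofNat, map_one,
      Nat.cast_ofNat, Nat.cast_add, Nat.cast_one] at h ⊢
    linear_combination h

theorem iterate_derivative_legendre (l m : ℕ) :
    derivative^[m] (legendre l) =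
      C ((2 : ℝ) ^ l * (l.factorial : ℝ))⁻¹ * derivative^[l + m] ((X ^ 2 - 1) ^ l) := by
  rw [legendre, iterate_derivative_C_mul, ← Function.iterate_add_apply, add_comm]

/-- The `m`-fold differentiated Legendre equation in Sturm–Liouville form, ready for integration by
parts. -/
theorem derivative_one_sub_sq_pow_mul (l m : ℕ) :
    derivative ((1 - X ^ 2) ^ (m + 1) * derivative^[m + 1] (legendre l)) =
      -C (((l : ℝ) - m) * (l + m + 1)) * ((1 - X ^ 2) ^ m * derivative^[m] (legendre l)) := by
  have h := iterate_derivative_sq_sub_one_pow l (l + m)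
  rw [derivative_mul, ← Function.iterate_succ_apply' derivative, derivative_pow]
  simp only [derivative_sub, derivative_X_pow, derivative_one, iterate_derivative_legendre,
    Nat.add_sub_cancel]
  simp only [map_mul, map_add, map_sub, map_natCast, map_ofNat, map_one,
    Nat.cast_ofNat, Nat.cast_add, Nat.cast_one, ← add_assoc] at h ⊢
  linear_combination -((1 - X ^ 2) ^ m * C ((2 : ℝ) ^ l * (l.factorial : ℝ))⁻¹) * h

/-- The integral `∫_{-1}^1 (1-x²)^m P_l^{(m)} P_{l'}^{(m)}`. -/
def legendreInt (m l l' : ℕ) : ℝ :=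
  ∫ x in (-1 : ℝ)..1, ((1 - X ^ 2) ^ m * derivative^[m] (legendre l) *
    derivative^[m] (legendre l')).eval x

theorem integral_eval_derivative (p : ℝ[X]) :
    ∫ x in (-1 : ℝ)..1, (derivative p).eval x = p.eval 1 - p.eval (-1) :=
  intervalIntegral.integral_eq_sub_of_hasDerivAt (fun x _ => p.hasDerivAt x)
    ((derivative p).continuous.intervalIntegrable _ _)

/-- Integration by parts against the Sturm–Liouville form; the factor `(1 - x²)^{m+1}` kills the
boundary terms. -/
theorem legendreInt_succ (m l l' : ℕ) :
    legendreInt (m + 1) l l' = ((l : ℝ) - m) * (l + m + 1) * legendreInt m l l' := by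
  have h := integral_eval_derivative
    (((1 - X ^ 2) ^ (m + 1) * derivative^[m + 1] (legendre l)) * derivative^[m] (legendre l'))
  rw [derivative_mul, derivative_one_sub_sq_pow_mul, ← Function.iterate_succ_apply' derivative] at h
  simp only [eval_add] at h
  rw [intervalIntegral.integral_add ((Polynomial.continuous _).intervalIntegrable _ _)
    ((Polynomial.continuous _).intervalIntegrable _ _)] at h
  simp only [eval_mul, eval_neg, eval_C, eval_pow, eval_sub, eval_one, eval_X] at h
  simp only [legendreInt, eval_mul, eval_pow, eval_sub, eval_one, eval_X]
  rw [← intervalIntegral.integral_const_mul]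
  have e : (fun x : ℝ => ((l : ℝ) - m) * (l + m + 1) * ((1 - x ^ 2) ^ m *
      (derivative^[m] (legendre l)).eval x * (derivative^[m] (legendre l')).eval x)) =
      fun x => -(-((↑l - ↑m) * (↑l + ↑m + 1)) * ((1 - x ^ 2) ^ m *
      (derivative^[m] (legendre l)).eval x) * (derivative^[m] (legendre l')).eval x) := by
    funext x; ring
  rw [e, intervalIntegral.integral_neg]
  norm_num at h
  norm_num
  linarith

theorem legendreInt_comm (m l l' : ℕ) : legendreInt m l l' = legendreInt m l' l := by
  simp only [legendreInt]
  congr 1; funext x; congr 1; ring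

/-- At `m = 0` the integral of order one is symmetric in the degrees, so `l(l+1)` and `l'(l'+1)`
multiply the same number. As they differ, that number is zero, and the recursion carries this to
every `m`. -/
theorem legendreInt_of_ne {l l' : ℕ} (h : l ≠ l') (m : ℕ) : legendreInt m l l' = 0 := by
  induction m with
  | zero =>
    have h1 := legendreInt_succ 0 l l'
    have h2 := legendreInt_succ 0 l' l
    rw [legendreInt_comm 1, legendreInt_comm 0, h1] at h2
    have h3 : (((l : ℝ) - l') * (l + l' + 1)) * legendreInt 0 l l' = 0 := by
      push_cast at h2; linarith
    rcases mul_eq_zero.1 h3 with h4 | h4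
    · exfalso
      rcases mul_eq_zero.1 h4 with h5 | h5
      · exact h (by exact_mod_cast sub_eq_zero.1 h5)
      · have : (0 : ℝ) < (l : ℝ) + l' + 1 := by positivity
        linarith
    · exact h4
  | succ m ih => rw [legendreInt_succ, ih, mul_zero]

theorem integral_one_sub_sq_pow (l : ℕ) :
    ∫ x in (-1 : ℝ)..1, (1 - x ^ 2) ^ l = 2 ^ (2 * l + 1) * (l.factorial : ℝ) ^ 2 /
      ((2 * l + 1).factorial : ℝ) := by
  induction l with
  | zero => norm_num
  | succ l ih =>
    -- This polynomial vanishes at both ends, and its derivative links the exponents `l + 1` and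
    -- `l`.
    have h := integral_eval_derivative (X * (1 - X ^ 2) ^ (l + 1))
    have e : ∀ x : ℝ, (derivative (X * (1 - X ^ 2) ^ (l + 1) : ℝ[X])).eval x =
        (2 * l + 3) * (1 - x ^ 2) ^ (l + 1) - (2 * l + 2) * (1 - x ^ 2) ^ l := by
      intro x
      simp only [derivative_mul, derivative_pow, derivative_sub, derivative_one, derivative_X,
        Nat.add_sub_cancel, eval_add, eval_mul, eval_pow, eval_sub, eval_one, eval_X, eval_C,
        eval_zero]
      push_cast
      simp
      ring
    simp only [e] at h
    have hi : ∀ (c : ℝ) (n : ℕ), IntervalIntegrable (fun x : ℝ => c * (1 - x ^ 2) ^ n) volume (-1) 1 :=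
      fun c n => (by fun_prop : Continuous fun x : ℝ => c * (1 - x ^ 2) ^ n).intervalIntegrable _ _
    rw [intervalIntegral.integral_sub (hi _ _) (hi _ _), intervalIntegral.integral_const_mul,
      intervalIntegral.integral_const_mul, ih] at h
    simp only [eval_mul, eval_X, eval_pow, eval_sub, eval_one] at h
    norm_num at h
    have h1 : (0 : ℝ) < 2 * l + 3 := by positivity
    rw [← mul_right_inj' h1.ne', sub_eq_zero.1 h, show 2 * (l + 1) + 1 = (2 * l + 1) + 1 + 1 by ring,
      Nat.factorial_succ (2 * l + 1 + 1), Nat.factorial_succ (2 * l + 1), Nat.factorial_succ l]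
    push_cast
    have h2 : ((2 * l + 1).factorial : ℝ) ≠ 0 := by positivity
    have h3 : (2 * (l : ℝ) + 1 + 1 + 1) ≠ 0 := by positivity
    field_simp
    ring

theorem iterate_derivative_legendre_self (l : ℕ) :
    derivative^[l] (legendre l) = C (((2 * l).factorial : ℝ) / (2 ^ l * l.factorial)) := by
  have hm : ((X : ℝ[X]) ^ 2 - 1).Monic := monic_X_pow_sub_C 1 two_ne_zero
  have hd : ((X : ℝ[X]) ^ 2 - 1).natDegree = 2 := natDegree_X_pow_sub_C (n := 2) (r := (1 : ℝ))
  have hm' := hm.pow l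
  have hd' : (((X : ℝ[X]) ^ 2 - 1) ^ l).natDegree = l + l := by
    rw [hm.natDegree_pow, hd]; ring
  rw [iterate_derivative_legendre]
  have h0 : (derivative^[l + l] (((X : ℝ[X]) ^ 2 - 1) ^ l)).natDegree = 0 := by
    have := natDegree_iterate_derivative (((X : ℝ[X]) ^ 2 - 1) ^ l) (l + l)
    rw [hd'] at this
    omega
  rw [eq_C_of_natDegree_eq_zero h0, coeff_iterate_derivative]
  have hc := hm'.coeff_natDegree
  rw [hd'] at hc
  rw [zero_add, hc, Nat.descFactorial_self, ← two_mul, ← C_mul]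
  congr 1
  simp
  field_simp

theorem legendreInt_self {l m : ℕ} (h : m ≤ l) :
    legendreInt m l l = 2 / (2 * l + 1) * (((l + m).factorial : ℝ) / ((l - m).factorial : ℝ)) := by
  have step : ∀ m, m ≤ l → legendreInt m l l =
      ((l + m).factorial : ℝ) / ((l - m).factorial : ℝ) * legendreInt 0 l l := by
    intro m
    induction m with
    | zero =>
      intro _
      have : (l.factorial : ℝ) ≠ 0 := by positivity
      simp [this]
    | succ m ih =>
      intro hm
      rw [legendreInt_succ, ih (by omega), ← add_assoc, Nat.factorial_succ (l + m)]
      obtain ⟨k, rfl⟩ : ∃ k, l = m + 1 + k := ⟨l - (m + 1), by omega⟩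
      rw [show m + 1 + k - m = k + 1 by omega, show m + 1 + k - (m + 1) = k by omega,
        Nat.factorial_succ k]
      push_cast
      have : ((k.factorial : ℕ) : ℝ) ≠ 0 := by positivity
      field_simp
      ring
  -- The recursion is read at `m = l`, where the derivative is constant and the integral explicit,
  -- to recover the value at `m = 0`.
  have hl := step l le_rfl
  have hv : legendreInt l l l = (((2 * l).factorial : ℝ) / (2 ^ l * l.factorial)) ^ 2 *
      (2 ^ (2 * l + 1) * (l.factorial : ℝ) ^ 2 / ((2 * l + 1).factorial : ℝ)) := by
    rw [← integral_one_sub_sq_pow, ← intervalIntegral.integral_const_mul, legendreInt]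
    congr 1; funext x
    rw [iterate_derivative_legendre_self]
    simp only [eval_mul, eval_pow, eval_sub, eval_one, eval_X, eval_C]
    ring
  rw [step m h]
  have h0 : legendreInt 0 l l = 2 / (2 * l + 1) := by
    rw [hv, Nat.sub_self, ← two_mul, Nat.factorial_zero, Nat.factorial_succ] at hl
    have h1 : ((2 * l).factorial : ℝ) ≠ 0 := by positivity
    have h2 : (l.factorial : ℝ) ≠ 0 := by positivity
    push_cast at hl
    rw [div_one] at hl
    rw [← mul_right_inj' h1, ← hl]
    have : (2 : ℝ) ^ (2 * l + 1) = 2 * (2 ^ l) ^ 2 := by rw [pow_succ, pow_mul']; ring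
    rw [this]
    field_simp
  rw [h0]; ring

end Legendre

/-! ### Orthonormality of the spherical harmonics -/

theorem norm_sq_E3 (x : E3) : ‖x‖ ^ 2 = x 0 ^ 2 + x 1 ^ 2 + x 2 ^ 2 := by
  rw [EuclideanSpace.real_norm_sq_eq, Fin.sum_univ_three]

theorem S2_sum_sq (x : S2) : x.1 0 ^ 2 + x.1 1 ^ 2 + x.1 2 ^ 2 = 1 := by
  have h := x.2
  rw [mem_sphere_zero_iff_norm] at h
  rw [← norm_sq_E3, h, one_pow]

theorem measurable_rotate (R : E3 ≃ₗᵢ[ℝ] E3) : Measurable (rotate R) :=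
  (R.continuous.measurable.comp measurable_subtype_coe).subtype_mk

open scoped Pointwise in
-- Surface measure is, up to the dimension factor, the volume of the cone `(0,1) • s`. An isometry
-- maps cones to cones and preserves volume.
theorem measurePreserving_rotate_toSphere (R : E3 ≃ₗᵢ[ℝ] E3) :
    MeasurePreserving (rotate R) (volume : Measure E3).toSphere (volume : Measure E3).toSphere := by
  refine ⟨measurable_rotate R, Measure.ext fun s hs => ?_⟩
  rw [Measure.map_apply (measurable_rotate R) hs, Measure.toSphere_apply' _ hs,
    Measure.toSphere_apply' _ (measurable_rotate R hs)]
  congr 1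
  have himg : R '' (Set.Ioo (0 : ℝ) 1 • ((↑) '' (rotate R ⁻¹' s) : Set E3)) =
      Set.Ioo (0 : ℝ) 1 • ((↑) '' s : Set E3) := by
    ext y
    simp only [Set.mem_image, Set.mem_smul, Set.mem_preimage]
    constructor
    · rintro ⟨_, ⟨r, hr, _, ⟨x, hx, rfl⟩, rfl⟩, rfl⟩
      exact ⟨r, hr, _, ⟨_, hx, rfl⟩, by simp [rotate]⟩
    · rintro ⟨r, hr, _, ⟨x, hx, rfl⟩, rfl⟩
      refine ⟨r • R.symm x.1, ⟨r, hr, _, ⟨rotate R.symm x, ?_, rfl⟩, by simp [rotate]⟩, by simp⟩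
      have : rotate R (rotate R.symm x) = x := by ext1; simp [rotate]
      rwa [this]
  rw [← himg, ← R.measurePreserving.measure_preimage_emb R.toHomeomorph.measurableEmbedding
    (R '' _), Set.preimage_image_eq _ R.injective]

theorem measurePreserving_rotate (R : E3 ≃ₗᵢ[ℝ] E3) :
    MeasurePreserving (rotate R) sphereMeasure sphereMeasure :=
  ⟨measurable_rotate R, by
    rw [sphereMeasure, Measure.map_smul, (measurePreserving_rotate_toSphere R).map_eq]⟩

/-- The rotation of angle `φ` about the third axis. -/
def axisRotation (φ : ℝ) : E3 ≃ₗᵢ[ℝ] E3 :=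
  LinearIsometry.toLinearIsometryEquiv
    (⟨{ toFun := fun x => !₂[Real.cos φ * x 0 - Real.sin φ * x 1,
          Real.sin φ * x 0 + Real.cos φ * x 1, x 2]
        map_add' := fun x y => by
          ext i; fin_cases i <;> simp <;> ring
        map_smul' := fun c x => by
          ext i; fin_cases i <;> simp <;> ring }, fun x => by
        rw [← sq_eq_sq₀ (norm_nonneg _) (norm_nonneg _), norm_sq_E3, norm_sq_E3]
        simp
        linear_combination (x 0 ^ 2 + x 1 ^ 2) * Real.sin_sq_add_cos_sq φ⟩ : E3 →ₗᵢ[ℝ] E3) rfl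

theorem axisRotation_apply (φ : ℝ) (x : E3) :
    axisRotation φ x = !₂[Real.cos φ * x 0 - Real.sin φ * x 1,
      Real.sin φ * x 0 + Real.cos φ * x 1, x 2] := rfl

theorem harmonicNonneg_rotate (l m : ℕ) (φ : ℝ) (x : S2) :
    harmonicNonneg l m (rotate (axisRotation φ) x) =
      Complex.exp (m * (φ * Complex.I)) * harmonicNonneg l m x := by
  have h : ∀ i, (rotate (axisRotation φ) x).1 i = (axisRotation φ x.1) i := fun i => rfl
  simp only [harmonicNonneg, h, axisRotation_apply]
  rw [Complex.exp_nat_mul, Complex.exp_mul_I]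
  have e : ((((!₂[Real.cos φ * x.1 0 - Real.sin φ * x.1 1,
      Real.sin φ * x.1 0 + Real.cos φ * x.1 1, x.1 2] : E3) 0 : ℝ) : ℂ) +
      Complex.I * (((!₂[Real.cos φ * x.1 0 - Real.sin φ * x.1 1,
      Real.sin φ * x.1 0 + Real.cos φ * x.1 1, x.1 2] : E3) 1 : ℝ) : ℂ)) =
      (Complex.cos φ + Complex.sin φ * Complex.I) * ((x.1 0 : ℂ) + Complex.I * (x.1 1 : ℂ)) := by
    simp
    linear_combination (-Complex.sin φ * x.1 1) * Complex.I_sq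
  rw [e, mul_pow]
  simp
  ring

theorem sphericalHarmonic_rotate (l : ℕ) (m : ℤ) (φ : ℝ) (x : S2) :
    sphericalHarmonic l m (rotate (axisRotation φ) x) =
      Complex.exp (m * (φ * Complex.I)) * sphericalHarmonic l m x := by
  unfold sphericalHarmonic
  split_ifs with h
  · rw [harmonicNonneg_rotate]
    congr 2
    have : ((m.natAbs : ℤ) : ℂ) = (m : ℂ) := by rw [Int.natAbs_of_nonneg h]
    push_cast at this
    rw [← this]; simp
  · rw [harmonicNonneg_rotate, map_mul, ← Complex.exp_conj]
    have : ((m.natAbs : ℤ) : ℂ) = (-m : ℂ) := by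
      rw [Int.ofNat_natAbs_of_nonpos (by omega)]; push_cast; rfl
    simp only [map_mul, Complex.conj_ofReal, Complex.conj_I, Complex.conj_natCast]
    have e : (m.natAbs : ℂ) * (φ * -Complex.I) = m * (φ * Complex.I) := by
      rw [Int.cast_natCast] at this
      rw [this]; ring
    rw [e]; ring

/-- Rotation by `π / (m - m')` about the third axis multiplies the integrand by `e^{iπ} = -1` and
leaves the integral unchanged. -/
theorem integral_harmonic_of_ne (l l' : ℕ) {m m' : ℤ} (h : m ≠ m') :
    ∫ x, sphericalHarmonic l m x * conj (sphericalHarmonic l' m' x) ∂sphereMeasure = 0 := by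
  have hmm : ((m : ℂ) - m') ≠ 0 := by
    rw [sub_ne_zero]; exact_mod_cast h
  set φ : ℝ := Real.pi / (m - m') with hφ
  have hemb : MeasurableEmbedding (rotate (axisRotation φ)) := by
    refine MeasurableEquiv.measurableEmbedding
      (⟨⟨rotate (axisRotation φ), rotate (axisRotation φ).symm, fun x => ?_, fun x => ?_⟩,
        measurable_rotate _, measurable_rotate _⟩ : S2 ≃ᵐ S2)
    · ext1; simp [rotate]
    · ext1; simp [rotate]
  have h1 := (measurePreserving_rotate (axisRotation φ)).integral_comp hemb
    (fun x => sphericalHarmonic l m x * conj (sphericalHarmonic l' m' x))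
  simp only [sphericalHarmonic_rotate] at h1
  have e : ∀ x, Complex.exp (m * (φ * Complex.I)) * sphericalHarmonic l m x *
      conj (Complex.exp (m' * (φ * Complex.I)) * sphericalHarmonic l' m' x) =
      -1 * (sphericalHarmonic l m x * conj (sphericalHarmonic l' m' x)) := by
    intro x
    have h2 : Complex.exp (m * (φ * Complex.I)) * conj (Complex.exp (m' * (φ * Complex.I))) = -1 := by
      rw [← Complex.exp_conj, ← Complex.exp_add, ← Complex.exp_pi_mul_I]
      congr 1
      simp only [map_mul, Complex.conj_ofReal, Complex.conj_I, map_intCast, hφ]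
      push_cast
      field_simp
      ring
    rw [map_mul, ← h2]; ring
  simp only [e] at h1
  rw [integral_const_mul] at h1
  generalize ∫ x, sphericalHarmonic l m x * conj (sphericalHarmonic l' m' x) ∂sphereMeasure = J at *
  linear_combination (-1 / 2) * h1

/-! ### Integrals over the sphere of functions of the third coordinate. -/

theorem integral_toSphere_mul (k : ℕ) :
    (∫ x : S2, x.1 2 ^ k ∂(volume : Measure E3).toSphere) *
      ∫ r in Set.Ioi (0 : ℝ), r ^ (k + 2) * Real.exp (-r ^ 2) =
    Real.pi * ∫ u : ℝ, u ^ k * Real.exp (-u ^ 2) := by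
  -- The same Gaussian integral is computed twice: in Cartesian coordinates it factors into three
  -- line integrals, in polar coordinates into the sphere moment times a radial integral.
  have hG : ∫ x : E3, x 2 ^ k * Real.exp (-‖x‖ ^ 2) = Real.pi * ∫ u : ℝ, u ^ k * Real.exp (-u ^ 2) := by
    rw [← (EuclideanSpace.volume_preserving_symm_measurableEquiv_toLp (Fin 3)).symm.integral_comp
      (MeasurableEquiv.measurableEmbedding _)]
    have := integral_fintype_prod_volume_eq_prod (𝕜 := ℝ) (ι := Fin 3) (E := fun _ => ℝ)
      (fun i (u : ℝ) => if i = 2 then u ^ k * Real.exp (-u ^ 2) else Real.exp (-u ^ 2))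
    simp only [Fin.prod_univ_three] at this
    simp only [Fin.isValue, Fin.reduceEq, if_false, if_true] at this
    have hg : ∫ u : ℝ, Real.exp (-u ^ 2) = Real.sqrt Real.pi := by
      simpa using integral_gaussian 1
    rw [hg, Real.mul_self_sqrt Real.pi_pos.le] at this
    rw [← this]
    congr 1
    funext x
    have e : ∀ i, ((MeasurableEquiv.toLp 2 (Fin 3 → ℝ)).symm.symm x) i = x i := fun i => rfl
    rw [norm_sq_E3, e, e, e, show -(x 0 ^ 2 + x 1 ^ 2 + x 2 ^ 2) =
      -(x 0) ^ 2 + -(x 1) ^ 2 + -(x 2) ^ 2 by ring, Real.exp_add, Real.exp_add]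
    ring
  rw [← hG]
  calc _ = (∫ x : S2, x.1 2 ^ k ∂(volume : Measure E3).toSphere) *
        ∫ r : Set.Ioi (0 : ℝ), r.1 ^ k * Real.exp (-r.1 ^ 2) ∂(Measure.volumeIoiPow 2) := by
        congr 1
        simp only [Measure.volumeIoiPow, ENNReal.ofReal]
        rw [integral_withDensity_eq_integral_smul,
          integral_subtype_comap measurableSet_Ioi
            fun a : ℝ => Real.toNNReal (a ^ 2) • (a ^ k * Real.exp (-a ^ 2))]
        · apply setIntegral_congr_fun measurableSet_Ioi
          intro r hr
          simp only [NNReal.smul_def, smul_eq_mul]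
          rw [Real.coe_toNNReal _ (by positivity)]
          ring
        · exact (measurable_subtype_coe.pow_const _).real_toNNReal
    _ = ∫ z : S2 × Set.Ioi (0 : ℝ), z.1.1 2 ^ k * (z.2.1 ^ k * Real.exp (-z.2.1 ^ 2))
          ∂((volume : Measure E3).toSphere.prod (Measure.volumeIoiPow 2)) :=
        (integral_prod_mul (fun x : S2 => x.1 2 ^ k)
          (fun r : Set.Ioi (0 : ℝ) => r.1 ^ k * Real.exp (-r.1 ^ 2))).symm
    _ = ∫ x : ({(0 : E3)}ᶜ : Set E3), x.1 2 ^ k * Real.exp (-‖x.1‖ ^ 2) ∂(volume.comap Subtype.val) := by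
        have hd : Module.finrank ℝ E3 - 1 = 2 := by simp
        have := (volume : Measure E3).measurePreserving_homeomorphUnitSphereProd
        rw [hd] at this
        rw [← this.integral_comp (Homeomorph.measurableEmbedding _)]
        congr 1
        funext x
        have hx : 0 < ‖x.1‖ := norm_pos_iff.2 x.2
        simp only [homeomorphUnitSphereProd_apply_snd_coe, homeomorphUnitSphereProd_apply_fst_coe]
        simp [mul_pow]
        field_simp
    _ = _ := by
        rw [integral_subtype_comap (measurableSet_singleton _).compl
          fun x : E3 => x 2 ^ k * Real.exp (-‖x‖ ^ 2), restrict_compl_singleton]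

theorem integral_Ioi_pow_mul_exp (k : ℕ) :
    ∫ r in Set.Ioi (0 : ℝ), r ^ k * Real.exp (-r ^ 2) = Real.Gamma (((k : ℝ) + 1) / 2) / 2 := by
  have := integral_rpow_mul_exp_neg_rpow (p := 2) (q := k) (by norm_num)
    (by have : (0 : ℝ) ≤ k := by positivity
        linarith)
  norm_cast at this
  rw [this]
  push_cast
  ring

theorem integral_pow_mul_exp (k : ℕ) :
    ∫ u : ℝ, u ^ k * Real.exp (-u ^ 2) = if Even k then Real.Gamma (((k : ℝ) + 1) / 2) else 0 := by
  split_ifs with h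
  · have := integral_comp_abs (f := fun u : ℝ => u ^ k * Real.exp (-u ^ 2))
    simp only [h.pow_abs, sq_abs] at this
    rw [this, integral_Ioi_pow_mul_exp]
    ring
  · have := integral_neg_eq_self (fun u : ℝ => u ^ k * Real.exp (-u ^ 2)) volume
    simp only [(Nat.not_even_iff_odd.1 h).neg_pow, neg_sq, neg_mul] at this
    rw [integral_neg] at this
    linarith

theorem integral_sphere_pow (k : ℕ) :
    ∫ x : S2, x.1 2 ^ k ∂sphereMeasure = if Even k then 1 / ((k : ℝ) + 1) else 0 := by
  have main : ∀ k : ℕ, ∫ x : S2, x.1 2 ^ k ∂(volume : Measure E3).toSphere =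
      if Even k then 4 * Real.pi / ((k : ℝ) + 1) else 0 := by
    intro k
    have h := integral_toSphere_mul k
    rw [integral_Ioi_pow_mul_exp, integral_pow_mul_exp] at h
    have hk : (0 : ℝ) < ((k : ℝ) + 1) / 2 := by positivity
    have hΓ := Real.Gamma_pos_of_pos hk
    -- The radial and the line integral involve Gamma values one step apart, so their quotient is
    -- rational. The case `k = 0` gives the total mass `4π` used to normalize.
    have e : ((((k + 2 : ℕ) : ℝ)) + 1) / 2 = ((k : ℝ) + 1) / 2 + 1 := by push_cast; ring
    rw [e, Real.Gamma_add_one hk.ne'] at h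
    have h' : (((k : ℝ) + 1) / 2 * Real.Gamma (((k : ℝ) + 1) / 2) / 2) ≠ 0 := by positivity
    rw [eq_div_of_mul_eq h' h]
    split_ifs
    · field_simp
      norm_num
    · simp
  have h0 := main 0
  simp only [pow_zero, Even.zero, if_true, integral_const, smul_eq_mul, mul_one, Nat.cast_zero,
    zero_add, div_one] at h0
  rw [sphereMeasure, integral_smul_measure, main, ENNReal.toReal_inv]
  rw [Measure.real] at h0
  rw [h0]
  split_ifs
  · simp
    field_simp
  · simp

/-- Archimedes: the third coordinate is uniformly distributed on `[-1, 1]`. -/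
theorem integral_sphere_eval (p : Polynomial ℝ) :
    ∫ x : S2, p.eval (x.1 2) ∂sphereMeasure = (∫ u in (-1 : ℝ)..1, p.eval u) / 2 := by
  have hc : ∀ q : Polynomial ℝ, Continuous fun x : S2 => q.eval (x.1 2) :=
    fun q => q.continuous.comp (by fun_prop)
  have hi : ∀ q : Polynomial ℝ, Integrable (fun x : S2 => q.eval (x.1 2)) sphereMeasure :=
    fun q => (hc q).integrable_of_hasCompactSupport (HasCompactSupport.of_compactSpace _)
  induction p using Polynomial.induction_on' with
  | add p q hp hq =>
    simp only [Polynomial.eval_add]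
    rw [integral_add (hi p) (hi q), hp, hq, intervalIntegral.integral_add
      (p.continuous.intervalIntegrable _ _) (q.continuous.intervalIntegrable _ _)]
    ring
  | monomial n a =>
    simp only [Polynomial.eval_monomial]
    rw [integral_const_mul, integral_sphere_pow, intervalIntegral.integral_const_mul, integral_pow]
    split_ifs with h
    · rw [(Nat.even_add_one.not_left.2 h |> Nat.not_even_iff_odd.1).neg_one_pow]
      simp
      ring
    · rw [(Nat.even_add_one.2 h).neg_one_pow]
      simp

/-- For equal orders the azimuthal factors combine to `|x₁ + i x₂|^{2m} = (1 - x₃²)^m`. The product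
is thus a polynomial in `x₃`, to which `integral_sphere_eval` applies. -/
theorem harmonicNonneg_mul_conj (l l' m : ℕ) (x : S2) :
    harmonicNonneg l m x * conj (harmonicNonneg l' m x) =
      ((Real.sqrt ((2 * l + 1) * ((l - m).factorial : ℝ) / ((l + m).factorial : ℝ)) *
        Real.sqrt ((2 * l' + 1) * ((l' - m).factorial : ℝ) / ((l' + m).factorial : ℝ)) *
        ((1 - Polynomial.X ^ 2) ^ m * Polynomial.derivative^[m] (legendre l) *
          Polynomial.derivative^[m] (legendre l')).eval (x.1 2) : ℝ) : ℂ) := by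
  have h1 : ((x.1 0 : ℂ) + Complex.I * (x.1 1 : ℂ)) * conj ((x.1 0 : ℂ) + Complex.I * (x.1 1 : ℂ)) =
      ((1 - x.1 2 ^ 2 : ℝ) : ℂ) := by
    have h0 : 1 - x.1 2 ^ 2 = x.1 0 ^ 2 + x.1 1 ^ 2 := by linarith [S2_sum_sq x]
    rw [h0]
    simp only [map_add, map_mul, Complex.conj_ofReal, Complex.conj_I]
    push_cast
    linear_combination -(x.1 1 : ℂ) ^ 2 * Complex.I_sq
  have h2 : ((-1 : ℂ) ^ m) * (-1) ^ m = 1 := by rw [← mul_pow]; simp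
  simp only [harmonicNonneg, map_mul, map_pow, Complex.conj_ofReal, map_neg, map_one,
    Polynomial.eval_mul, Polynomial.eval_pow, Polynomial.eval_sub, Polynomial.eval_one,
    Polynomial.eval_X]
  rw [Complex.ofReal_mul, Complex.ofReal_mul, Complex.ofReal_mul, Complex.ofReal_mul,
    Complex.ofReal_pow, ← h1, mul_pow]
  generalize (Real.sqrt ((2 * l + 1) * ((l - m).factorial : ℝ) / ((l + m).factorial : ℝ)) : ℂ) = a
  generalize (Real.sqrt ((2 * l' + 1) * ((l' - m).factorial : ℝ) / ((l' + m).factorial : ℝ)) : ℂ) = b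
  generalize (((Polynomial.derivative^[m] (legendre l)).eval (x.1 2) : ℝ) : ℂ) = p
  generalize (((Polynomial.derivative^[m] (legendre l')).eval (x.1 2) : ℝ) : ℂ) = p'
  generalize ((x.1 0 : ℂ) + Complex.I * (x.1 1 : ℂ)) ^ m = A
  generalize (conj ((x.1 0 : ℂ) + Complex.I * (x.1 1 : ℂ))) ^ m = B
  linear_combination (a * b * p * p' * A * B) * h2

theorem integral_harmonicNonneg {l l' m : ℕ} (hl : m ≤ l) :
    ∫ x, harmonicNonneg l m x * conj (harmonicNonneg l' m x) ∂sphereMeasure =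
      if l = l' then 1 else 0 := by
  simp only [harmonicNonneg_mul_conj]
  rw [integral_complex_ofReal, integral_const_mul, integral_sphere_eval]
  change ((_ * (legendreInt m l l' / 2) : ℝ) : ℂ) = _
  split_ifs with h
  · subst h
    rw [legendreInt_self hl, Real.mul_self_sqrt (by positivity)]
    rw [Complex.ofReal_eq_one]
    have h1 : ((l + m).factorial : ℝ) ≠ 0 := by positivity
    have h2 : ((l - m).factorial : ℝ) ≠ 0 := by positivity
    have h3 : (2 * (l : ℝ) + 1) ≠ 0 := by positivity
    field_simp
  · rw [legendreInt_of_ne h]; simp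

/-- The spherical harmonics are orthonormal. -/
theorem integral_harmonic {l l' : ℕ} {m m' : ℤ} (hm : m ∈ Finset.Icc (-(l : ℤ)) l) :
    ∫ x, sphericalHarmonic l m x * conj (sphericalHarmonic l' m' x) ∂sphereMeasure =
      if l = l' ∧ m = m' then 1 else 0 := by
  by_cases hmm : m = m'
  · subst hmm
    rw [Finset.mem_Icc] at hm
    have hle : m.natAbs ≤ l := by omega
    have := integral_harmonicNonneg (l' := l') hle
    simp only [and_true]
    rw [← this]
    by_cases h0 : 0 ≤ m
    · simp only [sphericalHarmonic, if_pos h0]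
    · simp only [sphericalHarmonic, if_neg h0]
      have h2 : ((-1 : ℂ) ^ m.natAbs) * (-1) ^ m.natAbs = 1 := by rw [← mul_pow]; simp
      rw [this]
      have e : ∀ x, (-1) ^ m.natAbs * conj (harmonicNonneg l m.natAbs x) *
          conj ((-1) ^ m.natAbs * conj (harmonicNonneg l' m.natAbs x)) =
          conj (harmonicNonneg l m.natAbs x * conj (harmonicNonneg l' m.natAbs x)) := by
        intro x
        simp only [map_mul, map_pow, map_neg, map_one, Complex.conj_conj]
        linear_combination (conj (harmonicNonneg l m.natAbs x) * harmonicNonneg l' m.natAbs x) * h2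
      simp only [e]
      rw [integral_conj, this]
      split_ifs <;> simp
  · rw [integral_harmonic_of_ne l l' hmm, if_neg (fun h => hmm h.2)]

/-! ### Wiener integrals -/

/-! ### Linear extension of maps that scale distances. -/

section Hilbert

variable {E F ι : Type*} [NormedAddCommGroup E] [InnerProductSpace ℝ E] [NormedAddCommGroup F]
  [InnerProductSpace ℝ F]

/-- Distances to a common zero and mutual distances determine the Gram matrix by polarization, so
the two Gram matrices are proportional. For increments of a process this makes orthogonality of
disjoint increments a consequence of the variance formula. -/
theorem norm_linearCombination_sq {v : ι → E} {u : ι → F} {A : ℝ}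
    (h : ∀ i j, ‖v i - v j‖ ^ 2 = A * ‖u i - u j‖ ^ 2) {o : ι} (hv : v o = 0) (hu : u o = 0)
    (a : ι →₀ ℝ) :
    ‖Finsupp.linearCombination ℝ v a‖ ^ 2 = A * ‖Finsupp.linearCombination ℝ u a‖ ^ 2 := by
  have hn : ∀ i, ‖v i‖ ^ 2 = A * ‖u i‖ ^ 2 := fun i => by simpa [hv, hu] using h i o
  have hi : ∀ i j, ⟪v i, v j⟫ = A * ⟪u i, u j⟫ := by
    intro i j
    have h1 := h i j
    rw [norm_sub_sq_real, norm_sub_sq_real] at h1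
    linarith [hn i, hn j]
  have h2 : ⟪Finsupp.linearCombination ℝ v a, Finsupp.linearCombination ℝ v a⟫ =
      A * ⟪Finsupp.linearCombination ℝ u a, Finsupp.linearCombination ℝ u a⟫ := by
    simp only [Finsupp.linearCombination_apply, Finsupp.sum, sum_inner, inner_sum,
      inner_smul_left, inner_smul_right, hi, Finset.mul_sum]
    simp only [mul_left_comm A]
  rwa [real_inner_self_eq_norm_sq, real_inner_self_eq_norm_sq] at h2

theorem cauchySeq_linearCombination {v : ι → E} {u : ι → F} {A : ℝ} (hA : 0 ≤ A)
    (h : ∀ i j, ‖v i - v j‖ ^ 2 = A * ‖u i - u j‖ ^ 2) {o : ι} (hv : v o = 0) (hu : u o = 0)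
    {a : ℕ → ι →₀ ℝ} (ha : CauchySeq fun k => Finsupp.linearCombination ℝ u (a k)) :
    CauchySeq fun k => Finsupp.linearCombination ℝ v (a k) := by
  rw [cauchySeq_iff_tendsto_dist_atTop_0] at ha ⊢
  have e : ∀ n : ℕ × ℕ, dist (Finsupp.linearCombination ℝ v (a n.1))
      (Finsupp.linearCombination ℝ v (a n.2)) = Real.sqrt A *
      dist (Finsupp.linearCombination ℝ u (a n.1)) (Finsupp.linearCombination ℝ u (a n.2)) := by
    intro n
    rw [dist_eq_norm, dist_eq_norm, ← map_sub, ← map_sub,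
      ← sq_eq_sq₀ (norm_nonneg _) (by positivity), mul_pow, Real.sq_sqrt hA,
      norm_linearCombination_sq h hv hu]
  simp only [e]
  simpa using ha.const_mul (Real.sqrt A)

/-- The formal combination of point masses attached to a step function. -/
def stepComb (n : ℕ) (p : ℕ → ι) (c : ℕ → ℝ) : ι →₀ ℝ :=
  ∑ i ∈ Finset.range n, c i • (Finsupp.single (p (i + 1)) 1 - Finsupp.single (p i) 1)

theorem linearCombination_stepComb (v : ι → E) (n : ℕ) (p : ℕ → ι) (c : ℕ → ℝ) :
    Finsupp.linearCombination ℝ v (stepComb n p c) =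
      ∑ i ∈ Finset.range n, c i • (v (p (i + 1)) - v (p i)) := by
  simp [stepComb, map_sum, map_sub]

variable {Ω : Type*} [MeasurableSpace Ω] {μ : Measure Ω}

theorem norm_toLp_sq {f : Ω → E} (hf : MemLp f 2 μ) : ‖hf.toLp f‖ ^ 2 = ∫ ω, ‖f ω‖ ^ 2 ∂μ := by
  rw [← real_inner_self_eq_norm_sq, L2.inner_def]
  apply integral_congr_ae
  filter_upwards [hf.coeFn_toLp] with ω hω
  rw [hω, real_inner_self_eq_norm_sq]

theorem inner_toLp {f g : Ω → E} (hf : MemLp f 2 μ) (hg : MemLp g 2 μ) :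
    ⟪hf.toLp f, hg.toLp g⟫ = ∫ ω, ⟪f ω, g ω⟫ ∂μ := by
  rw [L2.inner_def]
  apply integral_congr_ae
  filter_upwards [hf.coeFn_toLp, hg.coeFn_toLp] with ω hω hω'
  rw [hω, hω']

theorem toLp_sum_increments {T : ℝ} (X : Set.Icc (0 : ℝ) T → Ω → E) {o : Set.Icc (0 : ℝ) T}
    (hX : ∀ t, MemLp (fun ω => X t ω - X o ω) 2 μ) (n : ℕ) (p : ℕ → Set.Icc (0 : ℝ) T) (c : ℕ → ℝ) :
    ∃ h : MemLp (fun ω => ∑ i ∈ Finset.range n, c i • (X (p (i + 1)) ω - X (p i) ω)) 2 μ,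
      h.toLp _ = Finsupp.linearCombination ℝ (fun t => (hX t).toLp _) (stepComb n p c) := by
  simp only [linearCombination_stepComb]
  induction n with
  | zero =>
    simp only [Finset.range_zero, Finset.sum_empty]
    exact ⟨MemLp.zero', MemLp.toLp_zero _⟩
  | succ n ih =>
    obtain ⟨h, e⟩ := ih
    have h0 := (hX (p (n + 1))).sub (hX (p n))
    have h1 := h0.const_smul (c n)
    have e1 : h1.toLp _ = c n • ((hX (p (n + 1))).toLp _ - (hX (p n)).toLp _) := by
      rw [MemLp.toLp_const_smul _ h0, MemLp.toLp_sub]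
    have h2 := h.add h1
    have e2 : h2.toLp _ = h.toLp _ + h1.toLp _ := MemLp.toLp_add _ _
    have e3 : (fun ω => ∑ i ∈ Finset.range (n + 1), c i • (X (p (i + 1)) ω - X (p i) ω)) =
        (fun ω => ∑ i ∈ Finset.range n, c i • (X (p (i + 1)) ω - X (p i) ω)) +
        c n • ((fun ω => X (p (n + 1)) ω - X o ω) - fun ω => X (p n) ω - X o ω) := by
      funext ω
      rw [Finset.sum_range_succ]
      simp
    have h3 : MemLp (fun ω => ∑ i ∈ Finset.range (n + 1), c i • (X (p (i + 1)) ω - X (p i) ω)) 2 μ := by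
      rw [e3]; exact h2
    refine ⟨h3, ?_⟩
    rw [Finset.sum_range_succ, ← e, ← e1, ← e2, MemLp.toLp_eq_toLp_iff, e3]

end Hilbert

/-! ### Existence and isometry of the integral for a process with Brownian second moments. -/

section WienerIntegral

variable {Ω : Type*} [MeasurableSpace Ω] {P : Measure Ω}

/-- The indicator of `(0, t]`, as a function on `[0, T]`. -/
def cumInd (t u : ℝ) : ℝ := (Set.Ioc 0 t).indicator (fun _ => 1) u

theorem cumInd_sub {s t : ℝ} (hs : 0 ≤ s) (hst : s ≤ t) (u : ℝ) :
    cumInd t u - cumInd s u = (Set.Ioc s t).indicator (fun _ => 1) u := by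
  simp only [cumInd, Set.indicator_apply, Set.mem_Ioc]
  split_ifs <;> grind

theorem stepFun_eq {n : ℕ} {p c : ℕ → ℝ} (hp : Monotone p) (h0 : ∀ i, 0 ≤ p i) (u : ℝ) :
    stepFun n p c u = ∑ i ∈ Finset.range n, c i • (cumInd (p (i + 1)) u - cumInd (p i) u) := by
  unfold stepFun
  apply Finset.sum_congr rfl
  intro i _
  rw [cumInd_sub (h0 i) (hp (Nat.le_succ i)), smul_eq_mul]
  simp only [Set.indicator_apply]
  split_ifs <;> simp

theorem memLp_cumInd_sub (s t T : ℝ) :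
    MemLp (fun u => cumInd t u - cumInd s u) 2 (volume.restrict (Set.Icc 0 T)) := by
  have h : ∀ t, MemLp (fun u => cumInd t u) 2 (volume.restrict (Set.Icc 0 T)) := fun t =>
    (memLp_const (1 : ℝ)).indicator measurableSet_Ioc
  exact (h t).sub (h s)

theorem integral_cumInd_sub_sq {s t T : ℝ} (hs : 0 ≤ s) (hst : s ≤ t) (ht : t ≤ T) :
    ∫ u in Set.Icc 0 T, ‖cumInd t u - cumInd s u‖ ^ 2 = t - s := by
  have e : ∀ u, ‖cumInd t u - cumInd s u‖ ^ 2 = (Set.Ioc s t).indicator (fun _ => (1 : ℝ)) u := by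
    intro u
    rw [cumInd_sub hs hst]
    simp only [Set.indicator_apply]
    split_ifs <;> simp
  simp only [e]
  have hsub : Set.Ioc s t ∩ Set.Icc 0 T = Set.Ioc s t :=
    Set.inter_eq_left.2 fun x hx => ⟨hs.trans hx.1.le, hx.2.trans ht⟩
  rw [integral_indicator measurableSet_Ioc, Measure.restrict_restrict measurableSet_Ioc, hsub]
  simp [hst]

/-- A process whose increments have the second moments of a multiple of Brownian motion. -/
structure HasBrownianIncrements (P : Measure Ω) (X : ℝ → Ω → ℂ) (A : ℝ) : Prop where
  nonneg : 0 ≤ A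
  memLp : ∀ s t, 0 ≤ s → 0 ≤ t → MemLp (fun ω => X t ω - X s ω) 2 P
  sq : ∀ s t, 0 ≤ s → s ≤ t → ∫ ω, ‖X t ω - X s ω‖ ^ 2 ∂P = A * (t - s)

variable {X : ℝ → Ω → ℂ} {A T : ℝ}

/-- The class of `X t - X 0` in `L²`. -/
def incrLp (hX : HasBrownianIncrements P X A) (t : Set.Icc (0 : ℝ) T) : Lp ℂ 2 P :=
  (hX.memLp 0 t le_rfl t.2.1).toLp (fun ω => X t ω - X 0 ω)

/-- The class of the indicator of `(0, t]` in `L²([0, T])`. -/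
def cumIndLp (T : ℝ) (t : Set.Icc (0 : ℝ) T) : Lp ℝ 2 (volume.restrict (Set.Icc 0 T)) :=
  (memLp_cumInd_sub 0 t T).toLp (fun u => cumInd t u - cumInd 0 u)

/-- Both sides equal `A |s - t|`; this is the hypothesis of `norm_linearCombination_sq` for the
curves `t ↦ X t - X 0` and `t ↦ 1_{(0,t]}`. -/
theorem norm_incrLp_sub_sq (hX : HasBrownianIncrements P X A) (s t : Set.Icc (0 : ℝ) T) :
    ‖incrLp hX s - incrLp hX t‖ ^ 2 = A * ‖cumIndLp T s - cumIndLp T t‖ ^ 2 := by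
  wlog hst : t ≤ s generalizing s t
  · rw [norm_sub_rev, this t s (le_of_not_ge hst), norm_sub_rev]
  rw [incrLp, incrLp, cumIndLp, cumIndLp, ← MemLp.toLp_sub, ← MemLp.toLp_sub, norm_toLp_sq,
    norm_toLp_sq]
  simp only [Pi.sub_apply, sub_sub_sub_cancel_right]
  rw [integral_cumInd_sub_sq t.2.1 hst s.2.2, hX.sq _ _ t.2.1 hst]

theorem stepIntegral_toLp (hX : HasBrownianIncrements P X A) (hT : 0 ≤ T) (n : ℕ) {p : ℕ → ℝ}
    (hp : ∀ i, p i ∈ Set.Icc 0 T) (c : ℕ → ℝ) :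
    ∃ h : MemLp (stepIntegral X n p c) 2 P, h.toLp _ =
      Finsupp.linearCombination ℝ (incrLp hX) (stepComb n (fun i => (⟨p i, hp i⟩ : Set.Icc 0 T)) c) := by
  obtain ⟨h, e⟩ := toLp_sum_increments (fun (t : Set.Icc (0 : ℝ) T) => X t) (o := ⟨0, le_rfl, hT⟩)
    (fun t => hX.memLp 0 t le_rfl t.2.1) n (fun i => (⟨p i, hp i⟩ : Set.Icc 0 T)) c
  have e2 : stepIntegral X n p c =
      fun ω => ∑ i ∈ Finset.range n, c i • (X (p (i + 1)) ω - X (p i) ω) := by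
    funext ω
    simp [stepIntegral]
  have h' : MemLp (stepIntegral X n p c) 2 P := e2 ▸ h
  refine ⟨h', ?_⟩
  rw [show incrLp hX = fun t : Set.Icc (0 : ℝ) T => (hX.memLp 0 t le_rfl t.2.1).toLp _ from rfl, ← e,
    MemLp.toLp_eq_toLp_iff, e2]

theorem stepFun_toLp (hT : 0 ≤ T) (n : ℕ) {p : ℕ → ℝ} (hm : Monotone p)
    (hp : ∀ i, p i ∈ Set.Icc 0 T) (c : ℕ → ℝ) :
    ∃ h : MemLp (stepFun n p c) 2 (volume.restrict (Set.Icc 0 T)), h.toLp _ =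
      Finsupp.linearCombination ℝ (cumIndLp T) (stepComb n (fun i => (⟨p i, hp i⟩ : Set.Icc 0 T)) c) := by
  obtain ⟨h, e⟩ := toLp_sum_increments (fun (t : Set.Icc (0 : ℝ) T) => cumInd t)
    (o := ⟨0, le_rfl, hT⟩)
    (fun t => memLp_cumInd_sub 0 t T) n (fun i => (⟨p i, hp i⟩ : Set.Icc 0 T)) c
  have e2 : stepFun n p c =
      fun u => ∑ i ∈ Finset.range n, c i • (cumInd (p (i + 1)) u - cumInd (p i) u) :=
    funext fun u => stepFun_eq hm (fun i => (hp i).1) u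
  have h' : MemLp (stepFun n p c) 2 (volume.restrict (Set.Icc 0 T)) := e2 ▸ h
  refine ⟨h', ?_⟩
  rw [show cumIndLp T = fun t : Set.Icc (0 : ℝ) T => (memLp_cumInd_sub 0 t T).toLp _ from rfl, ← e,
    MemLp.toLp_eq_toLp_iff, e2]

/-- A continuous function is the `L²` limit of step functions. -/
theorem exists_stepFun_tendsto (hT : 0 < T) {g : ℝ → ℝ} (hg : ContinuousOn g (Set.Icc 0 T)) :
    ∃ (n : ℕ → ℕ) (p c : ℕ → ℕ → ℝ), (∀ k, Monotone (p k) ∧ ∀ i, p k i ∈ Set.Icc 0 T) ∧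
      Tendsto (fun k => eLpNorm (fun u => stepFun (n k) (p k) (c k) u - g u) 2
        (volume.restrict (Set.Icc 0 T))) atTop (𝓝 0) := by
  -- Uniform grid of mesh `T / (k + 1)`, capped at `T` so that every index gives a point of `[0,
  -- T]`.
  set p : ℕ → ℕ → ℝ := fun k i => min (i * (T / (k + 1))) T with hpdef
  have hd : ∀ k : ℕ, 0 < T / ((k : ℝ) + 1) := fun k => by positivity
  have hpm : ∀ k, Monotone (p k) := by
    intro k i j hij
    have : (i : ℝ) * (T / (k + 1)) ≤ j * (T / (k + 1)) :=
      mul_le_mul_of_nonneg_right (by exact_mod_cast hij) (hd k).le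
    exact min_le_min_right _ this
  have hpI : ∀ k i, p k i ∈ Set.Icc 0 T := fun k i =>
    ⟨le_min (mul_nonneg (Nat.cast_nonneg i) (hd k).le) hT.le, min_le_right _ _⟩
  refine ⟨fun k => k + 1, p, fun k i => g (p k i), fun k => ⟨hpm k, hpI k⟩, ?_⟩
  have hval : ∀ k : ℕ, ∀ u ∈ Set.Ioc 0 T, ∃ x ∈ Set.Icc 0 T, dist u x ≤ T / ((k : ℝ) + 1) ∧
      stepFun (k + 1) (p k) (fun i => g (p k i)) u = g x := by
    intro k u hu
    -- The ceiling selects the cell `(p i, p (i + 1)]` containing `u`, with `i = j - 1`; `u > 0`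
    -- makes `j` positive.
    set j : ℕ := ⌈u / (T / ((k : ℝ) + 1))⌉₊ with hj
    have hq : 0 < u / (T / ((k : ℝ) + 1)) := div_pos hu.1 (hd k)
    have hj0 : 0 < j := Nat.ceil_pos.2 hq
    obtain ⟨i, hi⟩ : ∃ i, j = i + 1 := ⟨j - 1, by omega⟩
    have hup : u ≤ (i + 1 : ℝ) * (T / (k + 1)) := by
      have := Nat.le_ceil (u / (T / ((k : ℝ) + 1)))
      rw [← hj, hi, div_le_iff₀ (hd k)] at this
      exact_mod_cast this
    have hlow : (i : ℝ) * (T / (k + 1)) < u := by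
      have := Nat.ceil_lt_add_one hq.le
      rw [← hj, hi] at this
      push_cast at this
      rw [← lt_div_iff₀ (hd k)]
      linarith
    have hik : i < k + 1 := by
      have h1 : (i : ℝ) * (T / (k + 1)) < (k + 1) * (T / (k + 1)) := by
        have : ((k : ℝ) + 1) * (T / (k + 1)) = T := by field_simp
        rw [this]; exact hlow.trans_le hu.2
      exact_mod_cast lt_of_mul_lt_mul_right h1 (hd k).le
    have hpi : p k i < u := (min_le_left _ _).trans_lt hlow
    have hpi1 : u ≤ p k (i + 1) := by
      apply le_min _ hu.2
      push_cast
      exact hup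
    refine ⟨p k i, hpI k i, ?_, ?_⟩
    · have : p k i = i * (T / (k + 1)) := min_eq_left (hlow.le.trans hu.2)
      rw [Real.dist_eq, this, abs_le]
      constructor <;> nlinarith [hd k]
    · rw [stepFun, Finset.sum_eq_single i]
      · exact Set.indicator_of_mem (Set.mem_Ioc.2 ⟨hpi, hpi1⟩) _
      · intro b _ hb
        apply Set.indicator_of_notMem
        rintro ⟨hb1, hb2⟩
        rcases lt_or_gt_of_ne hb with h | h
        · exact absurd (hpi.trans_le hb2) (not_lt.2 (hpm k (show b + 1 ≤ i by omega)))
        · exact absurd (hb1.trans_le hpi1) (not_lt.2 (hpm k (show i + 1 ≤ b by omega)))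
      · intro h
        exact absurd (Finset.mem_range.2 hik) h
  have huc := isCompact_Icc.uniformContinuousOn_of_continuous hg
  rw [Metric.uniformContinuousOn_iff] at huc
  have hbound : ∀ ε : ℝ, 0 < ε → ∀ᶠ k : ℕ in atTop,
      eLpNorm (fun u => stepFun (k + 1) (p k) (fun i => g (p k i)) u - g u) 2
        (volume.restrict (Set.Icc 0 T)) ≤ ENNReal.ofReal T ^ (2⁻¹ : ℝ) * ENNReal.ofReal ε := by
    intro ε hε
    obtain ⟨δ, hδ, hδ'⟩ := huc ε hε
    have hlim : Tendsto (fun k : ℕ => T / ((k : ℝ) + 1)) atTop (𝓝 0) :=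
      tendsto_const_div_atTop_nhds_zero_nat T |>.comp (tendsto_add_atTop_nat 1) |>.congr
        (fun k => by simp)
    filter_upwards [hlim.eventually (gt_mem_nhds hδ)] with k hk
    have hae : ∀ᵐ u ∂(volume.restrict (Set.Icc 0 T)),
        ‖stepFun (k + 1) (p k) (fun i => g (p k i)) u - g u‖ ≤ ε := by
      -- At `0` every half-open cell misses the point and the step function vanishes; a null set is
      -- discarded.
      rw [← restrict_Ioc_eq_restrict_Icc]
      filter_upwards [ae_restrict_mem measurableSet_Ioc] with u hu
      obtain ⟨x, hx, hd, he⟩ := hval k u hu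
      rw [he, ← dist_eq_norm, dist_comm]
      exact (hδ' u ⟨hu.1.le, hu.2⟩ x hx (hd.trans_lt hk)).le
    have := eLpNorm_le_of_ae_bound (p := 2) hae
    simpa using this
  rw [ENNReal.tendsto_nhds_zero]
  intro ε hε
  have hC : ENNReal.ofReal T ^ (2⁻¹ : ℝ) ≠ ⊤ := ENNReal.rpow_ne_top_of_nonneg (by norm_num) ENNReal.ofReal_ne_top
  have hlim2 : Tendsto (fun e : ℝ => ENNReal.ofReal T ^ (2⁻¹ : ℝ) * ENNReal.ofReal e) (𝓝[>] 0) (𝓝 0) := by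
    have h1 : Tendsto (fun e : ℝ => ENNReal.ofReal e) (𝓝[>] 0) (𝓝 0) := by
      have := (ENNReal.continuous_ofReal.tendsto 0).mono_left (nhdsWithin_le_nhds (s := Set.Ioi 0))
      simpa using this
    simpa using ENNReal.Tendsto.const_mul h1 (Or.inr hC)
  obtain ⟨e, he1, he2⟩ := ((hlim2.eventually (gt_mem_nhds hε)).and
    (eventually_mem_nhdsWithin : ∀ᶠ e : ℝ in 𝓝[>] 0, e ∈ Set.Ioi (0 : ℝ))).exists
  exact (hbound e he2).mono fun k hk => hk.trans he1.le

theorem incrLp_zero (hX : HasBrownianIncrements P X A) (hT : 0 ≤ T) :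
    incrLp hX (⟨0, le_rfl, hT⟩ : Set.Icc (0 : ℝ) T) = 0 := by
  have h : (fun ω => X 0 ω - X 0 ω) = 0 := by funext ω; simp
  simp only [incrLp, h]
  exact MemLp.toLp_zero _

theorem cumIndLp_zero (hT : 0 ≤ T) : cumIndLp T (⟨0, le_rfl, hT⟩ : Set.Icc (0 : ℝ) T) = 0 := by
  have h : (fun u => cumInd 0 u - cumInd 0 u) = 0 := by funext ω; simp
  simp only [cumIndLp, h]
  exact MemLp.toLp_zero _

theorem memLp_of_continuousOn_Icc {g : ℝ → ℝ} (hg : ContinuousOn g (Set.Icc 0 T)) :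
    MemLp g 2 (volume.restrict (Set.Icc 0 T)) := by
  obtain ⟨C, hC⟩ := isCompact_Icc.exists_bound_of_continuousOn hg
  exact MemLp.of_bound (hg.aestronglyMeasurable measurableSet_Icc) C
    ((ae_restrict_mem measurableSet_Icc).mono fun u hu => hC u hu)

/-- Continuous functions have a Wiener integral. -/
theorem exists_isWienerIntegral (hX : HasBrownianIncrements P X A) (hT : 0 < T) {g : ℝ → ℝ}
    (hg : ContinuousOn g (Set.Icc 0 T)) : ∃ J, IsWienerIntegral P X g 0 T J := by
  obtain ⟨n, p, c, hp, hlim⟩ := exists_stepFun_tendsto hT hg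
  have hgL := memLp_of_continuousOn_Icc hg
  choose hF eF using fun k => stepFun_toLp hT.le (n k) (hp k).1 (hp k).2 (c k)
  choose hI eI using fun k => stepIntegral_toLp hX hT.le (n k) (hp k).2 (c k)
  have hU := (Lp.tendsto_Lp_iff_tendsto_eLpNorm'' _ hF g hgL).2 hlim
  simp only [eF] at hU
  -- Convergence of the step functions makes them Cauchy, the scaled isometry transfers this to the
  -- step integrals, and completeness of `L²(P)` provides the limit.
  have hV := cauchySeq_linearCombination hX.nonneg (norm_incrLp_sub_sq (T := T) hX)
    (incrLp_zero hX hT.le) (cumIndLp_zero hT.le) hU.cauchySeq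
  obtain ⟨J, hJ⟩ := cauchySeq_tendsto_of_complete hV
  simp only [← eI] at hJ
  have hJ' := (Lp.tendsto_Lp_iff_tendsto_eLpNorm'' _ hI J (Lp.memLp J)).1 (by rwa [Lp.toLp_coeFn])
  exact ⟨J, Lp.memLp J, n, p, c, hp, hlim, hJ'⟩

/-- The Itô isometry. -/
theorem IsWienerIntegral.integral_norm_sq (hX : HasBrownianIncrements P X A) (hT : 0 < T)
    {g : ℝ → ℝ} (hg : ContinuousOn g (Set.Icc 0 T)) {J : Ω → ℂ} (hJ : IsWienerIntegral P X g 0 T J) :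
    ∫ ω, ‖J ω‖ ^ 2 ∂P = A * ∫ u in (0 : ℝ)..T, g u ^ 2 := by
  obtain ⟨hJm, n, p, c, hp, hlim, hlimJ⟩ := hJ
  have hgL := memLp_of_continuousOn_Icc hg
  choose hF eF using fun k => stepFun_toLp hT.le (n k) (hp k).1 (hp k).2 (c k)
  choose hI eI using fun k => stepIntegral_toLp hX hT.le (n k) (hp k).2 (c k)
  have hU := (Lp.tendsto_Lp_iff_tendsto_eLpNorm'' _ hF g hgL).2 hlim
  have hV := (Lp.tendsto_Lp_iff_tendsto_eLpNorm'' _ hI J hJm).2 hlimJ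
  simp only [eF] at hU
  simp only [eI] at hV
  have hU2 := (hU.norm.pow 2).const_mul A
  have hV2 := hV.norm.pow 2
  simp only [norm_linearCombination_sq (norm_incrLp_sub_sq (T := T) hX)
    (incrLp_zero hX hT.le) (cumIndLp_zero hT.le)] at hV2
  have := tendsto_nhds_unique hV2 hU2
  rw [norm_toLp_sq, norm_toLp_sq] at this
  rw [this, intervalIntegral.integral_of_le hT.le, integral_Icc_eq_integral_Ioc]
  simp

/-- Orthogonality to every `X t - X 0` passes to step integrals by linearity and to their `L²` limit
by continuity. -/
theorem IsWienerIntegral.integral_inner_eq_zero (hX : HasBrownianIncrements P X A) (hT : 0 < T)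
    {g : ℝ → ℝ} {J : Ω → ℂ} (hJ : IsWienerIntegral P X g 0 T J) {Z : Ω → ℂ} (hZ : MemLp Z 2 P)
    (hZX : ∀ t, 0 ≤ t → ∫ ω, ⟪Z ω, X t ω - X 0 ω⟫ ∂P = 0) : ∫ ω, ⟪Z ω, J ω⟫ ∂P = 0 := by
  obtain ⟨hJm, n, p, c, hp, -, hlimJ⟩ := hJ
  choose hI eI using fun k => stepIntegral_toLp hX hT.le (n k) (hp k).2 (c k)
  have hV := (Lp.tendsto_Lp_iff_tendsto_eLpNorm'' _ hI J hJm).2 hlimJ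
  simp only [eI] at hV
  have hz : ∀ t : Set.Icc (0 : ℝ) T, ⟪hZ.toLp Z, incrLp hX t⟫ = 0 := by
    intro t
    rw [incrLp, inner_toLp, hZX t t.2.1]
  have hV2 := (tendsto_const_nhds (x := hZ.toLp Z)).inner (𝕜 := ℝ) hV
  simp only [linearCombination_stepComb, inner_sum, inner_smul_right, inner_sub_right, hz, sub_zero,
    mul_zero, Finset.sum_const_zero] at hV2
  have := tendsto_nhds_unique hV2 tendsto_const_nhds
  rwa [inner_toLp] at this

end WienerIntegral

/-! ### Fourier coefficients of the initial field and of the noise -/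

section Coefficients

theorem reHarmonic_coeFn (l : ℕ) (m : ℤ) :
    reHarmonic l m =ᵐ[sphereMeasure] fun x => (sphericalHarmonic l m x).re :=
  ContinuousMap.coeFn_toLp sphereMeasure (𝕜 := ℝ) _

theorem imHarmonic_coeFn (l : ℕ) (m : ℤ) :
    imHarmonic l m =ᵐ[sphereMeasure] fun x => (sphericalHarmonic l m x).im :=
  ContinuousMap.coeFn_toLp sphereMeasure (𝕜 := ℝ) _

theorem fourierCoeff_eq_inner (f : SphereL2) (l : ℕ) (m : ℤ) :
    fourierCoeff f l m = ((⟪f, reHarmonic l m⟫ : ℝ) : ℂ) - ((⟪f, imHarmonic l m⟫ : ℝ) : ℂ) * Complex.I := by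
  have hi : ∀ g : SphereL2, Integrable (fun x => ((f x * g x : ℝ) : ℂ)) sphereMeasure := fun g =>
    ((Lp.memLp f).integrable_mul (Lp.memLp g)).ofReal
  have hin : ∀ g : SphereL2, ((⟪f, g⟫ : ℝ) : ℂ) = ∫ x, ((f x * g x : ℝ) : ℂ) ∂sphereMeasure := by
    intro g
    rw [L2.inner_def, integral_complex_ofReal]
    congr 2
    funext x
    simp [mul_comm]
  rw [hin, hin, ← integral_mul_const, ← integral_sub (hi _) ((hi _).mul_const _), fourierCoeff]
  apply integral_congr_ae
  filter_upwards [reHarmonic_coeFn l m, imHarmonic_coeFn l m] with x h1 h2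
  rw [h1, h2]
  apply Complex.ext <;> simp

theorem continuous_fourierCoeff (l : ℕ) (m : ℤ) :
    Continuous fun f : SphereL2 => fourierCoeff f l m := by
  simp only [fourierCoeff_eq_inner]
  fun_prop

theorem norm_reHarmonic_sq_add (l : ℕ) {m : ℤ} (hm : m ∈ Finset.Icc (-(l : ℤ)) l) :
    ‖reHarmonic l m‖ ^ 2 + ‖imHarmonic l m‖ ^ 2 = 1 := by
  have hc := continuous_sphericalHarmonic l m
  have hi : ∀ {g : S2 → ℝ}, Continuous g → Integrable g sphereMeasure := fun hg =>
    hg.integrable_of_hasCompactSupport (HasCompactSupport.of_compactSpace _)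
  have e1 : ‖reHarmonic l m‖ ^ 2 = ∫ x, (sphericalHarmonic l m x).re ^ 2 ∂sphereMeasure := by
    rw [← real_inner_self_eq_norm_sq, L2.inner_def]
    apply integral_congr_ae
    filter_upwards [reHarmonic_coeFn l m] with x h
    rw [h]; simp [sq]
  have e2 : ‖imHarmonic l m‖ ^ 2 = ∫ x, (sphericalHarmonic l m x).im ^ 2 ∂sphereMeasure := by
    rw [← real_inner_self_eq_norm_sq, L2.inner_def]
    apply integral_congr_ae
    filter_upwards [imHarmonic_coeFn l m] with x h
    rw [h]; simp [sq]
  have h := integral_harmonic (l' := l) (m' := m) hm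
  simp only [and_self, if_true] at h
  have e3 : ∀ x, sphericalHarmonic l m x * conj (sphericalHarmonic l m x) =
      (((sphericalHarmonic l m x).re ^ 2 + (sphericalHarmonic l m x).im ^ 2 : ℝ) : ℂ) := by
    intro x
    rw [Complex.mul_conj, Complex.normSq_apply]
    push_cast; ring
  simp only [e3] at h
  rw [integral_complex_ofReal] at h
  rw [e1, e2, ← integral_add (hi (by fun_prop)) (hi (by fun_prop))]
  exact_mod_cast h

variable {Ω : Type*} [MeasurableSpace Ω] {P : Measure Ω}

theorem memLp_of_hasLaw_gaussianReal {X : Ω → ℝ} {v : ℝ≥0} (hX : HasLaw X (gaussianReal 0 v) P) :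
    MemLp X 2 P := by
  have h := memLp_id_gaussianReal (μ := 0) (v := v) 2
  rw [← hX.map_eq] at h
  exact (memLp_map_measure_iff aestronglyMeasurable_id hX.aemeasurable).1 h

theorem integral_sq_of_hasLaw_gaussianReal {X : Ω → ℝ} {v : ℝ≥0}
    (hX : HasLaw X (gaussianReal 0 v) P) : ∫ ω, X ω ^ 2 ∂P = v := by
  have h := hX.variance_eq
  rw [variance_id_gaussianReal, variance_of_integral_eq_zero hX.aemeasurable] at h
  · simpa using h
  · rw [hX.integral_eq, integral_id_gaussianReal]

variable {Q : SphereL2 →L[ℝ] SphereL2} {τ : ℝ} {W : ℝ → Ω → SphereL2} {A : ℕ → ℝ}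

/-- Real and imaginary parts are pairings of `W` with eigenfunctions of `Q`. Their variances add up
to `A_l (t - s) (‖Re Y‖² + ‖Im Y‖²) = A_l (t - s)`, whatever the correlation between the two parts.
-/
theorem IsQWiener.hasBrownianIncrements (hW : IsQWiener P Q τ W) (hA : IsNoiseSpectrum Q A)
    (l : ℕ) {m : ℤ} (hm : m ∈ Finset.Icc (-(l : ℤ)) l) :
    HasBrownianIncrements P (fun s ω => fourierCoeff (W (τ + s) ω) l m) (A l) := by
  obtain ⟨hA0, hAm⟩ := hA l
  obtain ⟨hre, him⟩ := hAm m hm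
  have e : ∀ s t ω, fourierCoeff (W (τ + t) ω) l m - fourierCoeff (W (τ + s) ω) l m =
      ((⟪W (τ + t) ω - W (τ + s) ω, reHarmonic l m⟫ : ℝ) : ℂ) -
      ((⟪W (τ + t) ω - W (τ + s) ω, imHarmonic l m⟫ : ℝ) : ℂ) * Complex.I := by
    intro s t ω
    rw [fourierCoeff_eq_inner, fourierCoeff_eq_inner, inner_sub_left, inner_sub_left]
    push_cast; ring
  have hlaw : ∀ s t, 0 ≤ s → s ≤ t → ∀ f, HasLaw (fun ω => ⟪W (τ + t) ω - W (τ + s) ω, f⟫)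
      (gaussianReal 0 (Real.toNNReal ((t - s) * ⟪Q f, f⟫))) P := by
    intro s t hs hst f
    have := hW.law (τ + s) (τ + t) (by linarith) (by linarith) f
    rwa [add_sub_add_left_eq_sub] at this
  have hmem : ∀ s t, 0 ≤ s → s ≤ t →
      MemLp (fun ω => fourierCoeff (W (τ + t) ω) l m - fourierCoeff (W (τ + s) ω) l m) 2 P := by
    intro s t hs hst
    simp only [e]
    exact (memLp_of_hasLaw_gaussianReal (hlaw s t hs hst _)).ofReal.sub
      ((memLp_of_hasLaw_gaussianReal (hlaw s t hs hst _)).ofReal.mul_const _)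
  refine ⟨hA0, fun s t hs ht => ?_, fun s t hs hst => ?_⟩
  · rcases le_total s t with h | h
    · exact hmem s t hs h
    · have h1 := (hmem t s ht h).neg
      have h2 : -(fun ω => fourierCoeff (W (τ + s) ω) l m - fourierCoeff (W (τ + t) ω) l m) =
          fun ω => fourierCoeff (W (τ + t) ω) l m - fourierCoeff (W (τ + s) ω) l m := by
        funext ω; simp
      rwa [h2] at h1
  · have e2 : ∀ ω, ‖fourierCoeff (W (τ + t) ω) l m - fourierCoeff (W (τ + s) ω) l m‖ ^ 2 =
        ⟪W (τ + t) ω - W (τ + s) ω, reHarmonic l m⟫ ^ 2 +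
        ⟪W (τ + t) ω - W (τ + s) ω, imHarmonic l m⟫ ^ 2 := by
      intro ω
      rw [e, ← Complex.normSq_eq_norm_sq, Complex.normSq_apply]
      simp
      ring
    simp only [e2]
    rw [integral_add (memLp_of_hasLaw_gaussianReal (hlaw s t hs hst _)).integrable_sq
      (memLp_of_hasLaw_gaussianReal (hlaw s t hs hst _)).integrable_sq,
      integral_sq_of_hasLaw_gaussianReal (hlaw s t hs hst _),
      integral_sq_of_hasLaw_gaussianReal (hlaw s t hs hst _), hre, him, inner_smul_left,
      inner_smul_left, real_inner_self_eq_norm_sq, real_inner_self_eq_norm_sq]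
    have hts : 0 ≤ t - s := by linarith
    simp only [conj_trivial]
    rw [Real.coe_toNNReal _ (by positivity), Real.coe_toNNReal _ (by positivity)]
    linear_combination (A l * (t - s)) * norm_reHarmonic_sq_add l hm

theorem exists_norm_sphericalHarmonic_le (l : ℕ) (m : ℤ) :
    ∃ B : ℝ, 0 ≤ B ∧ ∀ x, ‖sphericalHarmonic l m x‖ ≤ B := by
  obtain ⟨B, hB⟩ := isCompact_univ.exists_bound_of_continuousOn
    (continuous_sphericalHarmonic l m).continuousOn
  exact ⟨max B 0, le_max_right _ _, fun x => (hB x trivial).trans (le_max_left _ _)⟩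

theorem measurable_sphericalHarmonic (l : ℕ) (m : ℤ) : Measurable (sphericalHarmonic l m) :=
  (continuous_sphericalHarmonic l m).measurable

/-- The coefficient is at most `sup |Y|` times the `L²` norm of the path, whose square is integrable
by Tonelli. -/
theorem memLp_fourierCoeff {ξ : Ω → S2 → ℝ} (hξm : Measurable (Function.uncurry ξ))
    (hξ : MemLp (Function.uncurry ξ) 2 (P.prod sphereMeasure)) (l : ℕ) (m : ℤ) :
    MemLp (fun ω => fourierCoeff (ξ ω) l m) 2 P := by
  obtain ⟨B, hB0, hB⟩ := exists_norm_sphericalHarmonic_le l m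
  have hmeas : StronglyMeasurable (fun ω => fourierCoeff (ξ ω) l m) := by
    have h1 : Measurable fun z : Ω × S2 => ((ξ z.1 z.2 : ℝ) : ℂ) * conj (sphericalHarmonic l m z.2) :=
      (Complex.measurable_ofReal.comp hξm).mul
        (Complex.continuous_conj.measurable.comp ((measurable_sphericalHarmonic l m).comp measurable_snd))
    exact h1.stronglyMeasurable.integral_prod_right
  refine ⟨hmeas.aestronglyMeasurable, ?_⟩
  have hb : ∀ ω, ‖fourierCoeff (ξ ω) l m‖ₑ ≤ ENNReal.ofReal B * eLpNorm (ξ ω) 2 sphereMeasure := by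
    intro ω
    have hm : AEStronglyMeasurable (ξ ω) sphereMeasure :=
      (hξm.comp measurable_prodMk_left).aestronglyMeasurable
    calc ‖fourierCoeff (ξ ω) l m‖ₑ
        ≤ ∫⁻ x, ‖(ξ ω x : ℂ) * conj (sphericalHarmonic l m x)‖ₑ ∂sphereMeasure :=
          enorm_integral_le_lintegral_enorm _
      _ ≤ ∫⁻ x, ENNReal.ofReal B * ‖ξ ω x‖ₑ ∂sphereMeasure := by
          apply lintegral_mono
          intro x
          simp only
          rw [enorm_mul, mul_comm]
          gcongr
          · rw [← ofReal_norm]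
            apply ENNReal.ofReal_le_ofReal
            rw [RCLike.norm_conj]
            exact hB x
          · rw [← ofReal_norm, ← ofReal_norm]
            simp
      _ = ENNReal.ofReal B * eLpNorm (ξ ω) 1 sphereMeasure := by
          rw [lintegral_const_mul' _ _ ENNReal.ofReal_ne_top, eLpNorm_one_eq_lintegral_enorm]
      _ ≤ _ := by
          gcongr
          exact eLpNorm_le_eLpNorm_of_exponent_le (by norm_num) hm
  have hsq : ∫⁻ ω, eLpNorm (ξ ω) 2 sphereMeasure ^ 2 ∂P < ⊤ := by
    have h1 := hξ.2
    rw [eLpNorm_lt_top_iff_lintegral_rpow_enorm_lt_top two_ne_zero ENNReal.ofNat_ne_top] at h1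
    rw [lintegral_prod _ (by fun_prop)] at h1
    refine lt_of_eq_of_lt (lintegral_congr fun ω => ?_) h1
    rw [eLpNorm_eq_lintegral_rpow_enorm_toReal two_ne_zero ENNReal.ofNat_ne_top]
    simp only [ENNReal.toReal_ofNat, Function.uncurry_apply_pair]
    rw [← ENNReal.rpow_natCast, ← ENNReal.rpow_mul]
    norm_num
  rw [eLpNorm_lt_top_iff_lintegral_rpow_enorm_lt_top two_ne_zero ENNReal.ofNat_ne_top]
  calc ∫⁻ ω, ‖fourierCoeff (ξ ω) l m‖ₑ ^ (2 : ℝ≥0∞).toReal ∂P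
      ≤ ∫⁻ ω, ENNReal.ofReal B ^ 2 * eLpNorm (ξ ω) 2 sphereMeasure ^ 2 ∂P := by
        apply lintegral_mono
        intro ω
        simp only [ENNReal.toReal_ofNat, ENNReal.rpow_ofNat]
        rw [← mul_pow]
        gcongr
        exact hb ω
    _ = ENNReal.ofReal B ^ 2 * ∫⁻ ω, eLpNorm (ξ ω) 2 sphereMeasure ^ 2 ∂P :=
        lintegral_const_mul' _ _ (by finiteness)
    _ < ⊤ := ENNReal.mul_lt_top (by finiteness) hsq

/-- The initial field is uncorrelated with the increments of the noise. -/
theorem integral_inner_fourierCoeff_increment [IsProbabilityMeasure P] {ξ : Ω → S2 → ℝ} (hξ : IsIsotropicGaussianField P ξ)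
    (hW : IsQWiener P Q τ W) (hA : IsNoiseSpectrum Q A)
    (hindep : IndepFun (fun ω (x : S2) => ξ ω x) (fun ω (t : Set.Ici τ) => W t ω) P)
    (l : ℕ) {m : ℤ} (hm : m ∈ Finset.Icc (-(l : ℤ)) l) {t : ℝ} (ht : 0 ≤ t) :
    ∫ ω, ⟪fourierCoeff (ξ ω) l m,
      fourierCoeff (W (τ + t) ω) l m - fourierCoeff (W (τ + 0) ω) l m⟫ ∂P = 0 := by
  set D : Ω → ℂ := fun ω => fourierCoeff (W (τ + t) ω) l m - fourierCoeff (W (τ + 0) ω) l m with hD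
  have hDm : MemLp D 2 P := (hW.hasBrownianIncrements hA l hm).memLp 0 t le_rfl ht
  have hDc : MemLp (fun ω => conj (D ω)) 2 P := by
    refine hDm.of_le (Complex.continuous_conj.comp_aestronglyMeasurable hDm.1) ?_
    filter_upwards with ω
    rw [RCLike.norm_conj]
  have hZ := memLp_fourierCoeff hξ.measurable hξ.memLp l m
  obtain ⟨B, hB0, hB⟩ := exists_norm_sphericalHarmonic_le l m
  -- For fixed `x` the expectation factors by independence and `ξ x` has mean zero; Fubini then
  -- integrates over the sphere.
  have hx : ∀ x : S2, ∫ ω, (ξ ω x : ℂ) * conj (D ω) ∂P = 0 := by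
    intro x
    set G : (Set.Ici τ → SphereL2) → ℂ := fun w =>
      conj (fourierCoeff (w ⟨τ + t, by simpa using ht⟩) l m - fourierCoeff (w ⟨τ + 0, by simp⟩) l m)
    have hG : Measurable G := by
      have hc := (continuous_fourierCoeff l m).measurable
      exact Complex.continuous_conj.measurable.comp
        ((hc.comp (measurable_pi_apply _)).sub (hc.comp (measurable_pi_apply _)))
    have hi := hindep.comp (φ := fun y : S2 → ℝ => ((y x : ℝ) : ℂ))
      (Complex.measurable_ofReal.comp (measurable_pi_apply x)) hG
    have hξx : Measurable fun ω => ξ ω x := hξ.measurable.comp measurable_prodMk_right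
    have h := hi.integral_fun_mul_eq_mul_integral
      (Complex.measurable_ofReal.comp hξx).aestronglyMeasurable hDc.1
    have h0 : ∫ ω, (ξ ω x : ℂ) ∂P = 0 := by
      rw [integral_complex_ofReal, hξ.centered x, Complex.ofReal_zero]
    refine h.trans ?_
    simp only [Function.comp_def]
    rw [h0, zero_mul]
  have hprod : Integrable (fun z : Ω × S2 => (ξ z.1 z.2 : ℂ) * conj (sphericalHarmonic l m z.2) *
      conj (D z.1)) (P.prod sphereMeasure) := by
    have h1 : MemLp (fun z : Ω × S2 => (ξ z.1 z.2 : ℂ)) 2 (P.prod sphereMeasure) := hξ.memLp.ofReal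
    have h2 : MemLp (fun z : Ω × S2 => conj (D z.1)) 2 (P.prod sphereMeasure) :=
      hDc.comp_fst sphereMeasure
    have h3 := (h1.integrable_mul h2).bdd_mul
      (f := fun z : Ω × S2 => conj (sphericalHarmonic l m z.2)) (c := B)
      ((Complex.continuous_conj.measurable.comp
        ((measurable_sphericalHarmonic l m).comp measurable_snd)).aestronglyMeasurable)
      (by filter_upwards with z; rw [RCLike.norm_conj]; exact hB _)
    refine h3.congr ?_
    filter_upwards with z
    simp only [Pi.mul_apply]
    ring
  have hc : ∫ ω, fourierCoeff (ξ ω) l m * conj (D ω) ∂P = 0 := by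
    simp only [fourierCoeff]
    simp_rw [← integral_mul_const]
    rw [integral_integral_swap hprod]
    have : ∀ x : S2, ∫ ω, (ξ ω x : ℂ) * conj (sphericalHarmonic l m x) * conj (D ω) ∂P = 0 := by
      intro x
      have e : ∀ ω, (ξ ω x : ℂ) * conj (sphericalHarmonic l m x) * conj (D ω) =
          conj (sphericalHarmonic l m x) * ((ξ ω x : ℂ) * conj (D ω)) := fun ω => by ring
      simp only [e]
      rw [integral_const_mul, hx, mul_zero]
    simp [this]
  have e : ∀ ω, ⟪fourierCoeff (ξ ω) l m, D ω⟫ = (fourierCoeff (ξ ω) l m * conj (D ω)).re := by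
    intro ω
    rw [Complex.inner]
    simp only [Complex.mul_re, Complex.conj_re, Complex.conj_im]
    ring
  simp only [hD] at e
  simp only [e]
  have := integral_re (hZ.integrable_mul hDc)
  simp only [RCLike.re_eq_complex_re, Pi.mul_apply] at this
  rw [this, hc, Complex.zero_re]

end Coefficients

/-! ### Random series of spherical harmonics -/

section RandomSeries

theorem norm_sum_sq_of_orthogonal {E ι : Type*} [NormedAddCommGroup E] [InnerProductSpace ℂ E]
    (s : Finset ι) (v : ι → E) (h : ∀ i ∈ s, ∀ j ∈ s, i ≠ j → inner ℂ (v i) (v j) = 0) :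
    ‖∑ i ∈ s, v i‖ ^ 2 = ∑ i ∈ s, ‖v i‖ ^ 2 := by
  have h1 : inner ℂ (∑ i ∈ s, v i) (∑ i ∈ s, v i) = ∑ i ∈ s, inner ℂ (v i) (v i) := by
    rw [sum_inner]
    apply Finset.sum_congr rfl
    intro i hi
    rw [inner_sum, Finset.sum_eq_single i (fun j hj hji => h i hi j hj hji.symm)
      (fun h => absurd hi h)]
  simp only [inner_self_eq_norm_sq_to_K] at h1
  exact_mod_cast h1

variable {Ω : Type*} [MeasurableSpace Ω] {P : Measure Ω}

theorem eLpNorm_two_eq {E : Type*} [NormedAddCommGroup E] [InnerProductSpace ℝ E] {f : Ω → E}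
    (hf : MemLp f 2 P) : eLpNorm f 2 P = ENNReal.ofReal (Real.sqrt (∫ ω, ‖f ω‖ ^ 2 ∂P)) := by
  rw [← norm_toLp_sq hf, Real.sqrt_sq (norm_nonneg _), Lp.norm_toLp,
    ENNReal.ofReal_toReal hf.eLpNorm_ne_top]

/-- The sum `∑_m d_{ℓ,m}(ω) Y_{ℓ,m}(x)`. -/
def randomLayer (d : ℕ → ℤ → Ω → ℂ) (l : ℕ) (z : Ω × S2) : ℂ :=
  ∑ m ∈ Finset.Icc (-(l : ℤ)) l, d l m z.1 * sphericalHarmonic l m z.2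

/-- The index set of the spherical harmonics with degree in `s`. -/
def harmonicIndex (s : Finset ℕ) : Finset (Σ _ : ℕ, ℤ) :=
  s.sigma fun l => Finset.Icc (-(l : ℤ)) l

theorem memLp_mul_harmonic {f : Ω → ℂ} (hf : MemLp f 2 P) (l : ℕ) (m : ℤ) :
    MemLp (fun z : Ω × S2 => f z.1 * sphericalHarmonic l m z.2) 2 (P.prod sphereMeasure) := by
  obtain ⟨B, hB0, hB⟩ := exists_norm_sphericalHarmonic_le l m
  have h := hf.comp_fst sphereMeasure
  refine h.of_le_mul (c := B) (h.1.mul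
    ((measurable_sphericalHarmonic l m).comp measurable_snd).aestronglyMeasurable) ?_
  filter_upwards with z
  rw [norm_mul, mul_comm]
  exact mul_le_mul_of_nonneg_right (hB _) (norm_nonneg _)

/-- The remainder is a finite block plus two errors tending to zero, so a uniform bound on blocks
suffices. -/
theorem IsL2Sum.eLpNorm_add_sub_le {f g : ℕ → Ω × S2 → ℂ} {F G : Ω × S2 → ℂ}
    (hf : IsL2Sum P f F) (hg : IsL2Sum P g G) (L : ℕ) {B : ℝ≥0∞}
    (hB : ∀ N, L + 1 ≤ N → eLpNorm (fun z => ∑ l ∈ Finset.Ico (L + 1) N, (f l z + g l z)) 2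
      (P.prod sphereMeasure) ≤ B) :
    eLpNorm (fun z => (F + G) z - ∑ l ∈ Finset.range (L + 1), (f l z + g l z)) 2
      (P.prod sphereMeasure) ≤ B := by
  obtain ⟨hf1, hF, hf2⟩ := hf
  obtain ⟨hg1, hG, hg2⟩ := hg
  have hlim : Tendsto (fun N => eLpNorm (fun z => F z - ∑ l ∈ Finset.range N, f l z) 2
      (P.prod sphereMeasure) + eLpNorm (fun z => G z - ∑ l ∈ Finset.range N, g l z) 2
      (P.prod sphereMeasure) + B) atTop (𝓝 B) := by
    simpa using (hf2.add hg2).add_const B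
  refine ge_of_tendsto hlim ?_
  filter_upwards [eventually_ge_atTop (L + 1)] with N hN
  have e : (fun z => (F + G) z - ∑ l ∈ Finset.range (L + 1), (f l z + g l z)) =
      ((fun z => F z - ∑ l ∈ Finset.range N, f l z) + fun z => G z - ∑ l ∈ Finset.range N, g l z) +
      fun z => ∑ l ∈ Finset.Ico (L + 1) N, (f l z + g l z) := by
    funext z
    simp only [Pi.add_apply]
    rw [Finset.sum_Ico_eq_sub _ hN, Finset.sum_add_distrib (s := Finset.range N)]
    ring
  have m1 : AEStronglyMeasurable (fun z => F z - ∑ l ∈ Finset.range N, f l z) (P.prod sphereMeasure) :=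
    (hF.sub (memLp_finsetSum _ fun l _ => hf1 l)).1
  have m2 : AEStronglyMeasurable (fun z => G z - ∑ l ∈ Finset.range N, g l z) (P.prod sphereMeasure) :=
    (hG.sub (memLp_finsetSum _ fun l _ => hg1 l)).1
  have m3 : AEStronglyMeasurable (fun z => ∑ l ∈ Finset.Ico (L + 1) N, (f l z + g l z))
      (P.prod sphereMeasure) := (memLp_finsetSum _ fun l _ => (hf1 l).add (hg1 l)).1
  rw [e]
  refine (eLpNorm_add_le (m1.add m2) m3 one_le_two).trans ?_
  exact add_le_add (eLpNorm_add_le m1 m2 one_le_two) (hB N hN)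

variable {d : ℕ → ℤ → Ω → ℂ}

theorem memLp_randomLayer
    (hd : ∀ l : ℕ, ∀ m ∈ Finset.Icc (-(l : ℤ)) l, MemLp (d l m) 2 P) (l : ℕ) :
    MemLp (randomLayer d l) 2 (P.prod sphereMeasure) :=
  memLp_finsetSum _ fun m hm => memLp_mul_harmonic (hd l m hm) l m

variable [IsProbabilityMeasure P]

/-- Parseval's identity for random combinations of spherical harmonics. -/
theorem integral_norm_sum_randomLayer_sq
    (hd : ∀ l : ℕ, ∀ m ∈ Finset.Icc (-(l : ℤ)) l, MemLp (d l m) 2 P) (s : Finset ℕ) :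
    ∫ z, ‖∑ l ∈ s, randomLayer d l z‖ ^ 2 ∂(P.prod sphereMeasure) =
      ∑ l ∈ s, ∑ m ∈ Finset.Icc (-(l : ℤ)) l, ∫ ω, ‖d l m ω‖ ^ 2 ∂P := by
  classical
  set e : (Σ _ : ℕ, ℤ) → Ω × S2 → ℂ := fun i z => d i.1 i.2 z.1 * sphericalHarmonic i.1 i.2 z.2
  have hmem : ∀ i ∈ harmonicIndex s, MemLp (e i) 2 (P.prod sphereMeasure) := fun i hi =>
    memLp_mul_harmonic (hd _ _ (Finset.mem_sigma.1 hi).2) i.1 i.2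
  -- The value `0` for terms outside `L²` only makes `v` total: every index in `harmonicIndex s`
  -- falls in the first case.
  set v : (Σ _ : ℕ, ℤ) → Lp ℂ 2 (P.prod sphereMeasure) := fun i =>
    if h : MemLp (e i) 2 (P.prod sphereMeasure) then h.toLp (e i) else 0 with hv
  have hvi : ∀ i ∈ harmonicIndex s, v i =ᵐ[P.prod sphereMeasure] e i := by
    intro i hi
    simp only [hv, dif_pos (hmem i hi)]
    exact (hmem i hi).coeFn_toLp
  have hinner : ∀ i ∈ harmonicIndex s, ∀ j ∈ harmonicIndex s, inner ℂ (v i) (v j) =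
      (∫ ω, d j.1 j.2 ω * conj (d i.1 i.2 ω) ∂P) * if i = j then 1 else 0 := by
    intro i hi j hj
    rw [L2.inner_def]
    have h1 := integral_harmonic (l' := i.1) (m' := i.2) (Finset.mem_sigma.1 hj).2
    have h2 : (if j.1 = i.1 ∧ j.2 = i.2 then (1 : ℂ) else 0) = if i = j then 1 else 0 := by
      have : (j.1 = i.1 ∧ j.2 = i.2) ↔ i = j := by
        obtain ⟨a, b⟩ := i
        obtain ⟨a', b'⟩ := j
        simp [eq_comm]
      simp only [this]
    -- The inner product factors into an `Ω` integral and a sphere integral, so spatial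
    -- orthonormality alone makes distinct terms orthogonal, even for correlated coefficients.
    rw [← h2, ← h1, ← integral_prod_mul]
    apply integral_congr_ae
    filter_upwards [hvi i hi, hvi j hj] with z hz1 hz2
    rw [hz1, hz2, RCLike.inner_apply]
    simp only [e, map_mul]
    ring
  have hsum : ∫ z, ‖∑ l ∈ s, randomLayer d l z‖ ^ 2 ∂(P.prod sphereMeasure) =
      ‖∑ i ∈ harmonicIndex s, v i‖ ^ 2 := by
    have hm : MemLp (fun z => ∑ i ∈ harmonicIndex s, e i z) 2 (P.prod sphereMeasure) :=
      memLp_finsetSum _ hmem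
    have h3 : ∑ i ∈ harmonicIndex s, v i = hm.toLp _ := by
      apply Lp.ext
      refine (Lp.coeFn_finsetSum _ _).trans (EventuallyEq.trans ?_ hm.coeFn_toLp.symm)
      have : ∀ᵐ z ∂(P.prod sphereMeasure), ∀ i ∈ harmonicIndex s, v i z = e i z :=
        (Finset.eventually_all _).2 hvi
      filter_upwards [this] with z hz
      rw [Finset.sum_apply]
      exact Finset.sum_congr rfl hz
    rw [h3, norm_toLp_sq]
    congr 1
    funext z
    congr 2
    simp only [harmonicIndex, Finset.sum_sigma]
    rfl
  rw [hsum, norm_sum_sq_of_orthogonal]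
  · simp only [harmonicIndex]
    rw [Finset.sum_sigma]
    apply Finset.sum_congr rfl
    intro l hl
    apply Finset.sum_congr rfl
    intro m hm
    have hi : (⟨l, m⟩ : Σ _ : ℕ, ℤ) ∈ harmonicIndex s := Finset.mem_sigma.2 ⟨hl, hm⟩
    have h4 := hinner _ hi _ hi
    rw [inner_self_eq_norm_sq_to_K, if_pos rfl, mul_one] at h4
    have h5 : ∀ ω, d l m ω * conj (d l m ω) = ((‖d l m ω‖ ^ 2 : ℝ) : ℂ) := by
      intro ω
      rw [Complex.mul_conj, Complex.normSq_eq_norm_sq]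
    simp only [h5] at h4
    rw [integral_complex_ofReal] at h4
    apply Complex.ofReal_injective
    rw [Complex.ofReal_pow]
    exact h4
  · intro i hi j hj hij
    rw [hinner i hi j hj, if_neg hij, mul_zero]

theorem eLpNorm_sum_randomLayer
    (hd : ∀ l : ℕ, ∀ m ∈ Finset.Icc (-(l : ℤ)) l, MemLp (d l m) 2 P) (s : Finset ℕ) :
    eLpNorm (fun z => ∑ l ∈ s, randomLayer d l z) 2 (P.prod sphereMeasure) = ENNReal.ofReal
      (Real.sqrt (∑ l ∈ s, ∑ m ∈ Finset.Icc (-(l : ℤ)) l, ∫ ω, ‖d l m ω‖ ^ 2 ∂P)) := by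
  have hm : MemLp (fun z => ∑ l ∈ s, randomLayer d l z) 2 (P.prod sphereMeasure) :=
    memLp_finsetSum _ fun l _ => memLp_randomLayer hd l
  rw [eLpNorm_two_eq hm, integral_norm_sum_randomLayer_sq hd]

/-- By Parseval, partial sums beyond `N` are within the square root of the tail of `b` from the
`N`-th one, hence Cauchy. -/
theorem exists_isL2Sum (hd : ∀ l : ℕ, ∀ m ∈ Finset.Icc (-(l : ℤ)) l, MemLp (d l m) 2 P) {b : ℕ → ℝ}
    (hb : Summable b)
    (hdb : ∀ l : ℕ, ∑ m ∈ Finset.Icc (-(l : ℤ)) l, ∫ ω, ‖d l m ω‖ ^ 2 ∂P ≤ b l) :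
    ∃ F, IsL2Sum P (randomLayer d) F := by
  have hm : ∀ n : ℕ, MemLp (fun z => ∑ l ∈ Finset.range n, randomLayer d l z) 2
      (P.prod sphereMeasure) := fun n => memLp_finsetSum _ fun l _ => memLp_randomLayer hd l
  have hb0 : ∀ l, 0 ≤ b l := fun l =>
    (Finset.sum_nonneg fun m _ => integral_nonneg fun ω => sq_nonneg _).trans (hdb l)
  have hle : ∀ N n : ℕ, N ≤ n → dist ((hm n).toLp _) ((hm N).toLp _) ≤
      Real.sqrt (∑' k, b (k + N)) := by
    intro N n hn
    rw [dist_eq_norm, ← MemLp.toLp_sub]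
    apply Real.le_sqrt_of_sq_le
    rw [norm_toLp_sq]
    have e : ∀ z, ((fun z => ∑ l ∈ Finset.range n, randomLayer d l z) -
        fun z => ∑ l ∈ Finset.range N, randomLayer d l z) z =
        ∑ l ∈ Finset.Ico N n, randomLayer d l z := fun z => by
      rw [Finset.sum_Ico_eq_sub _ hn]; rfl
    simp only [e]
    rw [integral_norm_sum_randomLayer_sq hd]
    refine (Finset.sum_le_sum fun l _ => hdb l).trans ?_
    rw [Finset.sum_Ico_eq_sum_range]
    simp only [add_comm N]
    exact ((summable_nat_add_iff N).2 hb).sum_le_tsum _ fun i _ => hb0 _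
  have hlim : Tendsto (fun N : ℕ => Real.sqrt (∑' k, b (k + N)) * 2) atTop (𝓝 0) := by
    have h1 := (Real.continuous_sqrt.tendsto 0).comp (tendsto_sum_nat_add b)
    simpa using h1.mul_const 2
  have hc : CauchySeq fun n => (hm n).toLp _ := by
    refine cauchySeq_of_le_tendsto_0 (fun N : ℕ => Real.sqrt (∑' k, b (k + N)) * 2)
      (fun n m N hn hm' => ?_) hlim
    have h1 := dist_triangle_right ((hm n).toLp _) ((hm m).toLp _) ((hm N).toLp _)
    have h2 := hle N n hn
    have h3 := hle N m hm'
    linarith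
  obtain ⟨F, hF⟩ := cauchySeq_tendsto_of_complete hc
  refine ⟨F, fun l => memLp_randomLayer hd l, Lp.memLp F, ?_⟩
  have h := (Lp.tendsto_Lp_iff_tendsto_eLpNorm'' _ hm F (Lp.memLp F)).1 (by rwa [Lp.toLp_coeFn])
  refine h.congr fun n => ?_
  rw [eLpNorm_sub_comm]
  rfl

end RandomSeries

/-! ### Tail sums and variances of the coefficients -/

section Bounds

theorem hasDerivAt_tailPrimitive {κ x : ℝ} (hκ : 2 < κ) (hx : 0 < x) :
    HasDerivAt (fun x : ℝ => -(2 / (κ - 2) * x ^ (2 - κ) + 1 / (κ - 1) * x ^ (1 - κ)))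
      (2 * x ^ (1 - κ) + x ^ (-κ)) x := by
  have h1 := ((Real.hasDerivAt_rpow_const (p := 2 - κ) (Or.inl hx.ne')).const_mul (2 / (κ - 2))).add
    ((Real.hasDerivAt_rpow_const (p := 1 - κ) (Or.inl hx.ne')).const_mul (1 / (κ - 1)))
  refine h1.neg.congr_deriv ?_
  have e1 : κ - 2 ≠ 0 := by linarith
  have e2 : κ - 1 ≠ 0 := by linarith
  rw [show 2 - κ - 1 = 1 - κ by ring, show 1 - κ - 1 = -κ by ring]
  field_simp
  ring

theorem antitoneOn_tail {κ a : ℝ} (hκ : 2 < κ) (b : ℝ) (ha : 0 < a) :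
    AntitoneOn (fun x : ℝ => 2 * x ^ (1 - κ) + x ^ (-κ)) (Set.Icc a b) := by
  intro x hx y hy hxy
  have hx0 := ha.trans_le hx.1
  have h1 := Real.rpow_le_rpow_of_nonpos hx0 hxy (show 1 - κ ≤ 0 by linarith)
  have h2 := Real.rpow_le_rpow_of_nonpos hx0 hxy (show -κ ≤ 0 by linarith)
  simp only
  linarith

/-- Comparison with the integral of the decreasing function `(2x + 1) x^{-κ}` from `L`, whose
primitive yields both fractions; `L^{1-κ} ≤ L^{2-κ}` merges the two powers. -/
theorem sum_tail_le {κ : ℝ} (hκ : 2 < κ) {L N : ℕ} (hL : 1 ≤ L) :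
    ∑ l ∈ Finset.Ico (L + 1) N, (2 * (l : ℝ) + 1) * (l : ℝ) ^ (-κ) ≤
      (2 / (κ - 2) + 1 / (κ - 1)) * (L : ℝ) ^ (2 - κ) := by
  have hL0 : (0 : ℝ) < L := by exact_mod_cast hL
  have h2 : 0 < κ - 2 := by linarith
  have h1 : 0 < κ - 1 := by linarith
  rcases le_or_gt N (L + 1) with hN | hN
  · rw [Finset.Ico_eq_empty_of_le hN, Finset.sum_empty]
    positivity
  obtain ⟨M, rfl⟩ : ∃ M, N = M + 1 := ⟨N - 1, by omega⟩
  have hLM : L ≤ M := by omega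
  have hLM' : (L : ℝ) ≤ M := by exact_mod_cast hLM
  rw [← Finset.sum_Ico_add' (fun l : ℕ => (2 * (l : ℝ) + 1) * (l : ℝ) ^ (-κ)) L M 1]
  have e : ∀ l : ℕ, (2 * ((l + 1 : ℕ) : ℝ) + 1) * ((l + 1 : ℕ) : ℝ) ^ (-κ) =
      2 * ((l + 1 : ℕ) : ℝ) ^ (1 - κ) + ((l + 1 : ℕ) : ℝ) ^ (-κ) := by
    intro l
    have : (0 : ℝ) < ((l + 1 : ℕ) : ℝ) := by positivity
    rw [sub_eq_add_neg, Real.rpow_add this, Real.rpow_one]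
    ring
  simp only [e]
  refine (AntitoneOn.sum_le_integral_Ico hLM (antitoneOn_tail hκ M hL0)).trans ?_
  have hpos : ∀ x ∈ Set.uIcc (L : ℝ) M, 0 < x := fun x hx => by
    rw [Set.uIcc_of_le hLM'] at hx
    exact hL0.trans_le hx.1
  rw [intervalIntegral.integral_eq_sub_of_hasDerivAt
    (fun x hx => hasDerivAt_tailPrimitive hκ (hpos x hx))]
  · have hM0 : (0 : ℝ) < M := hL0.trans_le hLM'
    have p1 : 0 ≤ 2 / (κ - 2) * (M : ℝ) ^ (2 - κ) + 1 / (κ - 1) * (M : ℝ) ^ (1 - κ) := by positivity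
    have p2 : (L : ℝ) ^ (1 - κ) ≤ (L : ℝ) ^ (2 - κ) :=
      Real.rpow_le_rpow_of_exponent_le (by exact_mod_cast hL) (by linarith)
    have p3 := mul_le_mul_of_nonneg_left p2 (one_div_pos.2 h1).le
    linarith
  · apply ContinuousOn.intervalIntegrable
    have hne : ∀ x ∈ Set.uIcc (L : ℝ) M, x ≠ 0 := fun x hx => (hpos x hx).ne'
    exact (continuousOn_const.mul (continuousOn_id.rpow_const fun x hx => Or.inl (hne x hx))).add
      (continuousOn_id.rpow_const fun x hx => Or.inl (hne x hx))

theorem decayConst_sq {c κ : ℝ} (hc : 0 < c) (hκ : 2 < κ) :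
    decayConst c κ ^ 2 = c * (2 / (κ - 2) + 1 / (κ - 1)) := by
  have h2 : 0 < κ - 2 := by linarith
  have h1 : 0 < κ - 1 := by linarith
  rw [decayConst, Real.sq_sqrt (by positivity)]

theorem sum_decay_le {a : ℕ → ℝ} {D c κ : ℝ} (ha : AlgebraicDecay a D c κ) (hc : 0 < c) (hκ : 2 < κ)
    {L : ℕ} (hL : 1 ≤ L) (N : ℕ) :
    ∑ l ∈ Finset.Ico (L + 1) N, (2 * (l : ℝ) + 1) * a l ≤ decayConst c κ ^ 2 * (L : ℝ) ^ (2 - κ) := by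
  have h := mul_le_mul_of_nonneg_left (sum_tail_le hκ (N := N) hL) hc.le
  rw [decayConst_sq hc hκ, mul_assoc]
  refine le_trans ?_ h
  rw [Finset.mul_sum]
  apply Finset.sum_le_sum
  intro l hl
  have h1 := ha.2 l (by have := (Finset.mem_Ico.1 hl).1; omega)
  calc (2 * (l : ℝ) + 1) * a l ≤ (2 * (l : ℝ) + 1) * (c * (l : ℝ) ^ (-κ)) := by gcongr
    _ = _ := by ring

theorem summable_decay {a : ℕ → ℝ} {D c κ : ℝ} (ha : AlgebraicDecay a D c κ) (ha0 : ∀ l, 0 ≤ a l)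
    (hκ : 2 < κ) : Summable fun l : ℕ => (2 * (l : ℝ) + 1) * a l := by
  have hs : Summable fun l : ℕ => (3 * c) * (l : ℝ) ^ (1 - κ) :=
    (Real.summable_nat_rpow.2 (by linarith)).mul_left _
  rw [← summable_nat_add_iff 1] at hs ⊢
  refine hs.of_nonneg_of_le (fun l => mul_nonneg (by positivity) (ha0 _)) fun l => ?_
  have hp : (0 : ℝ) < ((l + 1 : ℕ) : ℝ) := by positivity
  have h1 : (1 : ℝ) ≤ ((l + 1 : ℕ) : ℝ) := by push_cast; linarith [Nat.cast_nonneg (α := ℝ) l]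
  calc (2 * ((l + 1 : ℕ) : ℝ) + 1) * a (l + 1)
      ≤ (3 * ((l + 1 : ℕ) : ℝ)) * (c * ((l + 1 : ℕ) : ℝ) ^ (-κ)) := by
        apply mul_le_mul (by linarith) (ha.2 (l + 1) (by omega)) (ha0 _) (by positivity)
    _ = _ := by
        rw [sub_eq_add_neg, Real.rpow_add hp, Real.rpow_one]
        ring

/-- The variance `∫_0^T E_α(-λ_ℓ u^α)² du`. -/
def relaxVar (α : ℝ) (l : ℕ) (T : ℝ) : ℝ := ∫ u in (0 : ℝ)..T, relaxation α l u ^ 2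

variable {α : ℝ}

/-! ### Estimates of the relaxation functions and of their variance integrals. -/

theorem continuous_relaxation_sq (hα0 : 0 < α) (hα1 : α ≤ 1) (l : ℕ) :
    Continuous fun u => relaxation α l u ^ 2 := (continuous_relaxation hα0 hα1 l).pow 2

theorem relaxVar_nonneg (l : ℕ) {T : ℝ} (hT : 0 ≤ T) : 0 ≤ relaxVar α l T :=
  intervalIntegral.integral_nonneg hT fun _ _ => sq_nonneg _

theorem relaxation_sq_le_one (hα0 : 0 < α) (hα1 : α ≤ 1) (l : ℕ) {t : ℝ} (ht : 0 ≤ t) :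
    relaxation α l t ^ 2 ≤ 1 :=
  pow_le_one₀ (relaxation_nonneg hα0 hα1 l ht) (relaxation_le_one hα0 hα1 l ht)

theorem relaxVar_le (hα0 : 0 < α) (hα1 : α ≤ 1) (l : ℕ) {T : ℝ} (hT : 0 ≤ T) :
    relaxVar α l T ≤ T := by
  have h := intervalIntegral.integral_mono_on hT
    ((continuous_relaxation_sq hα0 hα1 l).intervalIntegrable 0 T)
    (continuous_const.intervalIntegrable (μ := volume) 0 T)
    (fun u hu => relaxation_sq_le_one hα0 hα1 l hu.1)
  simpa [relaxVar] using h

theorem eigenvalue_pos {l : ℕ} (hl : 1 ≤ l) : 0 < eigenvalue l := by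
  have : (0 : ℝ) < l := by exact_mod_cast hl
  unfold eigenvalue; positivity

theorem sq_le_eigenvalue (l : ℕ) : (l : ℝ) ^ 2 ≤ eigenvalue l := by
  have : (0 : ℝ) ≤ l := Nat.cast_nonneg l
  unfold eigenvalue; nlinarith

theorem eigenvalue_mono {l l' : ℕ} (h : l ≤ l') : eigenvalue l ≤ eigenvalue l' := by
  have : (l : ℝ) ≤ l' := by exact_mod_cast h
  unfold eigenvalue; gcongr

theorem sq_le_eigenvalue_of_le {L l : ℕ} (h : L ≤ l) : (L : ℝ) ^ 2 ≤ eigenvalue l :=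
  (sq_le_eigenvalue L).trans (eigenvalue_mono h)

/-- Negative powers of eigenvalues. -/
theorem eigenvalue_rpow_neg_le {L l : ℕ} (hL : 1 ≤ L) (h : L ≤ l) {r : ℝ} (hr : 0 ≤ r) :
    eigenvalue l ^ (-r) ≤ (L : ℝ) ^ (-(2 * r)) := by
  have hL0 : (0 : ℝ) < L := by exact_mod_cast hL
  have h1 := Real.rpow_le_rpow_of_nonpos (by positivity) (sq_le_eigenvalue_of_le h)
    (show -r ≤ 0 by linarith)
  rw [← Real.rpow_natCast, ← Real.rpow_mul hL0.le] at h1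
  refine h1.trans (le_of_eq ?_)
  congr 1
  push_cast; ring

theorem relaxation_sq_le (hα0 : 0 < α) (hα1 : α ≤ 1) {l : ℕ} (hl : 1 ≤ l) {t : ℝ} (ht : 0 < t) :
    relaxation α l t ^ 2 ≤ Real.Gamma (1 + α) ^ 2 * eigenvalue l ^ (-2 : ℝ) * t ^ (-(2 * α)) := by
  have hl0 := eigenvalue_pos hl
  have h := relaxation_mul_le hα0 hα1 hl ht
  have htα := Real.rpow_pos_of_pos ht α
  have h1 : relaxation α l t ≤ Real.Gamma (1 + α) / (eigenvalue l * t ^ α) := by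
    rw [le_div_iff₀ (by positivity)]; exact h
  have h2 := pow_le_pow_left₀ (relaxation_nonneg hα0 hα1 l ht.le) h1 2
  refine h2.trans (le_of_eq ?_)
  rw [Real.rpow_neg hl0.le, Real.rpow_neg ht.le, mul_comm 2 α, Real.rpow_mul ht.le]
  norm_cast
  field_simp

theorem relaxation_sq_le_psiH (hα0 : 0 < α) (hα1 : α ≤ 1) {L l : ℕ} (hL : 1 ≤ L) (h : L ≤ l) {t : ℝ}
    (ht : 0 < t) : relaxation α l t ^ 2 ≤ psiH α t ^ 2 * (L : ℝ) ^ (-4 : ℝ) := by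
  have h1 := relaxation_sq_le hα0 hα1 (hL.trans h) ht
  have h2 := eigenvalue_rpow_neg_le hL h (r := 2) (by norm_num)
  have e : psiH α t ^ 2 = Real.Gamma (1 + α) ^ 2 * t ^ (-(2 * α)) := by
    rw [psiH, mul_pow, ← Real.rpow_natCast (t ^ (-α)), ← Real.rpow_mul ht.le]
    congr 2
    push_cast; ring
  rw [e]
  rw [show (2 * 2 : ℝ) = 4 by norm_num] at h2
  calc _ ≤ _ := h1
    _ ≤ Real.Gamma (1 + α) ^ 2 * (L : ℝ) ^ (-4 : ℝ) * t ^ (-(2 * α)) := by gcongr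
    _ = _ := by ring

/-- Up to time `a` the bound `E_α ≤ 1` is used, after it the algebraic decay. -/
theorem relaxVar_le_add (hα0 : 0 < α) (hα1 : α ≤ 1) {l : ℕ} (hl : 1 ≤ l) {a T : ℝ} (ha : 0 < a)
    (haT : a ≤ T) : relaxVar α l T ≤
      a + Real.Gamma (1 + α) ^ 2 * eigenvalue l ^ (-2 : ℝ) * ∫ u in a..T, u ^ (-(2 * α)) := by
  have hc := continuous_relaxation_sq hα0 hα1 l
  rw [relaxVar, ← intervalIntegral.integral_add_adjacent_intervals (hc.intervalIntegrable 0 a)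
    (hc.intervalIntegrable a T)]
  apply add_le_add (relaxVar_le hα0 hα1 l ha.le)
  rw [← intervalIntegral.integral_const_mul]
  apply intervalIntegral.integral_mono_on haT (hc.intervalIntegrable a T)
  · apply ContinuousOn.intervalIntegrable
    rw [Set.uIcc_of_le haT]
    exact continuousOn_const.mul
      (continuousOn_id.rpow_const fun x hx => Or.inl (ha.trans_le hx.1).ne')
  · intro u hu
    exact relaxation_sq_le hα0 hα1 hl (ha.trans_le hu.1)

theorem constM_nonneg (α : ℝ) : 0 ≤ constM α := by
  unfold constM; split_ifs <;> positivity

/-- The integral is split at `a = λ_l^{-1/α}`, which lies below `T` because `λ_l ≥ λ_L`. The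
exponent `gammaExp α κ - κ + 2` does not depend on `κ`: it is `4`, `2` or `2/α` for `α` below, at or
above `1/2`. -/
theorem relaxVar_le_psiI (hα0 : 0 < α) (hα1 : α ≤ 1) {L l : ℕ} (hL : 1 ≤ L) (h : L ≤ l) {T : ℝ}
    (hT : eigenvalue L ^ (-(1 / α)) < T) (κ : ℝ) :
    relaxVar α l T ≤ psiI α T ^ 2 * (L : ℝ) ^ (-(gammaExp α κ - κ + 2)) := by
  have hl := hL.trans h
  have hl0 := eigenvalue_pos hl
  have hL1 : (1 : ℝ) ≤ L := by exact_mod_cast hL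
  have hlam1 : 1 ≤ eigenvalue l := by
    have := sq_le_eigenvalue_of_le h
    nlinarith
  set a := eigenvalue l ^ (-(1 / α)) with ha
  have ha0 : 0 < a := Real.rpow_pos_of_pos hl0 _
  have haT : a < T := lt_of_le_of_lt (Real.rpow_le_rpow_of_nonpos (eigenvalue_pos hL)
    (eigenvalue_mono h) (by simp [hα0.le])) hT
  have hT0 : 0 < T := ha0.trans haT
  have hmain := relaxVar_le_add hα0 hα1 hl ha0 haT.le
  have hM := constM_nonneg α
  have hl2 : 0 < eigenvalue l ^ (-2 : ℝ) := Real.rpow_pos_of_pos hl0 _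
  have h0 : (0 : ℝ) ∉ Set.uIcc a T := by
    rw [Set.uIcc_of_le haT.le]
    intro hx
    linarith [hx.1]
  rcases eq_or_ne α (1 / 2) with hα | hα
  · have hG : Real.Gamma (1 + α) ^ 2 = constM (1 / 2) := by
      rw [constM, if_pos rfl, hα]; norm_num
    have hI : ∫ u in a..T, u ^ (-(2 * α)) = Real.log T + 2 * Real.log (eigenvalue l) := by
      have e1 : -(2 * α) = -1 := by rw [hα]; norm_num
      simp only [e1, Real.rpow_neg_one]
      rw [integral_inv_of_pos ha0 hT0, Real.log_div hT0.ne' ha0.ne', ha, Real.log_rpow hl0, hα]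
      norm_num
    have e2 : a = eigenvalue l ^ (-2 : ℝ) := by rw [ha, hα]; norm_num
    have e3 : eigenvalue l ^ (-2 : ℝ) * eigenvalue l = eigenvalue l ^ (-1 : ℝ) := by
      nth_rewrite 2 [← Real.rpow_one (eigenvalue l)]
      rw [← Real.rpow_add hl0]; norm_num
    have e4 : eigenvalue l ^ (-2 : ℝ) ≤ eigenvalue l ^ (-1 : ℝ) :=
      Real.rpow_le_rpow_of_exponent_le hlam1 (by norm_num)
    -- The logarithm is absorbed into one power of `λ_l`; this loss is why the critical exponent is
    -- `2` instead of `4`.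
    have hlog : Real.log (eigenvalue l) ≤ eigenvalue l := by
      linarith [Real.log_le_sub_one_of_pos hl0]
    have hg : gammaExp α κ - κ + 2 = 2 := by
      rw [gammaExp, if_neg (by rw [hα]; norm_num), if_pos hα]; ring
    have hlam : eigenvalue l ^ (-1 : ℝ) ≤ (L : ℝ) ^ (-2 : ℝ) := by
      have := eigenvalue_rpow_neg_le hL h (r := 1) (by norm_num)
      rwa [mul_one] at this
    have hM' := constM_nonneg (1 / 2)
    rw [hG, hI, e2] at hmain
    have key : eigenvalue l ^ (-2 : ℝ) * (2 * Real.log (eigenvalue l)) ≤ 2 * eigenvalue l ^ (-1 : ℝ) := by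
      rw [← e3]; nlinarith
    have hpsi : psiI α T = constK T := by
      rw [psiI, if_neg (by rw [hα]; norm_num), if_pos hα]
    rw [hg, hpsi, constK]
    split_ifs with hT1
    · have hlT : 0 ≤ Real.log T := Real.log_nonneg hT1.le
      rw [Real.sq_sqrt (by positivity)]
      calc relaxVar α l T ≤ _ := hmain
        _ = eigenvalue l ^ (-2 : ℝ) * (1 + constM (1 / 2) * Real.log T) +
            constM (1 / 2) * (eigenvalue l ^ (-2 : ℝ) * (2 * Real.log (eigenvalue l))) := by ring
        _ ≤ eigenvalue l ^ (-1 : ℝ) * (1 + constM (1 / 2) * Real.log T) +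
            constM (1 / 2) * (2 * eigenvalue l ^ (-1 : ℝ)) := by gcongr
        _ = (1 + constM (1 / 2) * (2 + Real.log T)) * eigenvalue l ^ (-1 : ℝ) := by ring
        _ ≤ _ := by gcongr
    · have hlT : Real.log T ≤ 0 := Real.log_nonpos hT0.le (not_lt.1 hT1)
      rw [Real.sq_sqrt (by positivity)]
      calc relaxVar α l T ≤ _ := hmain
        _ = eigenvalue l ^ (-2 : ℝ) + constM (1 / 2) * eigenvalue l ^ (-2 : ℝ) * Real.log T +
            constM (1 / 2) * (eigenvalue l ^ (-2 : ℝ) * (2 * Real.log (eigenvalue l))) := by ring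
        _ ≤ eigenvalue l ^ (-1 : ℝ) + 0 + constM (1 / 2) * (2 * eigenvalue l ^ (-1 : ℝ)) := by
            gcongr
            exact mul_nonpos_of_nonneg_of_nonpos (by positivity) hlT
        _ = (1 + 2 * constM (1 / 2)) * eigenvalue l ^ (-1 : ℝ) := by ring
        _ ≤ _ := by gcongr
  · have hne : 1 - 2 * α ≠ 0 := fun h => hα (by linarith)
    have hMe : constM α = Real.Gamma (1 + α) ^ 2 * |2 * α - 1|⁻¹ := by rw [constM, if_neg hα]
    have hI : ∫ u in a..T, u ^ (-(2 * α)) = (T ^ (1 - 2 * α) - a ^ (1 - 2 * α)) / (1 - 2 * α) := by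
      rw [integral_rpow (Or.inr ⟨fun h => hne (by linarith), h0⟩)]
      rw [show -(2 * α) + 1 = 1 - 2 * α by ring]
    have hTp := Real.rpow_pos_of_pos hT0 (1 - 2 * α)
    have hap := Real.rpow_pos_of_pos ha0 (1 - 2 * α)
    rcases lt_or_gt_of_ne hα with hlt | hgt
    · have hpos : 0 < 1 - 2 * α := by linarith
      have habs : |2 * α - 1| = 1 - 2 * α := by rw [abs_of_neg (by linarith)]; ring
      have hg : gammaExp α κ - κ + 2 = 4 := by rw [gammaExp, if_pos hlt]; ring
      have hlam : eigenvalue l ^ (-2 : ℝ) ≤ (L : ℝ) ^ (-4 : ℝ) := by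
        have := eigenvalue_rpow_neg_le hL h (r := 2) (by norm_num)
        rwa [show (2 * 2 : ℝ) = 4 by norm_num] at this
      have ha2 : a ≤ eigenvalue l ^ (-2 : ℝ) := by
        apply Real.rpow_le_rpow_of_exponent_le hlam1
        have : 2 ≤ 1 / α := by rw [le_div_iff₀ hα0]; linarith
        linarith
      rw [hg, psiI, if_pos hlt, Real.sq_sqrt (by positivity)]
      -- For `α < 1/2` the upper end dominates and the term at `a` is dropped.
      have hI' : ∫ u in a..T, u ^ (-(2 * α)) ≤ |2 * α - 1|⁻¹ * T ^ (1 - 2 * α) := by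
        rw [hI, habs, div_eq_inv_mul]
        gcongr
        linarith
      calc relaxVar α l T ≤ _ := hmain
        _ ≤ eigenvalue l ^ (-2 : ℝ) + Real.Gamma (1 + α) ^ 2 * eigenvalue l ^ (-2 : ℝ) *
            (|2 * α - 1|⁻¹ * T ^ (1 - 2 * α)) := by gcongr
        _ = (1 + constM α * T ^ (1 - 2 * α)) * eigenvalue l ^ (-2 : ℝ) := by rw [hMe]; ring
        _ ≤ _ := by gcongr
    · have hpos : 0 < 2 * α - 1 := by linarith
      have habs : |2 * α - 1| = 2 * α - 1 := abs_of_pos hpos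
      have hg : gammaExp α κ - κ + 2 = 2 * (1 / α) := by
        rw [gammaExp, if_neg (by linarith), if_neg hα]; ring
      have hlam : a ≤ (L : ℝ) ^ (-(2 * (1 / α))) :=
        eigenvalue_rpow_neg_le hL h (r := 1 / α) (by positivity)
      have hla : eigenvalue l ^ (-2 : ℝ) * a ^ (1 - 2 * α) = a := by
        rw [ha, ← Real.rpow_mul hl0.le, ← Real.rpow_add hl0]
        congr 1
        field_simp
        ring
      rw [hg, psiI, if_neg (by linarith), if_neg hα, Real.sq_sqrt (by positivity)]
      -- For `α > 1/2` the lower end dominates; by `hla` its contribution has the size of `a`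
      -- itself, so the bound is uniform in `T`.
      have hI' : ∫ u in a..T, u ^ (-(2 * α)) ≤ |2 * α - 1|⁻¹ * a ^ (1 - 2 * α) := by
        have : (T ^ (1 - 2 * α) - a ^ (1 - 2 * α)) / (1 - 2 * α) =
            (2 * α - 1)⁻¹ * (a ^ (1 - 2 * α) - T ^ (1 - 2 * α)) := by
          field_simp
          ring
        rw [hI, habs, this]
        gcongr
        linarith
      calc relaxVar α l T ≤ _ := hmain
        _ ≤ a + Real.Gamma (1 + α) ^ 2 * eigenvalue l ^ (-2 : ℝ) *
            (|2 * α - 1|⁻¹ * a ^ (1 - 2 * α)) := by gcongr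
        _ = a + constM α * (eigenvalue l ^ (-2 : ℝ) * a ^ (1 - 2 * α)) := by rw [hMe]; ring
        _ = (1 + constM α) * a := by rw [hla]; ring
        _ ≤ _ := by gcongr

end Bounds

/-! ### The truncation error -/

section Main

variable {Ω : Type*} [MeasurableSpace Ω] {P : Measure Ω} {α τ : ℝ} {ξ : Ω → S2 → ℝ}
  {C A : ℕ → ℝ} {Q : SphereL2 →L[ℝ] SphereL2} {W : ℝ → Ω → SphereL2}

theorem coeffI_isWienerIntegral (hα0 : 0 < α) (hα1 : α ≤ 1) (hW : IsQWiener P Q τ W)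
    (hA : IsNoiseSpectrum Q A) (l : ℕ) {m : ℤ} (hm : m ∈ Finset.Icc (-(l : ℤ)) l) {t : ℝ}
    (ht : τ < t) : IsWienerIntegral P (fun s ω => fourierCoeff (W (τ + s) ω) l m)
      (fun s => relaxation α l (t - τ - s)) 0 (t - τ) (coeffI P α τ W l m t) := by
  have hg : Continuous fun s => relaxation α l (t - τ - s) :=
    (continuous_relaxation hα0 hα1 l).comp (by fun_prop)
  have h := exists_isWienerIntegral (hW.hasBrownianIncrements hA l hm) (sub_pos.2 ht)
    hg.continuousOn
  rw [coeffI, wienerIntegral, dif_pos h]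
  exact h.choose_spec

theorem integral_norm_coeffI_sq (hα0 : 0 < α) (hα1 : α ≤ 1) (hW : IsQWiener P Q τ W)
    (hA : IsNoiseSpectrum Q A) (l : ℕ) {m : ℤ} (hm : m ∈ Finset.Icc (-(l : ℤ)) l) {t : ℝ}
    (ht : τ < t) : ∫ ω, ‖coeffI P α τ W l m t ω‖ ^ 2 ∂P = A l * relaxVar α l (t - τ) := by
  have hg : Continuous fun s => relaxation α l (t - τ - s) :=
    (continuous_relaxation hα0 hα1 l).comp (by fun_prop)
  rw [(coeffI_isWienerIntegral hα0 hα1 hW hA l hm ht).integral_norm_sq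
    (hW.hasBrownianIncrements hA l hm) (sub_pos.2 ht) hg.continuousOn, relaxVar]
  congr 1
  have := intervalIntegral.integral_comp_sub_left (fun u => relaxation α l u ^ 2) (a := 0)
    (b := t - τ) (t - τ)
  simpa using this

/-- The coefficients of the layers `U^H_ℓ(t)`. -/
def homCoeff (α : ℝ) (ξ : Ω → S2 → ℝ) (t : ℝ) (l : ℕ) (m : ℤ) (ω : Ω) : ℂ :=
  (relaxation α l t : ℂ) * fourierCoeff (ξ ω) l m

/-- The coefficients of the layers `U^I_ℓ(t)`. -/
def inhomCoeff (P : Measure Ω) (α τ : ℝ) (W : ℝ → Ω → SphereL2) (t : ℝ) (l : ℕ) (m : ℤ) (ω : Ω) : ℂ :=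
  if t ≤ τ then 0 else coeffI P α τ W l m t ω

theorem layerI_eq (t : ℝ) (l : ℕ) : layerI P α τ W l t = randomLayer (inhomCoeff P α τ W t) l := by
  funext z
  simp only [layerI, randomLayer, inhomCoeff]
  split_ifs <;> simp

/-- The factor `∫_0^{t-τ} E_α(-λ_ℓ u^α)² du` of the variance of `U^I_ℓ(t)`; it vanishes for `t ≤ τ`. -/
def noiseVar (α τ t : ℝ) (l : ℕ) : ℝ := if t ≤ τ then 0 else relaxVar α l (t - τ)

section Coefficients

variable (hα0 : 0 < α) (hα1 : α ≤ 1) (hW : IsQWiener P Q τ W) (hA : IsNoiseSpectrum Q A)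
  (hξ : IsIsotropicGaussianField P ξ) (hC : IsAngularPowerSpectrum P ξ C)

include hα0 hα1 hW hA in
theorem memLp_inhomCoeff (t : ℝ) (l : ℕ) (m : ℤ) (hm : m ∈ Finset.Icc (-(l : ℤ)) l) :
    MemLp (inhomCoeff P α τ W t l m) 2 P := by
  by_cases h : t ≤ τ
  · have : inhomCoeff P α τ W t l m = 0 := by funext ω; simp [inhomCoeff, h]
    rw [this]
    exact MemLp.zero
  · have : inhomCoeff P α τ W t l m = coeffI P α τ W l m t := by funext ω; simp [inhomCoeff, h]
    rw [this]
    exact (coeffI_isWienerIntegral hα0 hα1 hW hA l hm (not_le.1 h)).1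

include hα0 hα1 hW hA in
theorem integral_norm_inhomCoeff_sq (t : ℝ) (l : ℕ) (m : ℤ) (hm : m ∈ Finset.Icc (-(l : ℤ)) l) :
    ∫ ω, ‖inhomCoeff P α τ W t l m ω‖ ^ 2 ∂P = A l * noiseVar α τ t l := by
  by_cases h : t ≤ τ
  · simp [inhomCoeff, noiseVar, h]
  · simp only [inhomCoeff, noiseVar, if_neg h]
    exact integral_norm_coeffI_sq hα0 hα1 hW hA l hm (not_le.1 h)

include hξ in
theorem memLp_homCoeff (t : ℝ) (l : ℕ) (m : ℤ) : MemLp (homCoeff α ξ t l m) 2 P :=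
  (memLp_fourierCoeff hξ.measurable hξ.memLp l m).const_mul _

include hC in
theorem integral_norm_homCoeff_sq (t : ℝ) (l : ℕ) (m : ℤ) (hm : m ∈ Finset.Icc (-(l : ℤ)) l) :
    ∫ ω, ‖homCoeff α ξ t l m ω‖ ^ 2 ∂P = C l * relaxation α l t ^ 2 := by
  rw [hC l m hm, mul_comm, ← integral_const_mul]
  congr 1
  funext ω
  rw [homCoeff, norm_mul, mul_pow, Complex.norm_real, Real.norm_eq_abs, sq_abs]

include hC in
theorem angularPowerSpectrum_nonneg (l : ℕ) : 0 ≤ C l := by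
  rw [hC l 0 (by simp)]
  exact integral_nonneg fun ω => sq_nonneg _

variable [IsProbabilityMeasure P]
  (hindep : IndepFun (fun ω (x : S2) => ξ ω x) (fun ω (t : Set.Ici τ) => W t ω) P)

include hα0 hα1 hW hA hξ hindep in
-- The relaxation factor is a real scalar, so the claim reduces to orthogonality of the initial
-- coefficient to the noise increments, which extends to the Wiener integral.
theorem integral_inner_coeff (t : ℝ) (l : ℕ) (m : ℤ) (hm : m ∈ Finset.Icc (-(l : ℤ)) l) :
    ∫ ω, ⟪homCoeff α ξ t l m ω, inhomCoeff P α τ W t l m ω⟫ ∂P = 0 := by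
  by_cases h : t ≤ τ
  · simp [inhomCoeff, h]
  · simp only [inhomCoeff, if_neg h]
    have h1 := (coeffI_isWienerIntegral hα0 hα1 hW hA l hm (not_le.1 h)).integral_inner_eq_zero
      (hW.hasBrownianIncrements hA l hm) (sub_pos.2 (not_le.1 h))
      (memLp_fourierCoeff hξ.measurable hξ.memLp l m)
      (fun s hs => integral_inner_fourierCoeff_increment hξ hW hA hindep l hm hs)
    have e : ∀ ω, ⟪homCoeff α ξ t l m ω, coeffI P α τ W l m t ω⟫ =
        relaxation α l t * ⟪fourierCoeff (ξ ω) l m, coeffI P α τ W l m t ω⟫ := by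
      intro ω
      rw [homCoeff, ← Complex.real_smul, real_inner_smul_left]
    simp only [e]
    rw [integral_const_mul, h1, mul_zero]

include hα0 hα1 hW hA hξ hC hindep in
theorem integral_norm_add_coeff_sq (t : ℝ) (l : ℕ) (m : ℤ) (hm : m ∈ Finset.Icc (-(l : ℤ)) l) :
    ∫ ω, ‖homCoeff α ξ t l m ω + inhomCoeff P α τ W t l m ω‖ ^ 2 ∂P =
      C l * relaxation α l t ^ 2 + A l * noiseVar α τ t l := by
  have h1 := memLp_homCoeff (α := α) hξ t l m
  have h2 := memLp_inhomCoeff hα0 hα1 hW hA t l m hm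
  have h3 := norm_add_sq_real (h1.toLp _) (h2.toLp _)
  rw [← MemLp.toLp_add, norm_toLp_sq, norm_toLp_sq, norm_toLp_sq, inner_toLp,
    integral_inner_coeff hα0 hα1 hW hA hξ hindep t l m hm,
    integral_norm_homCoeff_sq hC t l m hm,
    integral_norm_inhomCoeff_sq hα0 hα1 hW hA t l m hm, mul_zero, add_zero] at h3
  exact h3

include hα0 hα1 hW hA hξ hC hindep in
theorem eLpNorm_sum_layers (t : ℝ) (s : Finset ℕ) :
    eLpNorm (fun z => ∑ l ∈ s, (layerH α ξ l t z + layerI P α τ W l t z)) 2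
      (P.prod sphereMeasure) = ENNReal.ofReal (Real.sqrt (∑ l ∈ s,
        (2 * (l : ℝ) + 1) * (C l * relaxation α l t ^ 2 + A l * noiseVar α τ t l))) := by
  have e : (fun z => ∑ l ∈ s, (layerH α ξ l t z + layerI P α τ W l t z)) = fun z => ∑ l ∈ s,
      randomLayer (fun l m ω => homCoeff α ξ t l m ω + inhomCoeff P α τ W t l m ω) l z := by
    funext z
    apply Finset.sum_congr rfl
    intro l _
    rw [layerI_eq]
    simp only [layerH, randomLayer]
    rw [← Finset.sum_add_distrib]
    simp only [add_mul, homCoeff]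
  have hd : ∀ l : ℕ, ∀ m ∈ Finset.Icc (-(l : ℤ)) l,
      MemLp (fun ω => homCoeff α ξ t l m ω + inhomCoeff P α τ W t l m ω) 2 P := fun l m hm =>
    (memLp_homCoeff hξ t l m).add (memLp_inhomCoeff hα0 hα1 hW hA t l m hm)
  rw [e, eLpNorm_sum_randomLayer hd]
  congr 2
  apply Finset.sum_congr rfl
  intro l _
  rw [Finset.sum_congr rfl fun m hm =>
    integral_norm_add_coeff_sq hα0 hα1 hW hA hξ hC hindep t l m hm, Finset.sum_const, Int.card_Icc,
    nsmul_eq_mul]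
  congr 1
  have : ((l : ℤ) + 1 - -(l : ℤ)).toNat = 2 * l + 1 := by omega
  rw [this]
  push_cast; ring

variable {κ₁ κ₂ Dt Ct Kt At : ℝ} (hκ₁ : 2 < κ₁) (hκ₂ : 2 < κ₂)
  (hCdecay : AlgebraicDecay C Dt Ct κ₁) (hAdecay : AlgebraicDecay A Kt At κ₂)

include hα0 hα1 hW hA hξ hC hκ₁ hκ₂ hCdecay hAdecay in
theorem exists_isSolution : ∃ U, IsSolution P α τ ξ W U := by
  have card : ∀ l : ℕ, (((Finset.Icc (-(l : ℤ)) l).card : ℕ) : ℝ) = 2 * (l : ℝ) + 1 := by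
    intro l
    have : ((l : ℤ) + 1 - -(l : ℤ)).toNat = 2 * l + 1 := by omega
    rw [Int.card_Icc, this]
    push_cast; ring
  have hC0 := angularPowerSpectrum_nonneg hC
  have hH : ∀ t, 0 < t → ∃ F, IsL2Sum P (fun l => layerH α ξ l t) F := by
    intro t ht
    refine exists_isL2Sum (d := homCoeff α ξ t) (fun l m _ => memLp_homCoeff hξ t l m)
      (summable_decay hCdecay hC0 hκ₁) fun l => ?_
    rw [Finset.sum_congr rfl fun m hm => integral_norm_homCoeff_sq hC t l m hm, Finset.sum_const,
      nsmul_eq_mul, card]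
    have := mul_le_mul_of_nonneg_left (relaxation_sq_le_one hα0 hα1 l ht.le) (hC0 l)
    rw [mul_one] at this
    gcongr
  have hI : ∀ t, 0 < t → ∃ F, IsL2Sum P (fun l => layerI P α τ W l t) F := by
    intro t _
    simp only [layerI_eq]
    refine exists_isL2Sum (d := inhomCoeff P α τ W t) (fun l m hm => memLp_inhomCoeff hα0 hα1 hW hA t l m hm)
      -- The maximum covers both `t ≤ τ`, where the layers vanish, and `t > τ`, where the variance
      -- is at most the elapsed time.
      ((summable_decay hAdecay (fun l => (hA l).1) hκ₂).mul_right (max (t - τ) 0)) fun l => ?_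
    rw [Finset.sum_congr rfl fun m hm => integral_norm_inhomCoeff_sq hα0 hα1 hW hA t l m hm,
      Finset.sum_const, nsmul_eq_mul, card, mul_assoc]
    have hA0 := (hA l).1
    have : noiseVar α τ t l ≤ max (t - τ) 0 := by
      unfold noiseVar
      split_ifs with h
      · exact le_max_right _ _
      · exact (relaxVar_le hα0 hα1 l (by linarith)).trans (le_max_left _ _)
    gcongr
  choose! UH hUH using hH
  choose! UI hUI using hI
  exact ⟨fun t => UH t + UI t, UH, UI, fun t ht => ⟨hUH t ht, hUI t ht, rfl⟩⟩

include hα0 hα1 hW hA hξ hC hindep hκ₁ hκ₂ hCdecay hAdecay in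
/-- The truncation error in terms of bounds for the relaxation functions. -/
theorem truncationError_le (hCt : 0 < Ct) (hAt : 0 < At) {U : ℝ → Ω × S2 → ℂ}
    (hU : IsSolution P α τ ξ W U) {L : ℕ} (hL : 1 ≤ L) {t : ℝ} (ht : 0 < t) {h i : ℝ}
    (hh : ∀ l, L ≤ l → relaxation α l t ^ 2 ≤ h) (hi0 : 0 ≤ i)
    (hi : ∀ l, L ≤ l → τ < t → relaxVar α l (t - τ) ≤ i) :
    truncationError P α τ ξ W U L t ≤ ENNReal.ofReal (Real.sqrt
      (h * (decayConst Ct κ₁ ^ 2 * (L : ℝ) ^ (2 - κ₁)) +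
        i * (decayConst At κ₂ ^ 2 * (L : ℝ) ^ (2 - κ₂)))) := by
  obtain ⟨UH, UI, hU⟩ := hU
  obtain ⟨hH, hI, hUt⟩ := hU t ht
  have hC0 := angularPowerSpectrum_nonneg hC
  have hh0 : 0 ≤ h := (sq_nonneg _).trans (hh L le_rfl)
  rw [truncationError, hUt]
  refine hH.eLpNorm_add_sub_le hI L fun N _ => ?_
  rw [eLpNorm_sum_layers hα0 hα1 hW hA hξ hC hindep]
  apply ENNReal.ofReal_le_ofReal
  apply Real.sqrt_le_sqrt
  have s1 := mul_le_mul_of_nonneg_left (sum_decay_le hCdecay hCt hκ₁ hL N) hh0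
  have s2 := mul_le_mul_of_nonneg_left (sum_decay_le hAdecay hAt hκ₂ hL N) hi0
  refine le_trans ?_ (add_le_add s1 s2)
  rw [Finset.mul_sum, Finset.mul_sum, ← Finset.sum_add_distrib]
  apply Finset.sum_le_sum
  intro l hl
  have hLl : L ≤ l := by have := (Finset.mem_Ico.1 hl).1; omega
  have hn : noiseVar α τ t l ≤ i := by
    unfold noiseVar
    split_ifs with hc
    · exact hi0
    · exact hi l hLl (not_le.1 hc)
  have k1 := mul_le_mul_of_nonneg_left (hh l hLl) (hC0 l)
  have k2 := mul_le_mul_of_nonneg_left hn (hA l).1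
  have hl0 : (0 : ℝ) ≤ 2 * (l : ℝ) + 1 := by positivity
  calc _ ≤ (2 * (l : ℝ) + 1) * (C l * h + A l * i) := by gcongr
    _ = _ := by ring

end Coefficients

/-- Merges two decay rates into the slower one; `k` is later a minimum of two exponents. -/
theorem sqrt_mul_rpow_neg_le {x y a b s k : ℝ} {L : ℕ} (hL : 1 ≤ L) (hx : 0 ≤ x) (hy : 0 ≤ y)
    (hs : s = x + y) (ha : a ≤ -k) (hb : b ≤ -k) :
    Real.sqrt (x * (L : ℝ) ^ a + y * (L : ℝ) ^ b) ≤ Real.sqrt s * (L : ℝ) ^ (-(k / 2)) := by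
  have hL1 : (1 : ℝ) ≤ L := by exact_mod_cast hL
  have hL0 : (0 : ℝ) < L := by linarith
  have e : ((L : ℝ) ^ (-(k / 2))) = Real.sqrt ((L : ℝ) ^ (-k)) := by
    rw [Real.sqrt_eq_rpow, ← Real.rpow_mul hL0.le]
    congr 1; ring
  rw [e, ← Real.sqrt_mul (by rw [hs]; positivity)]
  apply Real.sqrt_le_sqrt
  rw [hs, add_mul]
  have h1 := Real.rpow_le_rpow_of_exponent_le hL1 ha
  have h2 := Real.rpow_le_rpow_of_exponent_le hL1 hb
  gcongr

end Main

end SphereSPDE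

end

/-! ### Assembly of the three time regimes. -/

theorem theorem5p3 {Ω : Type*} [MeasurableSpace Ω] (P : Measure Ω) [IsProbabilityMeasure P]
    (α τ : ℝ) (hα0 : 0 < α) (hα1 : α ≤ 1) (hτ : 0 ≤ τ)
    (ξ : Ω → SphereSPDE.S2 → ℝ) (hξ : SphereSPDE.IsIsotropicGaussianField P ξ)
    (C : ℕ → ℝ) (hC : SphereSPDE.IsAngularPowerSpectrum P ξ C)
    (Q : SphereSPDE.SphereL2 →L[ℝ] SphereSPDE.SphereL2)
    (W : ℝ → Ω → SphereSPDE.SphereL2) (hW : SphereSPDE.IsQWiener P Q τ W)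
    (A : ℕ → ℝ) (hA : SphereSPDE.IsNoiseSpectrum Q A)
    (hindep : IndepFun (fun ω (x : SphereSPDE.S2) => ξ ω x)
      (fun ω (t : Set.Ici τ) => W t ω) P)
    (κ₁ κ₂ Dt Ct Kt At : ℝ) (hκ₁ : 2 < κ₁) (hκ₂ : 2 < κ₂)
    (hDt : 0 < Dt) (hCt : 0 < Ct) (hKt : 0 < Kt) (hAt : 0 < At)
    (hCdecay : SphereSPDE.AlgebraicDecay C Dt Ct κ₁)
    (hAdecay : SphereSPDE.AlgebraicDecay A Kt At κ₂) :
    (∃ U, SphereSPDE.IsSolution P α τ ξ W U) ∧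
    ∀ U, SphereSPDE.IsSolution P α τ ξ W U → ∀ L : ℕ, 1 ≤ L → ∀ t : ℝ,
      (0 < t → t ≤ SphereSPDE.eigenvalue L ^ (-(1 / α)) →
        SphereSPDE.eigenvalue L ^ (-(1 / α)) ≤ τ →
        SphereSPDE.truncationError P α τ ξ W U L t ≤
          ENNReal.ofReal (SphereSPDE.decayConst Ct κ₁ * (L : ℝ) ^ (-((κ₁ - 2) / 2)))) ∧
      (SphereSPDE.eigenvalue L ^ (-(1 / α)) < t →
        t ≤ τ + SphereSPDE.eigenvalue L ^ (-(1 / α)) →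
        SphereSPDE.truncationError P α τ ξ W U L t ≤
          ENNReal.ofReal (Real.sqrt ((SphereSPDE.psiH α t * SphereSPDE.decayConst Ct κ₁) ^ 2 +
              SphereSPDE.decayConst At κ₂ ^ 2) *
            (L : ℝ) ^ (-(SphereSPDE.kappaHat α κ₁ κ₂ / 2)))) ∧
      (τ + SphereSPDE.eigenvalue L ^ (-(1 / α)) < t →
        SphereSPDE.truncationError P α τ ξ W U L t ≤
          ENNReal.ofReal (Real.sqrt ((SphereSPDE.psiH α t * SphereSPDE.decayConst Ct κ₁) ^ 2 +
              (SphereSPDE.psiI α (t - τ) * SphereSPDE.decayConst At κ₂) ^ 2) *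
            (L : ℝ) ^ (-(SphereSPDE.kappaFull α κ₁ κ₂ / 2)))) := by
  have hsol := SphereSPDE.exists_isSolution hα0 hα1 hW hA hξ hC hκ₁ hκ₂ hCdecay hAdecay
  refine ⟨hsol, fun U hU L hL t => ?_⟩
  have hL0 : (0 : ℝ) < L := by exact_mod_cast hL
  have hlam := Real.rpow_pos_of_pos (SphereSPDE.eigenvalue_pos hL) (-(1 / α))
  have hrpow : ∀ a b : ℝ, (L : ℝ) ^ a * (L : ℝ) ^ b = (L : ℝ) ^ (a + b) := fun a b =>
    (Real.rpow_add hL0 a b).symm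
  have hdec : 0 ≤ SphereSPDE.decayConst Ct κ₁ := Real.sqrt_nonneg _
  refine ⟨fun ht htL hτL => ?_, fun htL htτ => ?_, fun htL => ?_⟩
  -- Here `t ≤ τ`: the noise has not started, so `i = 0`, and only `E_α ≤ 1` is used.
  · refine (SphereSPDE.truncationError_le hα0 hα1 hW hA hξ hC hindep hκ₁ hκ₂ hCdecay hAdecay
      hCt hAt hU hL ht (h := 1) (i := 0)
      (fun l _ => SphereSPDE.relaxation_sq_le_one hα0 hα1 l ht.le) le_rfl
      (fun l _ h => absurd h (not_lt.2 (htL.trans hτL)))).trans (ENNReal.ofReal_le_ofReal ?_)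
    have := SphereSPDE.sqrt_mul_rpow_neg_le (x := SphereSPDE.decayConst Ct κ₁ ^ 2) (y := 0)
      (a := 2 - κ₁) (b := 2 - κ₁) (k := κ₁ - 2) hL (sq_nonneg _) le_rfl rfl (by linarith)
      (by linarith)
    rw [add_zero, Real.sqrt_sq hdec] at this
    simpa using this
  -- The noise has acted for at most `λ_L^{-1/α} ≤ L^{-2/α}`, so its variance factor is bounded by
  -- the elapsed time; the initial part already decays like `L^{-4}`.
  · have ht : 0 < t := hlam.trans htL
    refine (SphereSPDE.truncationError_le hα0 hα1 hW hA hξ hC hindep hκ₁ hκ₂ hCdecay hAdecay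
      hCt hAt hU hL ht (h := SphereSPDE.psiH α t ^ 2 * (L : ℝ) ^ (-4 : ℝ))
      (i := (L : ℝ) ^ (-(2 * (1 / α))))
      (fun l hl => SphereSPDE.relaxation_sq_le_psiH hα0 hα1 hL hl ht) (by positivity)
      (fun l hl h => (SphereSPDE.relaxVar_le hα0 hα1 l (by linarith)).trans
        ((show t - τ ≤ _ by linarith).trans
          (SphereSPDE.eigenvalue_rpow_neg_le hL le_rfl (by positivity))))).trans
      (ENNReal.ofReal_le_ofReal ?_)
    rw [show SphereSPDE.psiH α t ^ 2 * (L : ℝ) ^ (-4 : ℝ) *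
        (SphereSPDE.decayConst Ct κ₁ ^ 2 * (L : ℝ) ^ (2 - κ₁)) +
        (L : ℝ) ^ (-(2 * (1 / α))) * (SphereSPDE.decayConst At κ₂ ^ 2 * (L : ℝ) ^ (2 - κ₂)) =
        (SphereSPDE.psiH α t * SphereSPDE.decayConst Ct κ₁) ^ 2 * (L : ℝ) ^ (-4 + (2 - κ₁)) +
        SphereSPDE.decayConst At κ₂ ^ 2 * (L : ℝ) ^ (-(2 * (1 / α)) + (2 - κ₂)) by
      rw [← hrpow, ← hrpow]; ring]
    refine SphereSPDE.sqrt_mul_rpow_neg_le hL (sq_nonneg _) (sq_nonneg _) rfl ?_ ?_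
    · have := min_le_left (κ₁ + 2) (κ₂ + 2 / α - 2)
      rw [SphereSPDE.kappaHat]; linarith
    · have := min_le_right (κ₁ + 2) (κ₂ + 2 / α - 2)
      have e : 2 * (1 / α) = 2 / α := by ring
      rw [SphereSPDE.kappaHat, e]; linarith
  -- The noise has acted beyond the crossover time, so the split estimate `relaxVar_le_psiI` takes
  -- over.
  · have ht : 0 < t := by linarith
    refine (SphereSPDE.truncationError_le hα0 hα1 hW hA hξ hC hindep hκ₁ hκ₂ hCdecay hAdecay
      hCt hAt hU hL ht (h := SphereSPDE.psiH α t ^ 2 * (L : ℝ) ^ (-4 : ℝ))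
      (i := SphereSPDE.psiI α (t - τ) ^ 2 * (L : ℝ) ^ (-(SphereSPDE.gammaExp α κ₂ - κ₂ + 2)))
      (fun l hl => SphereSPDE.relaxation_sq_le_psiH hα0 hα1 hL hl ht) (by positivity)
      (fun l hl h => SphereSPDE.relaxVar_le_psiI hα0 hα1 hL hl (by linarith) κ₂)).trans
      (ENNReal.ofReal_le_ofReal ?_)
    rw [show SphereSPDE.psiH α t ^ 2 * (L : ℝ) ^ (-4 : ℝ) *
        (SphereSPDE.decayConst Ct κ₁ ^ 2 * (L : ℝ) ^ (2 - κ₁)) +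
        SphereSPDE.psiI α (t - τ) ^ 2 * (L : ℝ) ^ (-(SphereSPDE.gammaExp α κ₂ - κ₂ + 2)) *
          (SphereSPDE.decayConst At κ₂ ^ 2 * (L : ℝ) ^ (2 - κ₂)) =
        (SphereSPDE.psiH α t * SphereSPDE.decayConst Ct κ₁) ^ 2 * (L : ℝ) ^ (-4 + (2 - κ₁)) +
        (SphereSPDE.psiI α (t - τ) * SphereSPDE.decayConst At κ₂) ^ 2 *
          (L : ℝ) ^ (-(SphereSPDE.gammaExp α κ₂ - κ₂ + 2) + (2 - κ₂)) by
      rw [← hrpow, ← hrpow]; ring]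
    refine SphereSPDE.sqrt_mul_rpow_neg_le hL (sq_nonneg _) (sq_nonneg _) rfl ?_ ?_
    · have := min_le_left (κ₁ + 2) (SphereSPDE.gammaExp α κ₂)
      rw [SphereSPDE.kappaFull]; linarith
    · have := min_le_right (κ₁ + 2) (SphereSPDE.gammaExp α κ₂)
      rw [SphereSPDE.kappaFull]; linarith
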